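/- Let $K$ be a number field with ring of integers $\mathcal{O}_K$, and let $N(\mathfrak{m}) = |\mathcal{O}_K/\mathfrak{m}|$ for a nonzero ideal $\mathfrak{m}$ of $\mathcal{O}_K$. For a nonzero prime ideal $\mathfrak{p}$, let $n_{\mathfrak{p}}(\mathfrak{m})$ be the exponent of $\mathfrak{p}$ in the factorization of $\mathfrak{m}$. For $i \geq 1$, let $\omega_i(\mathfrak{m})$ be the number of nonzero prime ideals $\mathfrak{p}$ with $n_{\mathfrak{p}}(\mathfrak{m}) = i$, and for a sequence $\mathcal{A} = (a_1, a_2, \ldots)$ let $$\omega_{\mathcal{A}}(\mathfrak{m}) = \sum_{i \geq 1} a_i\, \omega_i(\mathfrak{m}),$$ a finite sum. Consider the following types of sequences, the last one depending on an integer $k \geq 1$: 1. $a_i = 1$ for all $i \geq 1$; 2. $a_i = i$ for all $i \geq 1$; 3. $a_i = \log(i+1)$ for all $i \geq 1$; 4. $a_i = 1$ for all odd $i \geq 1$ and $a_i = -1$ for all even $i \geq 1$; 5. $a_k = 1$ and $a_i = 0$ for all $i \geq 1$ with $i \neq k$. A nonzero ideal $\mathfrak{m}$ is called $k$-full if $n_{\mathfrak{p}}(\mathfrak{m})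 \geq k$ for every prime ideal $\mathfrak{p}$ dividing $\mathfrak{m}$, and $h$-free (for $h \geq 2$) if $n_{\mathfrak{p}}(\mathfrak{m}) \leq h-1$ for every prime ideal $\mathfrak{p}$ dividing $\mathfrak{m}$. For rational $x > 2$, let $\mathcal{N}_k(x)$ and $\mathcal{S}_h(x)$ be the sets of $k$-full and of $h$-free ideals of norm at most $x$. Put $\Phi(a) = \frac{1}{\sqrt{2\pi}} \int_{-\infty}^a e^{-u^2/2}\, du$. (i) Let $k \geq 1$ be an integer and let $\mathcal{A}$ be a sequence of one of the Types 1-5, with this $k$ in Type 5. Then for every $a \in \mathbb{R}$, $$\lim_{x \to \infty} \frac{1}{|\mathcal{N}_k(x)|} \left| \left\{ \mathfrak{m} \in \mathcal{N}_k(x) : N(\mathfrak{m}) \geq 3,\ \frac{\frac{1}{a_k}\omega_{\mathcal{A}}(\mathfrak{m}) - \log\log N(\mathfrak{m})}{\sqrt{\log\log N(\mathfrak{m})}} \leq a \right\} \right| = \Phi(a).$$ (ii) Let $h \geq 2$ be an integer and let $\mathcal{A}$ be a sequence of one of the Types 1-4, or of Type 5 with $k = 1$. Then for every $a \in \mathbb{R}$,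 $$\lim_{x \to \infty} \frac{1}{|\mathcal{S}_h(x)|} \left| \left\{ \mathfrak{m} \in \mathcal{S}_h(x) : N(\mathfrak{m}) \geq 3,\ \frac{\frac{1}{a_1}\omega_{\mathcal{A}}(\mathfrak{m}) - \log\log N(\mathfrak{m})}{\sqrt{\log\log N(\mathfrak{m})}} \leq a \right\} \right| = \Phi(a).$$ -/

import Mathlib

open scoped NumberField
open IsDedekindDomain

noncomputable section

namespace ErdosKac

variable {K : Type*} [Field K] [NumberField K]

/-- The multiplicity `n_𝔭(𝔪)` of the prime ideal `𝔭` in the factorization of the ideal `𝔪`;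
only used for nonzero `𝔪`. The prime ideals are the nonzero ones, i.e. the terms of
`HeightOneSpectrum (𝓞 K)`. -/
def mult (p : HeightOneSpectrum (𝓞 K)) (m : Ideal (𝓞 K)) : ℕ :=
  multiplicity p.asIdeal m

/-- The function `ω_i(𝔪)`, for `i ≥ 1` and nonzero `𝔪`: the number of prime ideals whose
multiplicity in `𝔪` is exactly `i`. -/
def omegaMult (i : ℕ) (m : Ideal (𝓞 K)) : ℕ :=
  {p : HeightOneSpectrum (𝓞 K) | mult p m = i}.ncard

/-- The function `ω_𝒜(𝔪) = ∑_{i ≥ 1} a_i ω_i(𝔪)` attached to the sequence `𝒜 = (a_1, a_2, …)`.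
The value `A 0` is irrelevant. The sum has finite support for every nonzero `𝔪`, see
`omegaSeq_support_finite`. -/
def omegaSeq (A : ℕ → ℝ) (m : Ideal (𝓞 K)) : ℝ :=
  ∑ᶠ (i : ℕ) (_ : 1 ≤ i), A i * (omegaMult i m : ℝ)

/-- The set of `k`-full ideals: the nonzero ideals all of whose prime divisors have multiplicity
at least `k`. For `k = 1` this is the set of all nonzero ideals. -/
def fullIdeals (K : Type*) [Field K] [NumberField K] (k : ℕ) : Set (Ideal (𝓞 K)) :=
  {m | m ≠ ⊥ ∧ ∀ p : HeightOneSpectrum (𝓞 K), p.asIdeal ∣ m → k ≤ mult p m}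

/-- The set of `h`-free ideals: the nonzero ideals all of whose prime divisors have multiplicity
at most `h - 1` (where `h ≥ 2`). -/
def freeIdeals (K : Type*) [Field K] [NumberField K] (h : ℕ) : Set (Ideal (𝓞 K)) :=
  {m | m ≠ ⊥ ∧ ∀ p : HeightOneSpectrum (𝓞 K), p.asIdeal ∣ m → mult p m ≤ h - 1}

/-- `𝒮(x)`: the members of `𝒮` of norm at most `x`. -/
def upTo (S : Set (Ideal (𝓞 K))) (x : ℚ) : Set (Ideal (𝓞 K)) :=
  {m ∈ S | (Ideal.absNorm m : ℚ) ≤ x}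

/-- The ratio `(g(𝔪) - log log N(𝔪)) / √(log log N(𝔪))`; only used for `N(𝔪) ≥ 3`. -/
def ratio (g : Ideal (𝓞 K) → ℝ) (m : Ideal (𝓞 K)) : ℝ :=
  (g m - Real.log (Real.log (Ideal.absNorm m))) / √(Real.log (Real.log (Ideal.absNorm m)))

/-- The proportion of the `𝔪 ∈ 𝒮(x)` with `N(𝔪) ≥ 3` and `ratio g 𝔪 ≤ a`. -/
def density (S : Set (Ideal (𝓞 K))) (g : Ideal (𝓞 K) → ℝ) (a : ℝ) (x : ℚ) : ℝ :=
  1 / ((upTo S x).ncard : ℝ) *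
    ({m ∈ upTo S x | 3 ≤ Ideal.absNorm m ∧ ratio g m ≤ a}.ncard : ℝ)

/-- The standard normal distribution function `Φ`. -/
def Phi (a : ℝ) : ℝ :=
  1 / √(2 * Real.pi) * ∫ u in Set.Iic a, Real.exp (-u ^ 2 / 2)

/-- Type 1: `ω_𝒜 = ω`. -/
def Type1 (A : ℕ → ℝ) : Prop := ∀ i, 1 ≤ i → A i = 1

/-- Type 2: `ω_𝒜 = Ω`. -/
def Type2 (A : ℕ → ℝ) : Prop := ∀ i, 1 ≤ i → A i = i

/-- Type 3: `ω_𝒜 = log d`. -/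
def Type3 (A : ℕ → ℝ) : Prop := ∀ i, 1 ≤ i → A i = Real.log (i + 1)

/-- Type 4: `ω_𝒜` is the number of prime divisors of odd multiplicity minus the number of those of
even multiplicity. -/
def Type4 (A : ℕ → ℝ) : Prop :=
  ∀ i, 1 ≤ i → (Odd i → A i = 1) ∧ (Even i → A i = -1)

/-- Type 5 for `k`: `ω_𝒜 = ω_k`. -/
def Type5 (k : ℕ) (A : ℕ → ℝ) : Prop :=
  A k = 1 ∧ ∀ i, 1 ≤ i → i ≠ k → A i = 0

/-- The sequence `A` is of one of the Types 1-5, the last one with parameter `k`. -/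
def Admissible (k : ℕ) (A : ℕ → ℝ) : Prop :=
  Type1 A ∨ Type2 A ∨ Type3 A ∨ Type4 A ∨ Type5 k A

theorem finite_setOf_mult_eq {m : Ideal (𝓞 K)} (hm : m ≠ ⊥) {i : ℕ} (hi : 1 ≤ i) :
    {p : HeightOneSpectrum (𝓞 K) | mult p m = i}.Finite := by
  refine (Ideal.finite_factors hm).subset fun p hp => ?_
  by_contra h
  have h0 : mult p m = 0 := multiplicity_eq_zero.2 h
  have hp' : mult p m = i := hp
  omega

theorem omegaSeq_support_finite (A : ℕ → ℝ) {m : Ideal (𝓞 K)} (hm : m ≠ ⊥) :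
    {i : ℕ | 1 ≤ i ∧ A i * (omegaMult i m : ℝ) ≠ 0}.Finite := by
  refine ((Ideal.finite_factors hm).image fun p => mult p m).subset ?_
  rintro i ⟨hi, h⟩
  have h1 : omegaMult i m ≠ 0 := by
    intro h0
    simp [h0] at h
  obtain ⟨p, hp⟩ := Set.nonempty_of_ncard_ne_zero h1
  refine ⟨p, ?_, hp⟩
  by_contra hd
  have h0 : mult p m = 0 := multiplicity_eq_zero.2 hd
  have hp' : mult p m = i := hp
  omega

theorem finite_upTo {S : Set (Ideal (𝓞 K))} (x : ℚ) : (upTo S x).Finite := by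
  refine (Ideal.finite_setOfPred_absNorm_le (S := 𝓞 K) ⌊x⌋₊).subset fun m hm => ?_
  exact Nat.le_floor hm.2

end ErdosKac

end

/-! Let `k` be the least exponent allowed: the given `k` for `k`-full ideals, 1 for `h`-free ideals.
An ideal whose exponents lie in a set `E` with minimum `k` is uniquely `a ^ k * b`, where `a` is
squarefree and coprime to `b`, and the exponents of `b` lie in `E \ {k}`. Then ω_𝒜(a^k b) = a_k ω(a)
+ ω_𝒜(b), so for fixed `b` the normalized function is ω(a) plus a constant, and N(a^k b) ≤ y^k means
N(a) ≤ y / N(b)^(1/k). The fibre over `b` has O(y / N(b)^(1/k)) elements, and the sum of N(b)^(-1/k)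
converges because the exponents of `b` exceed `k`. Dominated convergence (`tendsto_sum_exponentSet`)
therefore reduces everything to the Erdős–Kac theorem for ω on squarefree ideals coprime to a fixed
`b`.

That case is sieved out of the set of all ideals. Bounding the exponent at one prime removes the
multiples of a prime power, a dilated copy of the previous set on which ω moves by at most 1, and
neither effect is visible in the limit (`exists_isGaussian_sieved`). Infinitely many primes are
handled by approximation, since the sum of N(p)^(-2) has small tails
(`exists_isGaussian_forall_mult_le`).

For all ideals the characteristic function of ω is computed directly (`tendsto_charFun_idealsLE`).
With s = √(log log y) and w = exp(iτ/s), one drops the primes above z = y^(1/(2R)), where R is of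
order s, expands w^ω in powers of w - 1 up to order R with a Bonferroni-type error, and averages
over ideals. The result is close to exp((w - 1)Λ), where Λ is the sum of 1/N(p) over N(p) ≤ z, and Λ
= s² + o(s) by Mertens. Taylor expansion and Lévy's continuity theorem give the Gaussian law.

The averaging needs the number of ideals of norm at most t as κt + O(t^(1-β))
(`exists_abs_card_idealsLE_sub_le`). This comes from counting lattice points in the fundamental
cone, whose boundary is controlled in logarithmic coordinates. Mertens' estimate follows from the
same count. -/

noncomputable section

namespace ErdosKac

set_option linter.unusedSectionVars false

/-! ### Lattice points and volumes. -/

section LatticeCount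

open MeasureTheory Module

variable {E ι : Type*} [NormedAddCommGroup E] [NormedSpace ℝ E] [Fintype ι] [MeasurableSpace E]
  [BorelSpace E]

/-- The translates of the fundamental domain by distinct lattice points are disjoint, have equal
measure and all lie in `T`. -/
theorem card_mul_measure_fundamentalDomain_le (b : Basis ι ℝ E) (μ : Measure E)
    [μ.IsAddLeftInvariant] (S : Finset E) (hS : ∀ l ∈ S, l ∈ Submodule.span ℤ (Set.range b))
    {T : Set E} (h : ∀ l ∈ S, ∀ y, y - l ∈ ZSpan.fundamentalDomain b → y ∈ T) :
    S.card * μ (ZSpan.fundamentalDomain b) ≤ μ T := by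
  have hm : MeasurableSet (ZSpan.fundamentalDomain b) := ZSpan.fundamentalDomain_measurableSet b
  have key : μ (⋃ l ∈ S, (fun y => -l + y) ⁻¹' ZSpan.fundamentalDomain b) =
      S.card * μ (ZSpan.fundamentalDomain b) := by
    rw [measure_biUnion_finset]
    · simp [measure_preimage_add]
    · intro l hl l' hl' hne
      refine Set.disjoint_left.2 fun y hy hy' => hne ?_
      have h1 := ZSpan.fract_eq_self.2 hy
      have h2 := ZSpan.fract_eq_self.2 hy'
      rw [ZSpan.fract_zSpan_add _ _ (neg_mem (hS l hl))] at h1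
      rw [ZSpan.fract_zSpan_add _ _ (neg_mem (hS l' hl'))] at h2
      have := h1.symm.trans h2
      simpa using this
    · exact fun l _ => (measurable_const_add _) hm
  rw [← key]
  refine measure_mono fun y hy => ?_
  simp only [Set.mem_iUnion, Set.mem_preimage] at hy
  obtain ⟨l, hl, hy⟩ := hy
  exact h l hl y (by rwa [sub_eq_neg_add])

/-- Each `y` lies in the cell translated by its own floor, so the cells at the points of `S` cover
`T`. -/
theorem measure_le_card_mul_measure_fundamentalDomain (b : Basis ι ℝ E) (μ : Measure E)
    [μ.IsAddLeftInvariant] (S : Finset E) {T : Set E} (h : ∀ y ∈ T, (ZSpan.floor b y : E) ∈ S) :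
    μ T ≤ S.card * μ (ZSpan.fundamentalDomain b) := by
  have key : T ⊆ ⋃ l ∈ S, (fun y => -l + y) ⁻¹' ZSpan.fundamentalDomain b := by
    intro y hy
    simp only [Set.mem_iUnion, Set.mem_preimage]
    refine ⟨_, h y hy, ?_⟩
    rw [← sub_eq_neg_add]
    exact ZSpan.fract_mem_fundamentalDomain b y
  refine (measure_mono key).trans ((measure_biUnion_finset_le _ _).trans ?_)
  simp [measure_preimage_add]

end LatticeCount

/-! ### The fundamental cone in logarithmic coordinates. -/

section Regions

open NumberField NumberField.InfinitePlace NumberField.mixedEmbedding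
  NumberField.mixedEmbedding.fundamentalCone NumberField.Units NumberField.Units.dirichletUnitTheorem
  MeasureTheory
open scoped ENNReal

variable (K : Type*) [Field K] [NumberField K]

open scoped Classical in
/-- The box of parameters with logarithmic size at most `a` and unit coordinates in `[l, u)`. -/
def paramBox (a l u : ℝ) : Set (realSpace K) :=
  Set.univ.pi fun w => if w = w₀ then Set.Iic a else Set.Ico l u

/-- The part of the mixed space parametrized by `paramBox K a l u`. -/
def region (a l u : ℝ) : Set (mixedSpace K) :=
  normAtAllPlaces ⁻¹' (expMapBasis '' paramBox K a l u)

variable {K}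

theorem mem_paramBox {a l u : ℝ} {p : realSpace K} :
    p ∈ paramBox K a l u ↔ p w₀ ≤ a ∧ ∀ w, w ≠ w₀ → l ≤ p w ∧ p w < u := by
  simp only [paramBox, Set.mem_univ_pi]
  refine ⟨fun h => ⟨by simpa using h w₀, fun w hw => by simpa [hw] using h w⟩, fun h w => ?_⟩
  by_cases hw : w = w₀
  · subst hw; simpa using h.1
  · simpa [hw] using h.2 w hw

variable (K) in
theorem measurableSet_paramBox (a l u : ℝ) : MeasurableSet (paramBox K a l u) := by
  refine MeasurableSet.univ_pi fun _ ↦ ?_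
  split_ifs
  · exact measurableSet_Iic
  · exact measurableSet_Ico

variable (K) in
theorem setLIntegral_paramBox_exp (a l u : ℝ) {n : ℕ} (hn : 0 < n) :
    ∫⁻ (x : realSpace K) in paramBox K a l u, .ofReal (Real.exp (x w₀ * n)) =
      ENNReal.ofReal (Real.exp (n * a) / n) * ENNReal.ofReal (u - l) ^ rank K := by
  classical
  have hn : 0 < (n : ℝ) := Nat.cast_pos.mpr hn
  rw [volume_pi, paramBox, Measure.restrict_pi_pi, lintegral_eq_lmarginal_univ 0,
    lmarginal_erase' _ (by fun_prop) (Finset.mem_univ w₀), if_pos rfl]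
  simp_rw [Function.update_self, lmarginal, lintegral_const, Measure.pi_univ, if_neg
    (Finset.ne_of_mem_erase (Subtype.prop _)), Measure.restrict_apply_univ, Real.volume_Ico,
    mul_comm _ (n : ℝ)]
  rw [← ofReal_integral_eq_lintegral_ofReal (integrableOn_exp_mul_Iic hn _), integral_exp_mul_Iic
    hn]
  · congr 1
    rw [Finset.prod_const]
    congr 1
    simp [rank]
  · filter_upwards with _ using Real.exp_nonneg _

variable (K) in
theorem measurableSet_region (a l u : ℝ) : MeasurableSet (region K a l u) := by
  refine MeasurableSet.preimage ?_ (continuous_normAtAllPlaces K).measurable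
  exact MeasurableSet.image_of_continuousOn_injOn (measurableSet_paramBox K a l u)
    (continuous_expMapBasis K).continuousOn (injective_expMapBasis K).injOn

open scoped Classical in
variable (K) in
-- The change of variables `expMapBasis` turns the volume into an integral of exp(d x) over the box,
-- where x is the `w₀` coordinate. Comparing with the same formula for `normLeOne` identifies the
-- constant without evaluating it.
theorem volume_region (a l u : ℝ) : volume (region K a l u) =
    volume (normLeOne K) * (ENNReal.ofReal (Real.exp (Module.finrank ℚ K * a)) *
      ENNReal.ofReal (u - l) ^ rank K) := by
  rw [volume_eq_two_pow_mul_two_pi_pow_mul_integral (A := region K a l u)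
    Set.preimage_image_preimage (measurableSet_region K a l u), region,
    normAtAllPlaces_image_preimage_expMapBasis,
    setLIntegral_expMapBasis_image (measurableSet_paramBox K a l u) (by fun_prop)]
  simp_rw [ENNReal.inv_mul_cancel_right
    (Finset.prod_ne_zero_iff.mpr fun _ _ ↦ ENNReal.ofReal_ne_zero_iff.mpr (expMapBasis_pos _ _))
    (ENNReal.prod_ne_top fun _ _ ↦ ENNReal.ofReal_ne_top)]
  rw [volume_eq_two_pow_mul_two_pi_pow_mul_integral (normLeOne_eq_preimage_image K).symm
    (measurableSet_normLeOne K), normLeOne_eq_preimage,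
    normAtAllPlaces_image_preimage_expMapBasis,
    setLIntegral_expMapBasis_image (measurableSet_paramSet K) (by fun_prop)]
  simp_rw [ENNReal.inv_mul_cancel_right
    (Finset.prod_ne_zero_iff.mpr fun _ _ ↦ ENNReal.ofReal_ne_zero_iff.mpr (expMapBasis_pos _ _))
    (ENNReal.prod_ne_top fun _ _ ↦ ENNReal.ofReal_ne_top)]
  rw [setLIntegral_paramSet_exp K Module.finrank_pos,
    setLIntegral_paramBox_exp K a l u Module.finrank_pos]
  have hd : ENNReal.ofReal (Real.exp (Module.finrank ℚ K * a) / Module.finrank ℚ K) =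
      (Module.finrank ℚ K : ℝ≥0∞)⁻¹ * ENNReal.ofReal (Real.exp (Module.finrank ℚ K * a)) := by
    rw [div_eq_inv_mul, ENNReal.ofReal_mul (by positivity), ENNReal.ofReal_inv_of_pos
      (Nat.cast_pos.mpr Module.finrank_pos), ENNReal.ofReal_natCast]
  rw [hd]
  simp only [mul_assoc]

/-- Scaling by exp(-a) shifts the `w₀` coordinate by -a and fixes the unit coordinates, which
reduces to the description of `normLeOne`. -/
theorem mem_region_iff {a : ℝ} {x : mixedSpace K} :
    x ∈ region K a 0 1 ↔ x ∈ fundamentalCone K ∧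
      mixedEmbedding.norm x ≤ Real.exp (Module.finrank ℚ K * a) := by
  classical
  have h1 : x ∈ fundamentalCone K ∧ mixedEmbedding.norm x ≤ Real.exp (Module.finrank ℚ K * a) ↔
      Real.exp (-a) • x ∈ normLeOne K := by
    rw [mem_normLeOne, smul_mem_iff_mem (Real.exp_ne_zero _), NumberField.mixedEmbedding.norm_smul,
      abs_of_pos (Real.exp_pos _), ← Real.exp_nat_mul, mul_neg, Real.exp_neg,
      inv_mul_le_iff₀ (Real.exp_pos _), mul_one]
  rw [h1, normLeOne_eq_preimage, region, Set.mem_preimage, Set.mem_preimage]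
  have h2 : normAtAllPlaces (Real.exp (-a) • x) = Real.exp (-a) • normAtAllPlaces x := by
    ext w
    simp [normAtAllPlaces_apply, normAtPlace_smul]
  have h3 (c : ℝ) (p : realSpace K) : Real.exp c • expMapBasis p =
      expMapBasis (fun w => if w = w₀ then c + p w else p w) := by
    rw [expMapBasis_apply'' p, expMapBasis_apply'' (fun w => if w = w₀ then c + p w else p w),
      smul_smul, ← Real.exp_add]
    simp only [if_true]
    congr 2
    ext w; split_ifs <;> rfl
  rw [h2]
  constructor
  · rintro ⟨p, hp, hpx⟩
    rw [mem_paramBox] at hp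
    refine ⟨_, ?_, (h3 (-a) p).symm.trans (by rw [hpx])⟩
    simp only [Set.mem_univ_pi]
    intro w
    split_ifs with hw
    · subst hw; simpa using hp.1
    · exact hp.2 w hw
  · rintro ⟨p, hp, hpx⟩
    simp only [Set.mem_univ_pi] at hp
    refine ⟨fun w => if w = w₀ then a + p w else p w, ?_, ?_⟩
    · rw [mem_paramBox]
      refine ⟨by simpa using hp w₀, fun w hw => by simpa [hw] using hp w⟩
    · rw [← h3, hpx, smul_smul, ← Real.exp_add]
      simp

theorem abs_log_sub_log_le {u v c : ℝ} (hc : 0 < c) (hu : c ≤ u) (hv : c ≤ v) :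
    |Real.log u - Real.log v| ≤ |u - v| / c := by
  have key {u v : ℝ} (hu : c ≤ u) (hv : c ≤ v) : Real.log u - Real.log v ≤ |u - v| / c := by
    have hu' := hc.trans_le hu
    have hv' := hc.trans_le hv
    rw [← Real.log_div hu'.ne' hv'.ne']
    calc Real.log (u / v) ≤ u / v - 1 := Real.log_le_sub_one_of_pos (by positivity)
      _ = (u - v) / v := by field_simp
      _ ≤ |u - v| / v := by gcongr; exact le_abs_self _
      _ ≤ |u - v| / c := by gcongr
  rw [abs_le]
  have := key hv hu
  rw [abs_sub_comm] at this
  exact ⟨by linarith, key hu hv⟩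

open scoped Classical in
theorem abs_normAtPlace_sub_le (w : InfinitePlace K) (x y : mixedSpace K) :
    |normAtPlace w x - normAtPlace w y| ≤ ‖x - y‖ := by
  have hn (z : mixedSpace K) : normAtPlace w z ≤ ‖z‖ := by
    rw [norm_eq_sup'_normAtPlace]
    exact Finset.le_sup' (fun w => normAtPlace w z) (Finset.mem_univ w)
  have h1 := normAtPlace_add_le w (x - y) y
  have h2 := normAtPlace_add_le w (y - x) x
  rw [sub_add_cancel] at h1 h2
  have h3 := hn (x - y)
  have h4 := hn (y - x)
  rw [norm_sub_rev] at h4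
  rw [abs_le]
  constructor <;> linarith

variable (K) in
-- The `w₀` coordinate only contributes the factor exp(p w₀); what remains is positive and
-- continuous on a compact box. The range [-1, 2] leaves room around the unit box [0, 1) for
-- perturbations.
theorem exists_lower_bound_expMapBasis : ∃ m > 0, ∀ p : realSpace K,
    (∀ w, w ≠ w₀ → -1 ≤ p w ∧ p w ≤ 2) → ∀ w, m * Real.exp (p w₀) ≤ expMapBasis p w := by
  classical
  let Q : Set (realSpace K) := Set.univ.pi fun w => if w = w₀ then {0} else Set.Icc (-1) 2
  have hQ : IsCompact Q := isCompact_univ_pi fun w => by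
    split_ifs
    · exact isCompact_singleton
    · exact isCompact_Icc
  have hne : Q.Nonempty := ⟨0, fun w _ => by
    by_cases hw : w = w₀ <;> simp [hw]⟩
  have hmin (w : InfinitePlace K) : ∃ c > 0, ∀ p ∈ Q, c ≤ expMapBasis p w := by
    obtain ⟨p₀, hp₀, h⟩ := hQ.exists_isMinOn hne (f := fun p => expMapBasis p w)
      ((continuous_apply w).comp (continuous_expMapBasis K)).continuousOn
    exact ⟨_, expMapBasis_pos p₀ w, fun p hp => h hp⟩
  choose c hc hcp using hmin
  refine ⟨Finset.univ.inf' ⟨w₀, Finset.mem_univ _⟩ c, (Finset.lt_inf'_iff _).2 fun w _ => hc w,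
    fun p hp w => ?_⟩
  rw [expMapBasis_apply'' p, Pi.smul_apply, smul_eq_mul, mul_comm]
  gcongr
  refine (Finset.inf'_le c (Finset.mem_univ w)).trans (hcp w _ fun w' _ => ?_)
  by_cases hw : w' = w₀
  · simp [hw]
  · simpa [hw] using hp w' hw

open scoped Classical in
variable (K) in
-- At logarithmic size at least b every place has absolute value of order at least exp(b), so a
-- displacement of length R is a relative change R exp(-b), and the logarithmic coordinates move by
-- that order.
theorem exists_expMapBasis_perturb : ∃ M > 0, ∃ c > 0, ∀ R b : ℝ, R * Real.exp (-b) ≤ c →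
    ∀ p : realSpace K, b ≤ p w₀ → (∀ w, w ≠ w₀ → -1 ≤ p w ∧ p w ≤ 2) → ∀ x y : mixedSpace K,
    normAtAllPlaces x = expMapBasis p → ‖x - y‖ ≤ R →
    ∃ q, normAtAllPlaces y = expMapBasis q ∧ ∀ w, |q w - p w| ≤ M * (R * Real.exp (-b)) := by
  obtain ⟨m, hm, hlow⟩ := exists_lower_bound_expMapBasis K
  let e := (completeBasis K).equivFunL
  obtain ⟨B, hB⟩ : ∃ B, 0 < B ∧ ∀ v : realSpace K, ‖e v‖ ≤ B * ‖v‖ :=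
    ⟨‖(e : realSpace K →L[ℝ] realSpace K)‖ + 1, by positivity, fun v =>
      ((e : realSpace K →L[ℝ] realSpace K).le_opNorm v).trans (by gcongr; linarith)⟩
  -- `B` bounds the change of basis, 2 the multiplicity of a place, and `2 / m` comes from the slope
  -- of the logarithm. The choice `m / 2` keeps each place of `y` above half the lower bound.
  refine ⟨B * (2 * (2 / m)), mul_pos hB.1 (by positivity), m / 2, by positivity, ?_⟩
  intro R b hR p hb hp x y hx hxy
  have hpos := Real.exp_pos b
  have hR' : R ≤ m / 2 * Real.exp b := by
    rwa [Real.exp_neg, ← div_eq_mul_inv, div_le_iff₀ hpos] at hR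
  have hxw (w : InfinitePlace K) : m * Real.exp b ≤ normAtPlace w x := by
    rw [← normAtAllPlaces_apply, hx]
    refine le_trans ?_ (hlow p hp w)
    gcongr
  have hd (w : InfinitePlace K) := (abs_normAtPlace_sub_le w x y).trans hxy
  have hyw (w : InfinitePlace K) : m / 2 * Real.exp b ≤ normAtPlace w y := by
    have h1 := (abs_le.1 (hd w)).2
    have h2 := hxw w
    nlinarith
  have hc : 0 < m / 2 * Real.exp b := by positivity
  refine ⟨e (expMap.symm (normAtAllPlaces y)), ?_, fun w => ?_⟩
  · rw [expMapBasis_apply]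
    change _ = expMap (e.symm (e _))
    rw [e.symm_apply_apply, expMap.right_inv]
    rw [expMap_target]
    exact fun w _ => hc.trans_le (by rw [normAtAllPlaces_apply]; exact hyw w)
  · have hpe : p = e (expMap.symm (normAtAllPlaces x)) := by
      rw [hx, expMapBasis_apply, expMap.left_inv (by rw [expMap_source]; trivial)]
      exact (e.apply_symm_apply p).symm
    have h1 : |(e (expMap.symm (normAtAllPlaces y))) w - p w| ≤
        ‖e (expMap.symm (normAtAllPlaces y) - expMap.symm (normAtAllPlaces x))‖ := by
      rw [map_sub, ← hpe]
      exact norm_le_pi_norm (e (expMap.symm (normAtAllPlaces y)) - p) w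
    refine h1.trans ((hB.2 _).trans ?_)
    rw [mul_assoc]
    refine mul_le_mul_of_nonneg_left ?_ hB.1.le
    refine (pi_norm_le_iff_of_nonempty _).2 fun v => ?_
    rw [Pi.sub_apply, expMap_symm_apply, expMap_symm_apply, ← mul_sub, norm_mul, Real.norm_eq_abs,
      Real.norm_eq_abs, Nat.abs_cast, normAtAllPlaces_apply, normAtAllPlaces_apply, mul_assoc]
    have h2 : (v.mult : ℝ) ≤ 2 := by
      rw [InfinitePlace.mult]; split_ifs <;> norm_num
    refine mul_le_mul h2 ?_ (abs_nonneg _) zero_le_two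
    refine (abs_log_sub_log_le hc (hyw v) ((hxw v).trans' (by nlinarith))).trans ?_
    rw [abs_sub_comm, Real.exp_neg]
    calc |normAtPlace v x - normAtPlace v y| / (m / 2 * Real.exp b)
        ≤ R / (m / 2 * Real.exp b) := by gcongr; exact hd v
      _ = 2 / m * (R * (Real.exp b)⁻¹) := by field_simp

end Regions

/-! ### Lattice points in the cone, with an error term. -/

section IdealLatticeCount

open NumberField NumberField.InfinitePlace NumberField.mixedEmbedding
  NumberField.mixedEmbedding.fundamentalCone NumberField.Units NumberField.Units.dirichletUnitTheorem
  MeasureTheory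
open scoped ENNReal nonZeroDivisors

variable {K : Type*} [Field K] [NumberField K]

/-- The points of the lattice of the ideal `J` in the region of logarithmic size at most `a` of the
fundamental cone. -/
def latticePoints (J : (Ideal (𝓞 K))⁰) (a : ℝ) : Set (mixedSpace K) :=
  region K a 0 1 ∩ (mixedEmbedding.idealLattice K (FractionalIdeal.mk0 K J) : Set (mixedSpace K))

open scoped Classical in
variable (K) in
theorem isBounded_region (a : ℝ) : Bornology.IsBounded (region K a 0 1) := by
  obtain ⟨C, hC⟩ := isBounded_iff_forall_norm_le.mp (isBounded_normLeOne K)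
  refine isBounded_iff_forall_norm_le.mpr ⟨Real.exp a * C, fun x hx => ?_⟩
  rw [mem_region_iff] at hx
  have h : Real.exp (-a) • x ∈ normLeOne K := by
    rw [mem_normLeOne, smul_mem_iff_mem (Real.exp_ne_zero _), NumberField.mixedEmbedding.norm_smul,
      abs_of_pos (Real.exp_pos _), ← Real.exp_nat_mul, mul_neg, Real.exp_neg,
      inv_mul_le_iff₀ (Real.exp_pos _), mul_one]
    exact hx
  have := hC _ h
  rw [_root_.norm_smul, Real.norm_of_nonneg (Real.exp_nonneg _), Real.exp_neg,
    inv_mul_le_iff₀ (Real.exp_pos _)] at this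
  exact this

theorem finite_latticePoints (J : (Ideal (𝓞 K))⁰) (a : ℝ) : (latticePoints J a).Finite := by
  classical
  rw [latticePoints, ← span_idealLatticeBasis]
  exact ZSpan.setFinite_inter _ (isBounded_region K a)

theorem region_mono {a a' l u : ℝ} (h : a ≤ a') : region K a l u ⊆ region K a' l u :=
  Set.preimage_mono (Set.image_mono fun p hp => by
    rw [mem_paramBox] at hp ⊢
    exact ⟨hp.1.trans h, hp.2⟩)

open scoped Classical in
-- A cell at a point of logarithmic size above a/2 has bounded diameter, hence stays in the region
-- with every logarithmic coordinate relaxed by O(exp(-a/2)). Closer to the origin the chart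
-- distorts too much, so the part of size at most a/2 is split off and kept as an error.
theorem exists_latticePoints_bounds (J : (Ideal (𝓞 K))⁰) : ∃ M > 0, ∃ a₀ > 0, ∀ a, a₀ ≤ a →
    ((latticePoints J a).ncard : ℝ≥0∞) *
        volume (ZSpan.fundamentalDomain (fractionalIdealLatticeBasis K (FractionalIdeal.mk0 K J))) ≤
      (latticePoints J (a / 2)).ncard *
        volume (ZSpan.fundamentalDomain (fractionalIdealLatticeBasis K (FractionalIdeal.mk0 K J)))
      + volume (region K (a + M * Real.exp (-(a / 2))) (-(M * Real.exp (-(a / 2))))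
          (1 + M * Real.exp (-(a / 2)))) ∧
    volume (region K (a - M * Real.exp (-(a / 2))) (M * Real.exp (-(a / 2)))
          (1 - M * Real.exp (-(a / 2)))) ≤
      volume (region K (a / 2) 0 1) + ((latticePoints J a).ncard : ℝ≥0∞) *
        volume (ZSpan.fundamentalDomain (fractionalIdealLatticeBasis K (FractionalIdeal.mk0 K J)))
        := by
  obtain ⟨M, hM, c, hc, hpert⟩ := exists_expMapBasis_perturb K
  set B := fractionalIdealLatticeBasis K (FractionalIdeal.mk0 K J) with hB
  obtain ⟨R, hR0, hR⟩ : ∃ R > 0, ∀ f ∈ ZSpan.fundamentalDomain B, ‖f‖ ≤ R := by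
    obtain ⟨R, hR⟩ := isBounded_iff_forall_norm_le.mp (ZSpan.fundamentalDomain_isBounded B)
    exact ⟨max R 1, by positivity, fun f hf => (hR f hf).trans (le_max_left _ _)⟩
  have hlim : Filter.Tendsto (fun a : ℝ => Real.exp (-(a / 2))) Filter.atTop (nhds 0) :=
    Real.tendsto_exp_neg_atTop_nhds_zero.comp (Filter.tendsto_id.atTop_div_const two_pos)
  have h1 := (hlim.const_mul R).eventually_le_const (u := c) (by simpa using hc)
  have h2 := (hlim.const_mul (M * R)).eventually_le_const (u := 1) (by simp)
  obtain ⟨a₀, ha₀⟩ := Filter.eventually_atTop.1 (h1.and h2)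
  refine ⟨M * R, by positivity, max a₀ 1, by positivity, fun a ha => ?_⟩
  obtain ⟨hac, hη⟩ := ha₀ a ((le_max_left _ _).trans ha)
  set η := M * R * Real.exp (-(a / 2)) with hηdef
  have hη0 : 0 < η := by positivity
  have ha2 : a / 2 ≤ a := by
    have : (1 : ℝ) ≤ a := (le_max_right _ _).trans ha
    linarith
  have hL : ∀ x, x ∈ Submodule.span ℤ (Set.range B) ↔
      x ∈ mixedEmbedding.idealLattice K (FractionalIdeal.mk0 K J) := fun x => by
    rw [hB, span_idealLatticeBasis]
  have hfin := finite_latticePoints J a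
  have hfin2 := finite_latticePoints J (a / 2)
  constructor
  · have hsub : latticePoints J (a / 2) ⊆ latticePoints J a :=
      Set.inter_subset_inter_left _ (region_mono ha2)
    have hup := card_mul_measure_fundamentalDomain_le B volume
      ((hfin.subset (Set.sdiff_subset (t := latticePoints J (a / 2)))).toFinset)
      (T := region K (a + η) (-η) (1 + η)) (fun l hl => by
        rw [hL]; exact ((Set.Finite.mem_toFinset _).1 hl).1.2) (fun l hl y hy => by
        obtain ⟨⟨⟨p, hp, hpl⟩, hlL⟩, hl2⟩ := (Set.Finite.mem_toFinset _).1 hl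
        have hpb := mem_paramBox.1 hp
        have hpa : a / 2 ≤ p w₀ := by
          by_contra hcon
          exact hl2 ⟨⟨p, mem_paramBox.2 ⟨(not_le.1 hcon).le, hpb.2⟩, hpl⟩, hlL⟩
        obtain ⟨q, hq, hqp⟩ := hpert R (a / 2) hac p hpa (fun w hw => by
          have := hpb.2 w hw; constructor <;> linarith) l y hpl.symm (by
            rw [norm_sub_rev]; exact hR _ hy)
        rw [← mul_assoc, ← hηdef] at hqp
        refine ⟨q, mem_paramBox.2 ⟨?_, fun w hw => ?_⟩, hq.symm⟩
        · have := (abs_le.1 (hqp w₀)).2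
          linarith [hpb.1]
        · have := abs_le.1 (hqp w)
          have := hpb.2 w hw
          constructor <;> linarith)
    have hcard : (latticePoints J a).ncard = (latticePoints J (a / 2)).ncard +
        ((hfin.subset (Set.sdiff_subset (t := latticePoints J (a / 2)))).toFinset).card := by
      rw [← Set.ncard_eq_toFinset_card _ (hfin.subset Set.sdiff_subset), add_comm, Set.ncard_sdiff_add_ncard_of_subset hsub hfin]
    rw [hcard, Nat.cast_add, add_mul]
    gcongr
  · have hlow := measure_le_card_mul_measure_fundamentalDomain B volume hfin.toFinset
      (T := region K (a - η) η (1 - η) \ region K (a / 2) 0 1) (fun y hy => by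
        obtain ⟨⟨p, hp, hpy⟩, hy2⟩ := hy
        have hpb := mem_paramBox.1 hp
        have hpa : a / 2 ≤ p w₀ := by
          by_contra hcon
          refine hy2 ⟨p, mem_paramBox.2 ⟨(not_le.1 hcon).le, fun w hw => ?_⟩, hpy⟩
          have := hpb.2 w hw
          constructor <;> linarith
        obtain ⟨q, hq, hqp⟩ := hpert R (a / 2) hac p hpa (fun w hw => by
          have := hpb.2 w hw; constructor <;> linarith) y (ZSpan.floor B y) hpy.symm
            (hR _ (ZSpan.fract_mem_fundamentalDomain B y))
        rw [← mul_assoc, ← hηdef] at hqp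
        rw [Set.Finite.mem_toFinset]
        refine ⟨⟨q, mem_paramBox.2 ⟨?_, fun w hw => ?_⟩, hq.symm⟩, ?_⟩
        · have := (abs_le.1 (hqp w₀)).2
          linarith [hpb.1]
        · have := abs_le.1 (hqp w)
          have := hpb.2 w hw
          constructor <;> linarith
        · exact (hL _).1 (ZSpan.floor B y).2)
    rw [← Set.ncard_eq_toFinset_card _ hfin] at hlow
    refine (measure_mono ?_).trans ((measure_union_le (region K (a / 2) 0 1)
      (region K (a - η) η (1 - η) \ region K (a / 2) 0 1)).trans (by gcongr))
    rw [Set.union_sdiff_self]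
    exact Set.subset_union_right

/-- With d the degree and r the unit rank, this says that relaxing all coordinates by η multiplies
the volume by 1 + O(η). The next inequality is the matching one for shrinking. -/
theorem exp_mul_one_add_pow_le (d r : ℕ) {η : ℝ} (h0 : 0 ≤ η) (h1 : η ≤ 1) :
    Real.exp (d * η) * (1 + 2 * η) ^ r ≤ 1 + (d + 2 * r) * Real.exp (d + 2 * r) * η := by
  have hD : (0 : ℝ) ≤ d + 2 * r := by positivity
  have h2 : (1 + 2 * η) ^ r ≤ Real.exp (r * (2 * η)) := by
    rw [Real.exp_nat_mul]
    gcongr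
    linarith [Real.add_one_le_exp (2 * η)]
  have h3 : Real.exp (d * η) * (1 + 2 * η) ^ r ≤ Real.exp ((d + 2 * r) * η) := by
    refine (mul_le_mul_of_nonneg_left h2 (Real.exp_nonneg _)).trans_eq ?_
    rw [← Real.exp_add]; ring_nf
  refine h3.trans ?_
  have h4 : Real.exp ((d + 2 * r) * η) * (1 - (d + 2 * r) * η) ≤ 1 := by
    have := Real.add_one_le_exp (-((d + 2 * r) * η))
    calc _ ≤ Real.exp ((d + 2 * r) * η) * Real.exp (-((d + 2 * r) * η)) := by
          gcongr; linarith
      _ = 1 := by rw [← Real.exp_add]; simp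
  have h5 : Real.exp ((d + 2 * r) * η) ≤ Real.exp (d + 2 * r) :=
    Real.exp_le_exp.2 (by nlinarith)
  have h6 : Real.exp ((d + 2 * r) * η) * ((d + 2 * r) * η) ≤
      Real.exp (d + 2 * r) * ((d + 2 * r) * η) := by gcongr
  linarith

theorem one_sub_le_exp_mul_one_sub_pow (d r : ℕ) {η : ℝ} (h0 : 0 ≤ η) (h1 : η ≤ 1 / 2) :
    1 - (d + 2 * r) * η ≤ Real.exp (-(d * η)) * (1 - 2 * η) ^ r := by
  have h2 := one_add_mul_le_pow (a := -(2 * η)) (by linarith) r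
  have h3 := Real.add_one_le_exp (-(d * η))
  have h4 : (0 : ℝ) ≤ d * η := by positivity
  have h5 : (0 : ℝ) ≤ r * (2 * η) := by positivity
  have h6 : (0 : ℝ) ≤ (1 - 2 * η) ^ r := pow_nonneg (by linarith) _
  rw [← sub_eq_add_neg] at h2
  by_cases h7 : (d : ℝ) * η ≤ 1
  · have h8 : (-(d * η) + 1) * (1 - 2 * η) ^ r ≤ Real.exp (-(d * η)) * (1 - 2 * η) ^ r := by gcongr
    have h9 : (-(d * η) + 1) * (1 + r * -(2 * η)) ≤ (-(d * η) + 1) * (1 - 2 * η) ^ r :=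
      mul_le_mul_of_nonneg_left h2 (by linarith)
    nlinarith
  · have : (0 : ℝ) ≤ Real.exp (-(d * η)) * (1 - 2 * η) ^ r := by positivity
    nlinarith

open scoped Classical in
/-- The number of lattice points of logarithmic size at most `a` in the fundamental cone is, up to
a power saving, proportional to `exp (d a)`. -/
theorem exists_abs_latticePoints_sub_le (J : (Ideal (𝓞 K))⁰) :
    ∃ v > 0, ∃ M > 0, ∃ a₀ > 0, ∀ a, a₀ ≤ a →
      |(latticePoints J a).ncard * v -
        (volume (normLeOne K)).toReal * Real.exp (Module.finrank ℚ K * a)| ≤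
      M * (Real.exp (Module.finrank ℚ K * a) * Real.exp (-(a / 2))) +
        (latticePoints J (a / 2)).ncard * v + M * Real.exp (Module.finrank ℚ K * (a / 2)) := by
  obtain ⟨M, hM, a₀, ha₀, hb⟩ := exists_latticePoints_bounds J
  set B := fractionalIdealLatticeBasis K (FractionalIdeal.mk0 K J) with hB
  set V := (volume (normLeOne K)).toReal with hV
  set d := Module.finrank ℚ K with hd
  set r := rank K with hr
  have hVfin : volume (normLeOne K) ≠ ⊤ := (isBounded_normLeOne K).measure_lt_top.ne
  have hvfin : volume (ZSpan.fundamentalDomain B) ≠ ⊤ :=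
    (ZSpan.fundamentalDomain_isBounded B).measure_lt_top.ne
  have hv : 0 < (volume (ZSpan.fundamentalDomain B)).toReal :=
    ENNReal.toReal_pos (ZSpan.measure_fundamentalDomain_ne_zero B) hvfin
  set v := (volume (ZSpan.fundamentalDomain B)).toReal with hvdef
  have hV0 : 0 ≤ V := ENNReal.toReal_nonneg
  have hreg (a l u : ℝ) (hlu : l ≤ u) : volume (region K a l u) ≠ ⊤ ∧
      (volume (region K a l u)).toReal = V * (Real.exp (d * a) * (u - l) ^ r) := by
    rw [volume_region]
    refine ⟨ENNReal.mul_ne_top hVfin (ENNReal.mul_ne_top ENNReal.ofReal_ne_top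
      (ENNReal.pow_ne_top ENNReal.ofReal_ne_top)), ?_⟩
    rw [ENNReal.toReal_mul, ENNReal.toReal_mul, ENNReal.toReal_pow, ENNReal.toReal_ofReal
      (Real.exp_nonneg _), ENNReal.toReal_ofReal (by linarith)]
  have hlim : Filter.Tendsto (fun a : ℝ => Real.exp (-(a / 2))) Filter.atTop (nhds 0) :=
    Real.tendsto_exp_neg_atTop_nhds_zero.comp (Filter.tendsto_id.atTop_div_const two_pos)
  obtain ⟨a₁, ha₁⟩ := Filter.eventually_atTop.1
    ((hlim.const_mul M).eventually_le_const (u := 1 / 2) (by simp))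
  set D : ℝ := (d + 2 * r) * Real.exp (d + 2 * r) with hD
  have hD0 : 0 ≤ D := by positivity
  have hDD : (d + 2 * r : ℝ) ≤ D := by
    have : (1 : ℝ) ≤ Real.exp (d + 2 * r) := Real.one_le_exp (by positivity)
    rw [hD]
    exact le_mul_of_one_le_right (by positivity) this
  -- `V * D * M` comes from the volume of the relaxed boundary layer, `V` from the inner region, and
  -- 1 keeps the constant positive.
  refine ⟨v, hv, V * D * M + V + 1, by positivity, max a₀ a₁, by positivity, fun a ha => ?_⟩
  obtain ⟨hup, hlow⟩ := hb a ((le_max_left _ _).trans ha)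
  have hη1 := ha₁ a ((le_max_right _ _).trans ha)
  have hη0 : 0 < M * Real.exp (-(a / 2)) := by positivity
  set η := M * Real.exp (-(a / 2)) with hη
  have hE : 0 < Real.exp (d * a) := Real.exp_pos _
  have hup' : (latticePoints J a).ncard * v ≤ (latticePoints J (a / 2)).ncard * v +
      V * (Real.exp (d * (a + η)) * (1 + 2 * η) ^ r) := by
    have h := ENNReal.toReal_mono (ENNReal.add_ne_top.2
      ⟨ENNReal.mul_ne_top (ENNReal.natCast_ne_top _) hvfin, (hreg _ _ _ (by linarith)).1⟩) hup
    rw [ENNReal.toReal_add (ENNReal.mul_ne_top (ENNReal.natCast_ne_top _) hvfin)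
      (hreg _ _ _ (by linarith)).1, (hreg _ _ _ (by linarith)).2, ENNReal.toReal_mul,
      ENNReal.toReal_mul, ENNReal.toReal_natCast, ENNReal.toReal_natCast] at h
    convert h using 4
    ring
  have hlow' : V * (Real.exp (d * (a - η)) * (1 - 2 * η) ^ r) ≤
      V * Real.exp (d * (a / 2)) + (latticePoints J a).ncard * v := by
    have h := ENNReal.toReal_mono (ENNReal.add_ne_top.2
      ⟨(hreg _ _ _ zero_le_one).1, ENNReal.mul_ne_top (ENNReal.natCast_ne_top _) hvfin⟩) hlow
    rw [ENNReal.toReal_add (hreg _ _ _ zero_le_one).1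
      (ENNReal.mul_ne_top (ENNReal.natCast_ne_top _) hvfin), (hreg _ _ _ zero_le_one).2,
      (hreg _ _ _ (by linarith)).2, ENNReal.toReal_mul, ENNReal.toReal_natCast, sub_zero, one_pow,
      mul_one] at h
    convert h using 4
    ring
  have e1 : Real.exp (d * (a + η)) * (1 + 2 * η) ^ r ≤ Real.exp (d * a) * (1 + D * η) := by
    rw [mul_add, Real.exp_add, mul_assoc]
    gcongr
    exact exp_mul_one_add_pow_le d r hη0.le (by linarith)
  have e2 : Real.exp (d * a) * (1 - D * η) ≤ Real.exp (d * (a - η)) * (1 - 2 * η) ^ r := by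
    rw [show d * (a - η) = d * a + -(d * η) by ring, Real.exp_add, mul_assoc (Real.exp (d * a))]
    refine mul_le_mul_of_nonneg_left ?_ hE.le
    refine le_trans ?_ (one_sub_le_exp_mul_one_sub_pow d r hη0.le hη1)
    have := mul_le_mul_of_nonneg_right hDD hη0.le
    linarith
  have e3 := mul_le_mul_of_nonneg_left e1 hV0
  have e4 := mul_le_mul_of_nonneg_left e2 hV0
  have e5 : V * (Real.exp (d * a) * (D * η)) =
      V * D * M * (Real.exp (d * a) * Real.exp (-(a / 2))) := by
    rw [hη]; ring
  have p1 : 0 < Real.exp (d * a) * Real.exp (-(a / 2)) := by positivity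
  have p2 : 0 < Real.exp (d * (a / 2)) := Real.exp_pos _
  have p3 : 0 ≤ V * D * M := by positivity
  have p4 : 0 ≤ (latticePoints J (a / 2)).ncard * v := by positivity
  rw [abs_le]
  constructor <;> nlinarith [mul_nonneg hV0 p1.le, mul_nonneg p3 p2.le, mul_nonneg hV0 p2.le]

end IdealLatticeCount

/-! ### Counting ideals with a power saving. -/

section IdealCount

open NumberField NumberField.InfinitePlace NumberField.mixedEmbedding
  NumberField.mixedEmbedding.fundamentalCone NumberField.Units NumberField.Units.dirichletUnitTheorem
  Filter Topology Ideal
open scoped nonZeroDivisors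

variable (K : Type*) [Field K] [NumberField K]

theorem finite_nonzero_norm_le (t : ℝ) :
    {m : Ideal (𝓞 K) | m ≠ ⊥ ∧ (Ideal.absNorm m : ℝ) ≤ t}.Finite :=
  (Ideal.finite_setOfPred_absNorm_le (S := 𝓞 K) ⌊t⌋₊).subset fun _ hm => Nat.le_floor hm.2

/-- The finite set of nonzero ideals of norm at most `t`. -/
def idealsLE (t : ℝ) : Finset (Ideal (𝓞 K)) := (finite_nonzero_norm_le K t).toFinset

variable {K}

@[simp]
theorem mem_idealsLE {t : ℝ} {m : Ideal (𝓞 K)} :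
    m ∈ idealsLE K t ↔ m ≠ ⊥ ∧ (Ideal.absNorm m : ℝ) ≤ t := by
  simp [idealsLE]

theorem card_nonZeroDivisors_eq_card_filter (P : Ideal (𝓞 K) → Prop) [DecidablePred P] (t : ℝ) :
    Nat.card {I : (Ideal (𝓞 K))⁰ // P I ∧ (Ideal.absNorm (I : Ideal (𝓞 K)) : ℝ) ≤ t} =
      ((idealsLE K t).filter P).card := by
  rw [← Fintype.card_coe, ← Nat.card_eq_fintype_card]
  refine Nat.card_congr ⟨fun I => ⟨I.1, ?_⟩, fun I => ⟨⟨I.1, ?_⟩, ?_⟩, fun I => rfl, fun I => rfl⟩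
  · rw [Finset.mem_filter, mem_idealsLE]
    exact ⟨⟨mem_nonZeroDivisors_iff_ne_zero.1 I.1.2, I.2.2⟩, I.2.1⟩
  · have := I.2
    rw [Finset.mem_filter, mem_idealsLE] at this
    exact mem_nonZeroDivisors_iff_ne_zero.2 this.1.1
  · have := I.2
    rw [Finset.mem_filter, mem_idealsLE] at this
    exact ⟨this.2, this.1.2⟩

theorem card_nonZeroDivisors_eq_card_idealsLE (t : ℝ) :
    Nat.card {I : (Ideal (𝓞 K))⁰ // (Ideal.absNorm (I : Ideal (𝓞 K)) : ℝ) ≤ t} =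
      (idealsLE K t).card := by
  have := card_nonZeroDivisors_eq_card_filter (K := K) (fun _ => True) t
  simpa using this

theorem card_idealsLE_mono {s t : ℝ} (h : s ≤ t) : (idealsLE K s).card ≤ (idealsLE K t).card :=
  Finset.card_le_card fun m hm => by
    rw [mem_idealsLE] at hm ⊢
    exact ⟨hm.1, hm.2.trans h⟩

variable (K) in
theorem tendsto_card_idealsLE_div : ∃ κ > 0,
    Tendsto (fun t => ((idealsLE K t).card : ℝ) / t) atTop (𝓝 κ) := by
  refine ⟨_, dedekindZeta_residue_pos K, ?_⟩
  rw [dedekindZeta_residue_def]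
  refine (Ideal.tendsto_norm_le_div_atTop₀ K).congr fun t => ?_
  rw [card_nonZeroDivisors_eq_card_idealsLE]

/-- The cone is a fundamental domain for the units modulo torsion, so each principal ideal has
exactly `torsionOrder K` generators in it. -/
theorem card_latticePoints (J : (Ideal (𝓞 K))⁰) (a : ℝ) : (latticePoints J a).ncard =
    Nat.card {I : (Ideal (𝓞 K))⁰ // (J : Ideal (𝓞 K)) ∣ I ∧
      Submodule.IsPrincipal (I : Ideal (𝓞 K)) ∧
      (Ideal.absNorm (I : Ideal (𝓞 K)) : ℝ) ≤ Real.exp (Module.finrank ℚ K * a)} *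
      torsionOrder K := by
  rw [card_isPrincipal_dvd_norm_le, ← Nat.card_coe_set_eq]
  refine Nat.card_congr ((Equiv.subtypeEquivRight fun x => ?_).trans
    (Equiv.subtypeSubtypeEquivSubtypeInter (fun x => x ∈ idealSet K J)
      (fun x => mixedEmbedding.norm x ≤ Real.exp (Module.finrank ℚ K * a))).symm)
  rw [latticePoints, Set.mem_inter_iff, mem_region_iff, idealSet, and_right_comm]
  rfl

/-- Multiplication by an ideal `J` of the inverse class turns the ideals of class `C` and norm at
most s into the principal multiples of `J` of norm at most T = s N(J). The lattice estimate with
exp(d a) = T has relative error exp(-a/2) = T^(-1/(2d)). -/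
theorem exists_abs_card_class_sub_le (C : ClassGroup (𝓞 K)) : ∃ c M s₀ : ℝ, ∀ s, s₀ ≤ s →
    |(Nat.card {I : (Ideal (𝓞 K))⁰ //
        absNorm (I : Ideal (𝓞 K)) ≤ s ∧ ClassGroup.mk0 I = C} : ℝ) - c * s| ≤
      M * s ^ (1 - 1 / (2 * Module.finrank ℚ K : ℝ)) := by
  obtain ⟨J, hJ⟩ := ClassGroup.mk0_surjective C⁻¹
  set d := Module.finrank ℚ K with hd
  have hd1 : (1 : ℝ) ≤ d := by exact_mod_cast Module.finrank_pos
  have hd0 : (0 : ℝ) < d := by linarith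
  set N : ℝ := ((absNorm (J : Ideal (𝓞 K)) : ℕ) : ℝ) with hN
  have hN1 : 1 ≤ N := Nat.one_le_cast.2 (absNorm_pos_of_nonZeroDivisors J)
  have hN0 : 0 < N := by linarith
  set w : ℝ := ((torsionOrder K : ℕ) : ℝ) with hw
  have hw1 : 1 ≤ w := Nat.one_le_cast.2 (torsionOrder_pos K)
  have hcard (s : ℝ) : (Nat.card {I : (Ideal (𝓞 K))⁰ //
      absNorm (I : Ideal (𝓞 K)) ≤ s ∧ ClassGroup.mk0 I = C} : ℕ) =
      Nat.card {I : (Ideal (𝓞 K))⁰ // (J : Ideal (𝓞 K)) ∣ I ∧ Submodule.IsPrincipal (I : Ideal (𝓞 K)) ∧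
        absNorm (I : Ideal (𝓞 K)) ≤ s * N} := by
    simp_rw [← nonZeroDivisors_dvd_iff_dvd_coe]
    refine Nat.card_congr ?_
    refine ((Equiv.dvd J).subtypeEquiv fun I ↦ ?_).trans
      (Equiv.subtypeSubtypeEquivSubtypeInter (fun I : (Ideal (𝓞 K))⁰ ↦ J ∣ I) _)
    rw [← ClassGroup.mk0_eq_one_iff (SetLike.coe_mem _)]
    simp_rw [Equiv.dvd_apply, Submonoid.coe_mul, ← Submonoid.mul_def, _root_.map_mul, hJ,
      inv_mul_eq_one, Nat.cast_mul, mul_comm s, eq_comm, and_comm, and_congr_left_iff]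
    exact fun _ ↦ (mul_le_mul_iff_of_pos_left hN0).symm
  obtain ⟨v, hv, M, hM, a₀, ha₀, h⟩ := exists_abs_latticePoints_sub_le J
  classical
  set V := (MeasureTheory.volume (normLeOne K)).toReal with hV
  obtain ⟨κ, hκ, hlim⟩ := tendsto_card_idealsLE_div K
  obtain ⟨t₀, ht₀⟩ := eventually_atTop.1
    ((hlim.eventually_le_const (lt_add_one κ)).and (eventually_gt_atTop 0))
  refine ⟨V * N / (v * w), (M * N + w * (κ + 1) * v * N + M * N) / (v * w),
    max 1 (max (Real.exp (d * a₀)) (max t₀ 1 ^ 2)), fun s hs => ?_⟩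
  have hs1 : 1 ≤ s := (le_max_left _ _).trans hs
  have hs2 : Real.exp (d * a₀) ≤ s := (le_max_left _ _).trans ((le_max_right _ _).trans hs)
  have hs3 : max t₀ 1 ^ 2 ≤ s := (le_max_right _ _).trans ((le_max_right _ _).trans hs)
  have hs0 : 0 < s := by linarith
  set T := s * N with hT
  have hsT : s ≤ T := le_mul_of_one_le_right hs0.le hN1
  have hT0 : 0 < T := by positivity
  set a := Real.log T / d with ha
  have hda : d * a = Real.log T := by rw [ha]; field_simp
  have haa : a₀ ≤ a := by
    rw [ha, le_div_iff₀ hd0, mul_comm, Real.le_log_iff_exp_le hT0]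
    exact hs2.trans hsT
  have h1 := h a haa
  have hE : Real.exp (d * a) = T := by rw [hda, Real.exp_log hT0]
  have hE2 : Real.exp (d * (a / 2)) = √T := by
    rw [← mul_div_assoc, hda, Real.sqrt_eq_rpow, Real.rpow_def_of_pos hT0]
    ring_nf
  have hn1 : ((latticePoints J a).ncard : ℝ) = Nat.card {I : (Ideal (𝓞 K))⁰ //
      absNorm (I : Ideal (𝓞 K)) ≤ s ∧ ClassGroup.mk0 I = C} * w := by
    rw [hcard, card_latticePoints, Nat.cast_mul, ← hd, hE]
  -- The inner points correspond to ideals of norm at most √T, so the crude linear bound suffices: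
  -- √T is absorbed because 1 - 1/(2d) ≥ 1/2.
  have hn2 : ((latticePoints J (a / 2)).ncard : ℝ) ≤ (κ + 1) * √T * w := by
    rw [card_latticePoints, Nat.cast_mul, ← hd, hE2]
    refine mul_le_mul_of_nonneg_right ?_ (by positivity)
    have h2 : max t₀ 1 ≤ √T := Real.le_sqrt_of_sq_le (hs3.trans hsT)
    have h3 := ht₀ _ ((le_max_left _ _).trans h2)
    rw [div_le_iff₀ h3.2] at h3
    refine le_trans (Nat.cast_le.2 ?_) h3.1
    have := card_nonZeroDivisors_eq_card_filter (K := K) (fun I => (J : Ideal (𝓞 K)) ∣ I ∧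
      Submodule.IsPrincipal (I : Ideal (𝓞 K))) √T
    simp only [and_assoc] at this
    rw [this]
    exact Finset.card_filter_le _ _
  set X := s ^ (1 - 1 / (2 * d : ℝ)) with hX
  have hX0 : 0 ≤ X := Real.rpow_nonneg hs0.le _
  have hsX : √s ≤ X := by
    rw [Real.sqrt_eq_rpow]
    refine Real.rpow_le_rpow_of_exponent_le hs1 ?_
    rw [le_sub_comm, div_le_iff₀ (by positivity)]
    linarith
  have hTX : √T ≤ N * X := by
    rw [hT, mul_comm s, Real.sqrt_mul hN0.le]
    gcongr
    rw [Real.sqrt_le_left hN0.le]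
    nlinarith
  have hTE : Real.exp (d * a) * Real.exp (-(a / 2)) ≤ N * X := by
    have e1 : Real.exp (-(a / 2)) = T ^ (-(1 / (2 * d : ℝ))) := by
      rw [Real.rpow_def_of_pos hT0, ha]
      congr 1
      field_simp
    have e2 : T ^ (-(1 / (2 * d : ℝ))) ≤ s ^ (-(1 / (2 * d : ℝ))) :=
      Real.rpow_le_rpow_of_nonpos hs0 hsT (neg_nonpos.2 (by positivity))
    rw [hE, e1, hX, sub_eq_add_neg, Real.rpow_add hs0, Real.rpow_one, ← mul_assoc, mul_comm N s]
    gcongr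
  rw [hn1, hE, hE2] at h1
  have h2 : |(Nat.card {I : (Ideal (𝓞 K))⁰ //
      absNorm (I : Ideal (𝓞 K)) ≤ s ∧ ClassGroup.mk0 I = C} : ℝ) * w * v - V * T| ≤
      (M * N + w * (κ + 1) * v * N + M * N) * X := by
    refine h1.trans ?_
    have e3 := mul_le_mul_of_nonneg_left hTX hM.le
    rw [hE] at hTE
    have e4 := mul_le_mul_of_nonneg_left hTE hM.le
    have e5 : ((latticePoints J (a / 2)).ncard : ℝ) * v ≤ (κ + 1) * (N * X) * w * v := by
      refine mul_le_mul_of_nonneg_right (hn2.trans ?_) hv.le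
      gcongr
    linarith
  have hvw : 0 < v * w := by positivity
  rw [div_mul_eq_mul_div, div_mul_eq_mul_div, le_div_iff₀ hvw, ← abs_of_pos hvw, ← abs_mul,
    abs_of_pos hvw]
  refine (le_of_eq ?_).trans h2
  congr 1
  rw [sub_mul, div_mul_cancel₀ _ hvw.ne', hT]
  ring

variable (K) in
/-- The number of nonzero ideals of norm at most `t` is `κ t` up to a power saving. -/
theorem exists_abs_card_idealsLE_sub_le : ∃ κ : ℝ, 0 < κ ∧ ∃ β : ℝ, 0 < β ∧ β < 1 ∧
    ∃ M : ℝ, 0 < M ∧ ∀ t : ℝ, 1 ≤ t →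
    |((idealsLE K t).card : ℝ) - κ * t| ≤ M * t ^ (1 - β) := by
  obtain ⟨κ, hκ, hlim⟩ := tendsto_card_idealsLE_div K
  set d := Module.finrank ℚ K with hd
  have hd1 : (1 : ℝ) ≤ d := by exact_mod_cast Module.finrank_pos
  set β : ℝ := 1 / (2 * d : ℝ) with hβ
  have hβ0 : 0 < β := by positivity
  have hβ1 : β < 1 := by
    rw [hβ, div_lt_one (by positivity)]; linarith
  choose c M s₀ h using exists_abs_card_class_sub_le (K := K)
  have hsum (s : ℝ) : ((idealsLE K s).card : ℝ) = ∑ C : ClassGroup (𝓞 K),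
      (Nat.card {I : (Ideal (𝓞 K))⁰ //
        absNorm (I : Ideal (𝓞 K)) ≤ s ∧ ClassGroup.mk0 I = C} : ℝ) := by
    rw [← card_nonZeroDivisors_eq_card_idealsLE, ← Nat.cast_sum]
    congr 1
    have hfin : Finite {I : (Ideal (𝓞 K))⁰ // (absNorm (I : Ideal (𝓞 K)) : ℝ) ≤ s} :=
      Set.Finite.to_subtype (Set.Finite.of_finite_image (f := Subtype.val)
        ((finite_nonzero_norm_le K s).subset (by
          rintro _ ⟨I, hI, rfl⟩
          exact ⟨mem_nonZeroDivisors_iff_ne_zero.1 I.2, hI⟩)) Subtype.val_injective.injOn)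
    rw [Nat.card_congr (Equiv.sigmaFiberEquiv (fun I : {I : (Ideal (𝓞 K))⁰ //
      (absNorm (I : Ideal (𝓞 K)) : ℝ) ≤ s} => ClassGroup.mk0 I.1)).symm, Nat.card_sigma]
    refine Finset.sum_congr rfl fun C _ => Nat.card_congr ?_
    exact Equiv.subtypeSubtypeEquivSubtypeInter
      (fun I : (Ideal (𝓞 K))⁰ ↦ (absNorm I.1 : ℝ) ≤ s) (fun I ↦ ClassGroup.mk0 I = C)
  set c' := ∑ C, c C with hc'
  obtain ⟨S, hS⟩ : ∃ S, ∀ C, s₀ C ≤ S := ⟨∑ C, |s₀ C|, fun C => (le_abs_self _).trans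
    (Finset.single_le_sum (f := fun C => |s₀ C|) (fun _ _ => abs_nonneg _) (Finset.mem_univ C))⟩
  have hbound (s : ℝ) (hs : S ≤ s) :
      |((idealsLE K s).card : ℝ) - c' * s| ≤ (∑ C, M C) * s ^ (1 - β) := by
    rw [hsum, hc', Finset.sum_mul, ← Finset.sum_sub_distrib, Finset.sum_mul]
    exact (Finset.abs_sum_le_sum_abs _ _).trans
      (Finset.sum_le_sum fun C _ => h C s ((hS C).trans hs))
  -- The leading constants of the classes need not be evaluated: their sum is the limit of the count
  -- divided by s, which is the positive residue.
  have hck : c' = κ := by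
    refine tendsto_nhds_unique ?_ hlim
    have h0 : Tendsto (fun s : ℝ => (∑ C, M C) * s ^ (-β)) atTop (𝓝 0) := by
      simpa using (tendsto_rpow_neg_atTop hβ0).const_mul (∑ C, M C)
    rw [tendsto_iff_norm_sub_tendsto_zero]
    refine squeeze_zero' (Eventually.of_forall fun s => norm_nonneg _) ?_ h0
    filter_upwards [eventually_ge_atTop S, eventually_gt_atTop 0] with s hs hs0
    have e1 : ((idealsLE K s).card : ℝ) / s - c' = (((idealsLE K s).card : ℝ) - c' * s) / s := by
      field_simp
    rw [e1, Real.norm_eq_abs, abs_div, abs_of_pos hs0, div_le_iff₀ hs0, mul_assoc,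
      ← Real.rpow_add_one hs0.ne', neg_add_eq_sub]
    exact hbound s hs
  rw [hck] at hbound
  -- The second summand covers 1 ≤ t ≤ S, where count and main term are bounded separately and
  -- t^(1-β) ≥ 1.
  refine ⟨κ, hκ, β, hβ0, hβ1, |∑ C, M C| + ((idealsLE K (max S 1)).card + κ * max S 1), ?_, ?_⟩
  · have : 0 < κ * max S 1 := by positivity
    positivity
  intro t ht
  have ht0 : 0 < t := by linarith
  have hX : 1 ≤ t ^ (1 - β) := Real.one_le_rpow ht (by linarith)
  have hp : 0 < κ * max S 1 := by positivity
  rcases le_total S t with hSt | hSt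
  · refine (hbound t hSt).trans ?_
    gcongr
    have := le_abs_self (∑ C, M C)
    have h3 : (0 : ℝ) ≤ (idealsLE K (max S 1)).card := Nat.cast_nonneg _
    linarith
  · have h1 : ((idealsLE K t).card : ℝ) ≤ (idealsLE K (max S 1)).card :=
      Nat.cast_le.2 (card_idealsLE_mono (hSt.trans (le_max_left _ _)))
    have h2 : κ * t ≤ κ * max S 1 := by
      gcongr; exact hSt.trans (le_max_left _ _)
    have h3 : (0 : ℝ) ≤ (idealsLE K t).card := Nat.cast_nonneg _
    have h4 : 0 < κ * t := by positivity
    calc |((idealsLE K t).card : ℝ) - κ * t| ≤ (idealsLE K (max S 1)).card + κ * max S 1 := by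
          rw [abs_le]; constructor <;> linarith
      _ ≤ |∑ C, M C| + ((idealsLE K (max S 1)).card + κ * max S 1) := by
          linarith [abs_nonneg (∑ C, M C)]
      _ ≤ _ := le_mul_of_one_le_right (by linarith [abs_nonneg (∑ C, M C)]) hX

end IdealCount

/-! ### Multiplicities, divisibility and finite Euler products. -/

section Basics

variable {K : Type*} [Field K] [NumberField K]

/-- The norm of an ideal as a real number. -/
abbrev realNorm (m : Ideal (𝓞 K)) : ℝ := (Ideal.absNorm m : ℝ)

theorem realNorm_mul (a b : Ideal (𝓞 K)) : realNorm (a * b) = realNorm a * realNorm b := by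
  simp [realNorm]

theorem realNorm_pow (a : Ideal (𝓞 K)) (n : ℕ) : realNorm (a ^ n) = realNorm a ^ n := by
  simp [realNorm]

theorem realNorm_prod {ι : Type*} (s : Finset ι) (f : ι → Ideal (𝓞 K)) :
    realNorm (∏ i ∈ s, f i) = ∏ i ∈ s, realNorm (f i) := by
  simp [realNorm]

theorem one_le_realNorm {m : Ideal (𝓞 K)} (hm : m ≠ ⊥) : 1 ≤ realNorm m := by
  rw [realNorm, Nat.one_le_cast, Nat.one_le_iff_ne_zero]
  exact mt Ideal.absNorm_eq_zero_iff.1 hm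

theorem realNorm_pos {m : Ideal (𝓞 K)} (hm : m ≠ ⊥) : 0 < realNorm m :=
  zero_lt_one.trans_le (one_le_realNorm hm)

theorem two_le_realNorm (p : HeightOneSpectrum (𝓞 K)) : 2 ≤ realNorm p.asIdeal := by
  have h1 : Ideal.absNorm p.asIdeal ≠ 0 := mt Ideal.absNorm_eq_zero_iff.1 p.ne_bot
  have h2 : Ideal.absNorm p.asIdeal ≠ 1 := mt Ideal.absNorm_eq_one_iff.1 p.isPrime.ne_top
  have : 2 ≤ Ideal.absNorm p.asIdeal := by omega
  exact_mod_cast this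

theorem realNorm_prime_pos (p : HeightOneSpectrum (𝓞 K)) : 0 < realNorm p.asIdeal := by
  linarith [two_le_realNorm p]

theorem realNorm_le_of_dvd {a b : Ideal (𝓞 K)} (h : a ∣ b) (hb : b ≠ ⊥) :
    realNorm a ≤ realNorm b := by
  obtain ⟨c, rfl⟩ := h
  have hc : c ≠ ⊥ := by rintro rfl; exact hb (mul_zero a)
  rw [realNorm_mul]
  exact le_mul_of_one_le_right (Nat.cast_nonneg _) (one_le_realNorm hc)

theorem finiteMultiplicity (p : HeightOneSpectrum (𝓞 K)) {m : Ideal (𝓞 K)} (hm : m ≠ ⊥) :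
    FiniteMultiplicity p.asIdeal m := FiniteMultiplicity.of_prime_left p.prime hm

theorem pow_dvd_iff_le_mult (p : HeightOneSpectrum (𝓞 K)) {m : Ideal (𝓞 K)} (hm : m ≠ ⊥) {n : ℕ} :
    p.asIdeal ^ n ∣ m ↔ n ≤ mult p m :=
  (finiteMultiplicity p hm).pow_dvd_iff_le_multiplicity

theorem dvd_iff_mult_ne_zero (p : HeightOneSpectrum (𝓞 K)) {m : Ideal (𝓞 K)} (hm : m ≠ ⊥) :
    p.asIdeal ∣ m ↔ mult p m ≠ 0 := by
  rw [← Nat.one_le_iff_ne_zero, ← pow_dvd_iff_le_mult p hm, pow_one]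

theorem mul_ne_bot' {a b : Ideal (𝓞 K)} (ha : a ≠ ⊥) (hb : b ≠ ⊥) : a * b ≠ ⊥ := mul_ne_zero ha hb

theorem mult_mul (p : HeightOneSpectrum (𝓞 K)) {a b : Ideal (𝓞 K)} (ha : a ≠ ⊥) (hb : b ≠ ⊥) :
    mult p (a * b) = mult p a + mult p b :=
  multiplicity_mul p.prime (finiteMultiplicity p (mul_ne_bot' ha hb))

theorem mult_one (p : HeightOneSpectrum (𝓞 K)) : mult p (1 : Ideal (𝓞 K)) = 0 := by
  by_contra h
  have h1 := (dvd_iff_mult_ne_zero p (one_ne_zero (α := Ideal (𝓞 K)))).2 h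
  exact p.prime.not_isUnit (isUnit_of_dvd_one h1)

theorem mult_pow (p : HeightOneSpectrum (𝓞 K)) {a : Ideal (𝓞 K)} (ha : a ≠ ⊥) (n : ℕ) :
    mult p (a ^ n) = n * mult p a := by
  induction n with
  | zero => rw [pow_zero, mult_one, zero_mul]
  | succ n ih => rw [pow_succ, mult_mul p (pow_ne_zero n ha) ha, ih]; ring

theorem dvd_prime_iff {p q : HeightOneSpectrum (𝓞 K)} : p.asIdeal ∣ q.asIdeal ↔ p = q := by
  rw [p.prime.dvd_prime_iff_associated q.prime, associated_iff_eq, HeightOneSpectrum.ext_iff]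

theorem mult_prime (p q : HeightOneSpectrum (𝓞 K)) [Decidable (p = q)] :
    mult p q.asIdeal = if p = q then 1 else 0 := by
  split_ifs with h
  · subst h
    refine le_antisymm ?_ ((pow_dvd_iff_le_mult p p.ne_bot).1 (by simp))
    by_contra hcon
    have h2 := (pow_dvd_iff_le_mult p p.ne_bot (n := 2)).2 (by omega)
    rw [pow_two] at h2
    exact p.prime.not_isUnit (isUnit_of_dvd_one ((mul_dvd_mul_iff_left p.ne_bot).1
      (h2.trans (mul_one p.asIdeal).symm.dvd)))
  · by_contra h2
    exact h (dvd_prime_iff.1 ((dvd_iff_mult_ne_zero p q.ne_bot).2 h2))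

theorem prod_ne_bot' {ι : Type*} (s : Finset ι) (f : ι → Ideal (𝓞 K)) (h : ∀ i ∈ s, f i ≠ ⊥) :
    ∏ i ∈ s, f i ≠ ⊥ := Finset.prod_ne_zero_iff.2 h

open scoped Classical in
theorem mult_prod_pow (D : Finset (HeightOneSpectrum (𝓞 K))) (e : HeightOneSpectrum (𝓞 K) → ℕ)
    (p : HeightOneSpectrum (𝓞 K)) :
    mult p (∏ q ∈ D, q.asIdeal ^ e q) = if p ∈ D then e p else 0 := by
  induction D using Finset.induction_on with
  | empty => rw [Finset.prod_empty, mult_one]; simp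
  | insert q D hq ih =>
    rw [Finset.prod_insert hq, mult_mul p (pow_ne_zero _ q.ne_bot)
      (prod_ne_bot' _ _ fun i _ => pow_ne_zero _ i.ne_bot), ih, mult_pow p q.ne_bot, mult_prime]
    by_cases hp : p = q
    · subst hp; simp [hq]
    · simp [hp]

theorem prod_pow_mult {m : Ideal (𝓞 K)} (hm : m ≠ ⊥) (D : Finset (HeightOneSpectrum (𝓞 K)))
    (hD : ∀ p : HeightOneSpectrum (𝓞 K), p.asIdeal ∣ m → p ∈ D) :
    ∏ p ∈ D, p.asIdeal ^ mult p m = m := by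
  conv_rhs => rw [← Ideal.finprod_heightOneSpectrum_pow_multiplicity hm]
  refine (finprod_eq_prod_of_mulSupport_subset _ fun p hp => ?_).symm
  refine hD p ((dvd_iff_mult_ne_zero p hm).2 fun h => hp ?_)
  change p.asIdeal ^ mult p m = 1
  rw [h, pow_zero]

/-- The finite set of prime ideals dividing the nonzero ideal `m`. -/
def primeDivisors (m : Ideal (𝓞 K)) : Finset (HeightOneSpectrum (𝓞 K)) := by
  classical
  exact if hm : m ≠ ⊥ then (Ideal.finite_factors hm).toFinset else ∅

theorem mem_primeDivisors {m : Ideal (𝓞 K)} (hm : m ≠ ⊥) {p : HeightOneSpectrum (𝓞 K)} :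
    p ∈ primeDivisors m ↔ p.asIdeal ∣ m := by
  simp [primeDivisors, hm]

theorem ext_mult {m m' : Ideal (𝓞 K)} (hm : m ≠ ⊥) (hm' : m' ≠ ⊥)
    (h : ∀ p, mult p m = mult p m') : m = m' := by
  have h1 := prod_pow_mult hm (primeDivisors m) fun p hp => (mem_primeDivisors hm).2 hp
  have h2 := prod_pow_mult hm' (primeDivisors m) fun p hp => by
    rw [mem_primeDivisors hm, dvd_iff_mult_ne_zero p hm, h]
    exact (dvd_iff_mult_ne_zero p hm').1 hp
  simp only [h] at h1
  exact h1.symm.trans h2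

theorem dvd_of_mult_le {m m' : Ideal (𝓞 K)} (hm : m ≠ ⊥) (hm' : m' ≠ ⊥)
    (h : ∀ p, mult p m ≤ mult p m') : m ∣ m' := by
  have h1 := prod_pow_mult hm' (primeDivisors m') fun p hp => (mem_primeDivisors hm').2 hp
  have h2 := prod_pow_mult hm (primeDivisors m') fun p hp => by
    rw [dvd_iff_mult_ne_zero p hm] at hp
    rw [mem_primeDivisors hm', dvd_iff_mult_ne_zero p hm']
    have := h p
    omega
  calc m = _ := h2.symm
    _ ∣ _ := Finset.prod_dvd_prod_of_dvd _ _ fun p _ => pow_dvd_pow p.asIdeal (h p)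
    _ = m' := h1

theorem prod_asIdeal_dvd_iff (D : Finset (HeightOneSpectrum (𝓞 K))) {m : Ideal (𝓞 K)} :
    ∏ p ∈ D, p.asIdeal ∣ m ↔ ∀ p ∈ D, p.asIdeal ∣ m := by
  classical
  refine ⟨fun h p hp => (Finset.dvd_prod_of_mem _ hp).trans h, fun h => ?_⟩
  by_cases hm : m = ⊥
  · rw [hm]; exact dvd_zero _
  refine dvd_of_mult_le (prod_ne_bot' _ _ fun i _ => i.ne_bot) hm fun p => ?_
  have := mult_prod_pow D (fun _ => 1) p
  simp only [pow_one] at this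
  rw [this]
  split_ifs with hp
  · exact Nat.one_le_iff_ne_zero.2 ((dvd_iff_mult_ne_zero p hm).1 (h p hp))
  · exact Nat.zero_le _

theorem card_filter_dvd {d : Ideal (𝓞 K)} (hd : d ≠ ⊥) [DecidablePred (d ∣ ·)] (t : ℝ) :
    ((idealsLE K t).filter (d ∣ ·)).card = (idealsLE K (t / realNorm d)).card := by
  classical
  have : (idealsLE K t).filter (d ∣ ·) = (idealsLE K (t / realNorm d)).image (d * ·) := by
    ext m
    simp only [Finset.mem_filter, mem_idealsLE, Finset.mem_image]
    constructor
    · rintro ⟨⟨hm, hmt⟩, c, rfl⟩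
      have hc : c ≠ ⊥ := by rintro rfl; exact hm (mul_zero d)
      refine ⟨c, ⟨hc, ?_⟩, rfl⟩
      rw [le_div_iff₀ (realNorm_pos hd), mul_comm]
      rwa [← realNorm, realNorm_mul] at hmt
    · rintro ⟨c, ⟨hc, hct⟩, rfl⟩
      refine ⟨⟨mul_ne_bot' hd hc, ?_⟩, dvd_mul_right _ _⟩
      rw [le_div_iff₀ (realNorm_pos hd), mul_comm] at hct
      rwa [← realNorm, realNorm_mul]
  rw [this, Finset.card_image_of_injective _ (mul_right_injective₀ hd)]

variable (K) in
theorem finite_primes_norm_le (t : ℝ) :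
    {p : HeightOneSpectrum (𝓞 K) | realNorm p.asIdeal ≤ t}.Finite :=
  Set.Finite.of_finite_image (f := HeightOneSpectrum.asIdeal) ((finite_nonzero_norm_le K t).subset
    (by rintro _ ⟨p, hp, rfl⟩; exact ⟨p.ne_bot, hp⟩))
    (fun p _ q _ h => HeightOneSpectrum.ext h)

variable (K) in
/-- The finite set of prime ideals of norm at most `t`. -/
def primesLE (t : ℝ) : Finset (HeightOneSpectrum (𝓞 K)) := (finite_primes_norm_le K t).toFinset

@[simp]
theorem mem_primesLE {t : ℝ} {p : HeightOneSpectrum (𝓞 K)} :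
    p ∈ primesLE K t ↔ realNorm p.asIdeal ≤ t := by
  simp [primesLE]

theorem primesLE_mono {s t : ℝ} (h : s ≤ t) : primesLE K s ⊆ primesLE K t := fun p hp => by
  rw [mem_primesLE] at hp ⊢
  exact hp.trans h

/-- A finite form of the Euler product upper bound. -/
theorem sum_prod_mult_le (w : HeightOneSpectrum (𝓞 K) → ℕ → ℝ) (hw : ∀ p j, 0 ≤ w p j)
    (G : Finset (Ideal (𝓞 K))) (hG : ∀ m ∈ G, m ≠ ⊥) (P : Finset (HeightOneSpectrum (𝓞 K)))
    (hP : ∀ m ∈ G, ∀ p : HeightOneSpectrum (𝓞 K), p.asIdeal ∣ m → p ∈ P) (J : ℕ)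
    (hJ : ∀ m ∈ G, ∀ p ∈ P, mult p m ≤ J) :
    ∑ m ∈ G, ∏ p ∈ P, w p (mult p m) ≤ ∏ p ∈ P, ∑ j ∈ Finset.range (J + 1), w p j := by
  classical
  rw [Finset.prod_sum]
  have hinj : Set.InjOn (fun (m : Ideal (𝓞 K)) (p : HeightOneSpectrum (𝓞 K)) (_ : p ∈ P) =>
      mult p m) G := by
    intro m hm m' hm' h
    refine ext_mult (hG m hm) (hG m' hm') fun p => ?_
    by_cases hp : p ∈ P
    · exact congr_fun (congr_fun h p) hp
    · have h1 : mult p m = 0 := by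
        by_contra h0
        exact hp (hP m hm p ((dvd_iff_mult_ne_zero p (hG m hm)).2 h0))
      have h2 : mult p m' = 0 := by
        by_contra h0
        exact hp (hP m' hm' p ((dvd_iff_mult_ne_zero p (hG m' hm')).2 h0))
      rw [h1, h2]
  have hsum : ∑ m ∈ G, ∏ p ∈ P, w p (mult p m) =
      ∑ f ∈ G.image (fun (m : Ideal (𝓞 K)) (p : HeightOneSpectrum (𝓞 K)) (_ : p ∈ P) =>
        mult p m), ∏ x ∈ P.attach, w x.1 (f x.1 x.2) := by
    rw [Finset.sum_image hinj]
    exact Finset.sum_congr rfl fun m _ => (Finset.prod_attach P fun p => w p (mult p m)).symm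
  rw [hsum]
  refine Finset.sum_le_sum_of_subset_of_nonneg (fun f hf => ?_) fun f _ _ =>
    Finset.prod_nonneg fun _ _ => hw _ _
  obtain ⟨m, hm, rfl⟩ := Finset.mem_image.1 hf
  rw [Finset.mem_pi]
  intro p hp
  simpa [Nat.lt_succ_iff] using hJ m hm p hp

variable (K) in
theorem exists_card_idealsLE_bounds : ∃ c₁ : ℝ, 0 < c₁ ∧ ∃ c₂ : ℝ, 0 < c₂ ∧ ∀ t : ℝ, 1 ≤ t →
    c₁ * t ≤ (idealsLE K t).card ∧ ((idealsLE K t).card : ℝ) ≤ c₂ * t := by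
  obtain ⟨κ, hκ, β, hβ, hβ1, M, hM, h⟩ := exists_abs_card_idealsLE_sub_le K
  have hlim : Filter.Tendsto (fun t : ℝ => M * t ^ (-β)) Filter.atTop (nhds 0) := by
    simpa using (tendsto_rpow_neg_atTop hβ).const_mul M
  obtain ⟨t₀, ht₀⟩ := Filter.eventually_atTop.1 (hlim.eventually_le_const (half_pos hκ))
  -- For t up to `max t₀ 1` the lower bound is at most 1 and the unit ideal alone provides it.
  refine ⟨min (κ / 2) (1 / max t₀ 1), by positivity, κ + M, by positivity, fun t ht => ⟨?_, ?_⟩⟩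
  · rcases le_total (max t₀ 1) t with h1 | h1
    · have h2 := ht₀ t ((le_max_left _ _).trans h1)
      have ht0 : 0 < t := by linarith
      have h3 : M * t ^ (1 - β) ≤ κ / 2 * t := by
        rw [sub_eq_neg_add, Real.rpow_add_one ht0.ne', ← mul_assoc]
        gcongr
      have h4 := (abs_le.1 (h t ht)).1
      have h5 : min (κ / 2) (1 / max t₀ 1) * t ≤ κ / 2 * t := by
        gcongr; exact min_le_left _ _
      linarith
    · have h2 : (1 : ℝ) ≤ (idealsLE K t).card := by
        rw [Nat.one_le_cast, Nat.one_le_iff_ne_zero, Finset.card_ne_zero]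
        exact ⟨1, by simpa [Ideal.one_eq_top] using ht⟩
      refine le_trans ?_ h2
      calc min (κ / 2) (1 / max t₀ 1) * t ≤ 1 / max t₀ 1 * max t₀ 1 := by
            gcongr; exact min_le_right _ _
        _ = 1 := by field_simp
  · have h4 := (abs_le.1 (h t ht)).2
    have h5 : M * t ^ (1 - β) ≤ M * t := by
      gcongr
      conv_rhs => rw [← Real.rpow_one t]
      exact Real.rpow_le_rpow_of_exponent_le ht (by linarith)
    linarith

theorem idealsLE_eq_empty {t : ℝ} (ht : t < 1) : idealsLE K t = ∅ := by
  ext m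
  simp only [mem_idealsLE, Finset.notMem_empty, iff_false, not_and, not_le]
  exact fun hm => ht.trans_le (one_le_realNorm hm)

end Basics

/-! ### Chebyshev and Mertens estimates. -/

section Mertens

variable (K : Type*) [Field K] [NumberField K]

/-- Chebyshev's argument: the product of the distinct primes dividing m has norm at most N(m), so
summing log N(p) over p dividing m and m of norm at most x gives at most O(x log x). After
exchanging the sums, each p accounts for at least a constant times x log N(p) / N(p). -/
theorem exists_sum_log_div_le : ∃ M : ℝ, 0 < M ∧ ∀ x : ℝ, 1 ≤ x →
    ∑ p ∈ primesLE K x, Real.log (realNorm p.asIdeal) / realNorm p.asIdeal ≤ M * Real.log x := by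
  classical
  obtain ⟨c₁, hc₁, c₂, hc₂, hc⟩ := exists_card_idealsLE_bounds K
  refine ⟨c₂ / c₁, by positivity, fun x hx => ?_⟩
  have hx0 : 0 < x := by linarith
  have h1 : ∑ m ∈ idealsLE K x, Real.log (realNorm m) ≤ c₂ * x * Real.log x := by
    calc ∑ m ∈ idealsLE K x, Real.log (realNorm m) ≤ ∑ m ∈ idealsLE K x, Real.log x :=
          Finset.sum_le_sum fun m hm => by
            rw [mem_idealsLE] at hm
            exact Real.log_le_log (realNorm_pos hm.1) hm.2
      _ = (idealsLE K x).card * Real.log x := by simp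
      _ ≤ c₂ * x * Real.log x :=
          mul_le_mul_of_nonneg_right (hc x hx).2 (Real.log_nonneg hx)
  have h2 : ∑ m ∈ idealsLE K x, ∑ p ∈ (primesLE K x).filter (fun p => p.asIdeal ∣ m),
      Real.log (realNorm p.asIdeal) ≤ ∑ m ∈ idealsLE K x, Real.log (realNorm m) := by
    refine Finset.sum_le_sum fun m hm => ?_
    rw [mem_idealsLE] at hm
    rw [← Real.log_prod fun p _ => (realNorm_prime_pos p).ne', ← realNorm_prod]
    refine Real.log_le_log (realNorm_pos (prod_ne_bot' _ _ fun i _ => i.ne_bot))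
      (realNorm_le_of_dvd ?_ hm.1)
    rw [prod_asIdeal_dvd_iff]
    exact fun p hp => (Finset.mem_filter.1 hp).2
  have h3 : ∑ m ∈ idealsLE K x, ∑ p ∈ (primesLE K x).filter (fun p => p.asIdeal ∣ m),
      Real.log (realNorm p.asIdeal) = ∑ p ∈ primesLE K x,
        (idealsLE K (x / realNorm p.asIdeal)).card * Real.log (realNorm p.asIdeal) := by
    simp_rw [Finset.sum_filter]
    rw [Finset.sum_comm]
    refine Finset.sum_congr rfl fun p _ => ?_
    rw [← Finset.sum_filter, Finset.sum_const, nsmul_eq_mul, card_filter_dvd p.ne_bot]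
  have h4 : c₁ * x * ∑ p ∈ primesLE K x, Real.log (realNorm p.asIdeal) / realNorm p.asIdeal ≤
      ∑ p ∈ primesLE K x,
        (idealsLE K (x / realNorm p.asIdeal)).card * Real.log (realNorm p.asIdeal) := by
    rw [Finset.mul_sum]
    refine Finset.sum_le_sum fun p hp => ?_
    rw [mem_primesLE] at hp
    have hp2 := two_le_realNorm p
    have hp0 := realNorm_prime_pos p
    have := (hc (x / realNorm p.asIdeal) ((one_le_div hp0).2 hp)).1
    calc c₁ * x * (Real.log (realNorm p.asIdeal) / realNorm p.asIdeal)
        = c₁ * (x / realNorm p.asIdeal) * Real.log (realNorm p.asIdeal) := by ring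
      _ ≤ _ := mul_le_mul_of_nonneg_right this (Real.log_nonneg (by linarith))
  have h5 := h4.trans (h3.symm.le.trans (h2.trans h1))
  rw [div_mul_eq_mul_div, le_div_iff₀ hc₁]
  have h6 : x * ((∑ p ∈ primesLE K x, Real.log (realNorm p.asIdeal) / realNorm p.asIdeal) * c₁) ≤
      x * (c₂ * Real.log x) := by linarith
  exact le_of_mul_le_mul_left h6 hx0

/-- The ideals with 2^j ≤ N(m) < 2^(j+1) contribute O(2^(j(1-s))), a geometric series whose sum is
O(1/(s-1)). -/
theorem exists_sum_rpow_le : ∃ M : ℝ, 0 < M ∧ ∀ s : ℝ, 1 < s → s ≤ 2 →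
    ∀ G : Finset (Ideal (𝓞 K)), (∀ m ∈ G, m ≠ ⊥) →
    ∑ m ∈ G, realNorm m ^ (-s) ≤ M / (s - 1) := by
  classical
  obtain ⟨c₁, hc₁, c₂, hc₂, hc⟩ := exists_card_idealsLE_bounds K
  have hl2 : 0 < Real.log 2 := Real.log_pos one_lt_two
  refine ⟨4 * c₂ / Real.log 2, by positivity, fun s hs hs2 G hG => ?_⟩
  set J := G.sup (fun m => Nat.log 2 (Ideal.absNorm m)) + 1 with hJ
  have hmaps : ∀ m ∈ G, Nat.log 2 (Ideal.absNorm m) ∈ Finset.range J := fun m hm => by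
    rw [Finset.mem_range, hJ, Nat.lt_succ_iff]
    exact Finset.le_sup (f := fun m => Nat.log 2 (Ideal.absNorm m)) hm
  rw [← Finset.sum_fiberwise_of_maps_to hmaps]
  set q : ℝ := 2 ^ (1 - s) with hq
  have hq0 : 0 < q := by positivity
  have hblock (j : ℕ) : ∑ m ∈ G with Nat.log 2 (Ideal.absNorm m) = j, realNorm m ^ (-s) ≤
      2 * c₂ * q ^ j := by
    have h1 : ∀ m ∈ G.filter (fun m => Nat.log 2 (Ideal.absNorm m) = j),
        realNorm m ^ (-s) ≤ ((2 : ℝ) ^ j) ^ (-s) := fun m hm => by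
      rw [Finset.mem_filter] at hm
      refine Real.rpow_le_rpow_of_nonpos (by positivity) ?_ (by linarith)
      have := Nat.pow_log_le_self 2 (mt Ideal.absNorm_eq_zero_iff.1 (hG m hm.1))
      rw [hm.2] at this
      exact_mod_cast this
    have h2 : ((G.filter (fun m => Nat.log 2 (Ideal.absNorm m) = j)).card : ℝ) ≤
        c₂ * 2 ^ (j + 1) := by
      refine le_trans (Nat.cast_le.2 (Finset.card_le_card fun m hm => ?_))
        (hc (2 ^ (j + 1)) (one_le_pow₀ one_le_two)).2
      rw [Finset.mem_filter] at hm
      rw [mem_idealsLE]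
      refine ⟨hG m hm.1, ?_⟩
      have := Nat.lt_pow_succ_log_self one_lt_two (Ideal.absNorm m)
      rw [hm.2] at this
      exact_mod_cast this.le
    calc _ ≤ ∑ m ∈ G with Nat.log 2 (Ideal.absNorm m) = j, ((2 : ℝ) ^ j) ^ (-s) :=
          Finset.sum_le_sum h1
      _ = (G.filter (fun m => Nat.log 2 (Ideal.absNorm m) = j)).card * ((2 : ℝ) ^ j) ^ (-s) := by
          simp
      _ ≤ c₂ * 2 ^ (j + 1) * ((2 : ℝ) ^ j) ^ (-s) := by gcongr
      _ = 2 * c₂ * q ^ j := by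
          have e : q ^ j = 2 ^ j * ((2 : ℝ) ^ j) ^ (-s) := by
            rw [hq, ← Real.rpow_natCast (2 ^ (1 - s)) j, ← Real.rpow_natCast 2 j,
              ← Real.rpow_mul zero_le_two, ← Real.rpow_mul zero_le_two,
              ← Real.rpow_add zero_lt_two]
            ring_nf
          rw [e]; ring
  set u := (s - 1) * Real.log 2 with hu
  have hu0 : 0 < u := mul_pos (by linarith) hl2
  have hu1 : u ≤ 1 := by
    have := Real.log_two_lt_d9
    nlinarith
  have hqu : q = Real.exp (-u) := by
    rw [hq, Real.rpow_def_of_pos zero_lt_two, hu]; ring_nf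
  have hq1 : u / 2 ≤ 1 - q := by
    have h1 := Real.add_one_le_exp u
    have h2 : q ≤ 1 / (1 + u) := by
      rw [hqu, Real.exp_neg, ← one_div]
      exact one_div_le_one_div_of_le (by linarith) (by linarith)
    have h3 : 1 / (1 + u) ≤ 1 - u / 2 := by
      rw [div_le_iff₀ (by linarith)]
      nlinarith
    linarith
  calc _ ≤ ∑ j ∈ Finset.range J, 2 * c₂ * q ^ j := Finset.sum_le_sum fun j _ => hblock j
    _ = 2 * c₂ * ∑ j ∈ Finset.range J, q ^ j := by rw [Finset.mul_sum]
    _ ≤ 2 * c₂ * (1 - q)⁻¹ := by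
        gcongr
        have hlt : q < 1 := by linarith
        rw [← tsum_geometric_of_lt_one hq0.le hlt]
        exact (summable_geometric_of_lt_one hq0.le hlt).sum_le_tsum _ fun _ _ => by positivity
    _ ≤ 2 * c₂ * (u / 2)⁻¹ := by gcongr
    _ = _ := by
        rw [hu]
        have : s - 1 ≠ 0 := by linarith
        field_simp
        ring

theorem exists_sum_prime_rpow_le : ∃ M : ℝ, 0 < M ∧ ∀ s : ℝ, 1 < s → s ≤ 2 →
    ∀ P : Finset (HeightOneSpectrum (𝓞 K)),
    ∑ p ∈ P, realNorm p.asIdeal ^ (-s) ≤ M / (s - 1) := by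
  classical
  obtain ⟨M, hM, h⟩ := exists_sum_rpow_le K
  refine ⟨M, hM, fun s hs hs2 P => ?_⟩
  have hinj : Set.InjOn (HeightOneSpectrum.asIdeal : HeightOneSpectrum (𝓞 K) → Ideal (𝓞 K)) P :=
    fun p _ q _ h => HeightOneSpectrum.ext h
  have := h s hs hs2 (P.image HeightOneSpectrum.asIdeal) (by
    intro m hm
    obtain ⟨p, _, rfl⟩ := Finset.mem_image.1 hm
    exact p.ne_bot)
  rwa [Finset.sum_image hinj] at this

theorem summable_prime_rpow {s : ℝ} (hs : 1 < s) (hs2 : s ≤ 2) :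
    Summable fun p : HeightOneSpectrum (𝓞 K) => realNorm p.asIdeal ^ (-s) := by
  obtain ⟨M, hM, h⟩ := exists_sum_prime_rpow_le K
  exact summable_of_sum_le (fun p => by positivity) (h s hs hs2)

theorem exists_sum_inv_sq_le : ∃ M : ℝ, 0 < M ∧ ∀ P : Finset (HeightOneSpectrum (𝓞 K)),
    ∑ p ∈ P, 1 / realNorm p.asIdeal ^ 2 ≤ M := by
  obtain ⟨M, hM, h⟩ := exists_sum_prime_rpow_le K
  refine ⟨M, hM, fun P => ?_⟩
  have := h 2 one_lt_two le_rfl P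
  norm_num at this
  refine le_trans (le_of_eq (Finset.sum_congr rfl fun p _ => ?_)) this
  rw [one_div]

/-- Expanding the product gives a sum over distinct squarefree ideals, which the sum over all ideals
dominates. -/
theorem exists_prod_one_add_rpow_le : ∃ M : ℝ, 0 < M ∧ ∀ s : ℝ, 1 < s → s ≤ 2 →
    ∀ P : Finset (HeightOneSpectrum (𝓞 K)),
    ∏ p ∈ P, (1 + realNorm p.asIdeal ^ (-s)) ≤ M / (s - 1) := by
  classical
  obtain ⟨M, hM, h⟩ := exists_sum_rpow_le K
  refine ⟨M, hM, fun s hs hs2 P => ?_⟩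
  rw [Finset.prod_one_add]
  have hinj : Set.InjOn (fun D : Finset (HeightOneSpectrum (𝓞 K)) => ∏ p ∈ D, p.asIdeal)
      P.powerset := by
    intro D _ D' _ hDD
    ext p
    have h1 := mult_prod_pow D (fun _ => 1) p
    have h2 := mult_prod_pow D' (fun _ => 1) p
    simp only [pow_one] at h1 h2
    have h3 : mult p (∏ p ∈ D, p.asIdeal) = mult p (∏ p ∈ D', p.asIdeal) := congrArg _ hDD
    rw [h1, h2] at h3
    by_cases hp : p ∈ D <;> by_cases hp' : p ∈ D' <;> simp_all
  have := h s hs hs2 (P.powerset.image fun D => ∏ p ∈ D, p.asIdeal) (by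
    intro m hm
    obtain ⟨D, _, rfl⟩ := Finset.mem_image.1 hm
    exact prod_ne_bot' _ _ fun i _ => i.ne_bot)
  rw [Finset.sum_image hinj] at this
  refine le_trans (le_of_eq (Finset.sum_congr rfl fun D _ => ?_)) this
  rw [realNorm_prod, Real.finsetProd_rpow _ _ fun p _ => (realNorm_prime_pos p).le]

/-- Take s = 1 + 1/log z in the Euler product, so that its logarithm is at most log log z + O(1).
Replacing N(p)^(-s) by 1/N(p) costs log N(p) / (N(p) log z), which sums to O(1) by Chebyshev; the
quadratic term of the logarithm is controlled by the sum of N(p)^(-2). -/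
theorem exists_sum_inv_le : ∃ M : ℝ, ∀ z : ℝ, Real.exp 1 ≤ z →
    ∑ p ∈ primesLE K z, 1 / realNorm p.asIdeal ≤ Real.log (Real.log z) + M := by
  obtain ⟨M₁, hM₁, h₁⟩ := exists_sum_log_div_le K
  obtain ⟨M₂, hM₂, h₂⟩ := exists_sum_inv_sq_le K
  obtain ⟨M₃, hM₃, h₃⟩ := exists_prod_one_add_rpow_le K
  refine ⟨Real.log M₃ + M₂ + M₁, fun z hz => ?_⟩
  have hz0 : 0 < z := (Real.exp_pos 1).trans_le hz
  have hL1 : 1 ≤ Real.log z := (Real.le_log_iff_exp_le hz0).2 hz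
  set L := Real.log z with hL
  have hL0 : 0 < L := by linarith
  have hz1 : 1 ≤ z := (Real.one_le_exp zero_le_one).trans hz
  have hs : 1 < 1 + 1 / L := by
    have : 0 < 1 / L := by positivity
    linarith
  have hs2 : 1 + 1 / L ≤ 2 := by
    have : 1 / L ≤ 1 := (div_le_one hL0).2 hL1
    linarith
  set s := 1 + 1 / L with hsdef
  have e1 := h₃ s hs hs2 (primesLE K z)
  have e2 : ∑ p ∈ primesLE K z, Real.log (1 + realNorm p.asIdeal ^ (-s)) ≤
      Real.log M₃ + Real.log L := by
    rw [← Real.log_mul hM₃.ne' hL0.ne', ← Real.log_prod fun p _ => by positivity]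
    refine Real.log_le_log (Finset.prod_pos fun p _ => by positivity) (e1.trans_eq ?_)
    rw [hsdef]; field_simp; ring
  have e3 (p : HeightOneSpectrum (𝓞 K)) : 1 / realNorm p.asIdeal ≤
      Real.log (1 + realNorm p.asIdeal ^ (-s)) + 1 / realNorm p.asIdeal ^ 2 +
        (Real.log (realNorm p.asIdeal) / realNorm p.asIdeal) / L := by
    have hn := two_le_realNorm p
    set n := realNorm p.asIdeal with hndef
    have hn0 : 0 < n := by linarith
    set u := n ^ (-s) with hu
    have hu0 : 0 < u := by positivity
    have hun : u = Real.exp (-(Real.log n / L)) / n := by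
      rw [hu, Real.rpow_def_of_pos hn0, hsdef,
        show Real.log n * -(1 + 1 / L) = -(Real.log n / L) - Real.log n by ring, Real.exp_sub,
        Real.exp_log hn0]
    have hexp := Real.add_one_le_exp (-(Real.log n / L))
    have hlogn : 0 ≤ Real.log n / L := div_nonneg (Real.log_nonneg (by linarith)) hL0.le
    have hu1 : u ≤ 1 / n := by
      rw [hun]; gcongr; exact Real.exp_le_one_iff.2 (by linarith)
    have hu2 : 1 / n - (Real.log n / n) / L ≤ u := by
      rw [hun, div_div, mul_comm n L, ← div_div, ← sub_div]
      gcongr; linarith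
    have hlog : u - u ^ 2 ≤ Real.log (1 + u) := by
      have := Real.one_sub_inv_le_log_of_pos (show 0 < 1 + u by linarith)
      refine le_trans ?_ this
      rw [le_sub_iff_add_le, ← le_sub_iff_add_le', inv_eq_one_div, div_le_iff₀ (by linarith)]
      nlinarith [pow_pos hu0 3]
    have hsq : u ^ 2 ≤ 1 / n ^ 2 := by
      rw [← one_div_pow]; gcongr
    linarith
  calc ∑ p ∈ primesLE K z, 1 / realNorm p.asIdeal ≤ ∑ p ∈ primesLE K z,
        (Real.log (1 + realNorm p.asIdeal ^ (-s)) + 1 / realNorm p.asIdeal ^ 2 +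
        (Real.log (realNorm p.asIdeal) / realNorm p.asIdeal) / L) :=
        Finset.sum_le_sum fun p _ => e3 p
    _ ≤ (Real.log M₃ + Real.log L) + M₂ + M₁ := by
        rw [Finset.sum_add_distrib, Finset.sum_add_distrib, ← Finset.sum_div]
        refine add_le_add (add_le_add e2 (h₂ _)) ?_
        rw [div_le_iff₀ hL0]
        exact h₁ z hz1
    _ = _ := by ring

/-- With A = 2c₂/c₁ each shell A^n < N(m) ≤ A^(n+1) contains at least (c₁/2) A^(n+1) ideals, so it
contributes at least c₁/2, and there are of order log x shells below x. -/
theorem exists_le_sum_inv_ideals : ∃ c : ℝ, 0 < c ∧ ∃ x₀ : ℝ, ∀ x : ℝ, x₀ ≤ x →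
    c * Real.log x ≤ ∑ m ∈ idealsLE K x, 1 / realNorm m := by
  classical
  obtain ⟨c₁, hc₁, c₂, hc₂, hc⟩ := exists_card_idealsLE_bounds K
  have hc12 : c₁ ≤ c₂ := by have := hc 1 le_rfl; linarith
  set A := 2 * c₂ / c₁ with hA
  have hA2 : 2 ≤ A := by rw [hA, le_div_iff₀ hc₁]; linarith
  have hA0 : 0 < A := by linarith
  have hlA : 0 < Real.log A := Real.log_pos (by linarith)
  have key (n : ℕ) : n * (c₁ / 2) ≤ ∑ m ∈ idealsLE K (A ^ n), 1 / realNorm m := by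
    induction n with
    | zero => simpa using Finset.sum_nonneg fun m _ => by positivity
    | succ n ih =>
      have hAn : 1 ≤ A ^ n := one_le_pow₀ (by linarith)
      have hAn1 : A ^ n ≤ A ^ (n + 1) := pow_le_pow_right₀ (by linarith) n.le_succ
      have hsub : idealsLE K (A ^ n) ⊆ idealsLE K (A ^ (n + 1)) := fun m hm => by
        rw [mem_idealsLE] at hm ⊢; exact ⟨hm.1, hm.2.trans hAn1⟩
      rw [← Finset.sum_sdiff hsub]
      have h1 : ((idealsLE K (A ^ (n + 1)) \ idealsLE K (A ^ n)).card : ℝ) =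
          (idealsLE K (A ^ (n + 1))).card - (idealsLE K (A ^ n)).card := by
        rw [Finset.card_sdiff_of_subset hsub, Nat.cast_sub (Finset.card_le_card hsub)]
      have h2 := (hc _ (hAn.trans hAn1)).1
      have h3 := (hc _ hAn).2
      have h4 : c₁ / 2 ≤ ∑ m ∈ idealsLE K (A ^ (n + 1)) \ idealsLE K (A ^ n), 1 / realNorm m := by
        calc c₁ / 2 = (c₁ / 2 * A ^ (n + 1)) / A ^ (n + 1) := by field_simp
          _ ≤ ((idealsLE K (A ^ (n + 1)) \ idealsLE K (A ^ n)).card : ℝ) / A ^ (n + 1) := by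
              rw [h1]
              gcongr
              have : c₂ * A ^ n = c₁ / 2 * A ^ (n + 1) := by rw [pow_succ, hA]; field_simp
              linarith
          _ = ∑ m ∈ idealsLE K (A ^ (n + 1)) \ idealsLE K (A ^ n), 1 / A ^ (n + 1) := by
              simp [div_eq_mul_inv]
          _ ≤ _ := Finset.sum_le_sum fun m hm => by
              rw [Finset.mem_sdiff, mem_idealsLE] at hm
              exact one_div_le_one_div_of_le (realNorm_pos hm.1.1) hm.1.2
      push_cast
      linarith
  refine ⟨c₁ / 2 / (2 * Real.log A), by positivity, A ^ 2, fun x hx => ?_⟩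
  have hx0 : 0 < x := lt_of_lt_of_le (by positivity) hx
  have hlx : 2 * Real.log A ≤ Real.log x := by
    have := Real.log_le_log (by positivity) hx
    rwa [Real.log_pow] at this
  set n := ⌊Real.log x / Real.log A⌋₊ with hn
  have hnle : (n : ℝ) ≤ Real.log x / Real.log A := Nat.floor_le (by
    apply div_nonneg _ hlA.le; linarith)
  have hnlt := Nat.lt_floor_add_one (Real.log x / Real.log A)
  have hAx : A ^ n ≤ x := by
    rw [← Real.log_le_log_iff (by positivity) hx0, Real.log_pow]
    rwa [le_div_iff₀ hlA] at hnle
  have hge : Real.log x / (2 * Real.log A) ≤ n := by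
    have h1 : 2 ≤ Real.log x / Real.log A := by rwa [le_div_iff₀ hlA]
    have h2 : Real.log x / (2 * Real.log A) = Real.log x / Real.log A / 2 := by
      rw [div_div, mul_comm]
    rw [h2]
    linarith
  calc c₁ / 2 / (2 * Real.log A) * Real.log x = Real.log x / (2 * Real.log A) * (c₁ / 2) := by ring
    _ ≤ n * (c₁ / 2) := by gcongr
    _ ≤ _ := key n
    _ ≤ _ := Finset.sum_le_sum_of_subset_of_nonneg (fun m hm => by
        rw [mem_idealsLE] at hm ⊢; exact ⟨hm.1, hm.2.trans hAx⟩) fun _ _ _ => by positivity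

/-- Ideals of norm at most x only involve primes of norm at most x, so the Euler product dominates;
for u ≤ 1/2 one has 1/(1-u) ≤ 1 + u + 2u² ≤ exp(u + 2u²). Together with the logarithmic lower bound
this gives the lower half of Mertens. -/
theorem sum_inv_ideals_le (x : ℝ) : ∑ m ∈ idealsLE K x, 1 / realNorm m ≤
    Real.exp (∑ p ∈ primesLE K x, (1 / realNorm p.asIdeal + 2 * (1 / realNorm p.asIdeal ^ 2))) := by
  classical
  have hP : ∀ m ∈ idealsLE K x, ∀ p : HeightOneSpectrum (𝓞 K), p.asIdeal ∣ m →
      p ∈ primesLE K x := fun m hm p hp => by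
    rw [mem_idealsLE] at hm
    rw [mem_primesLE]
    exact (realNorm_le_of_dvd hp hm.1).trans hm.2
  have h := sum_prod_mult_le (fun (p : HeightOneSpectrum (𝓞 K)) j => (1 / realNorm p.asIdeal) ^ j)
    (fun p j => by positivity) (idealsLE K x) (fun m hm => (mem_idealsLE.1 hm).1)
    (primesLE K x) hP
    ((idealsLE K x).sup fun m => (primesLE K x).sup fun p => mult p m) (fun m hm p hp =>
      (Finset.le_sup (f := fun p => mult p m) hp).trans
        (Finset.le_sup (f := fun m => (primesLE K x).sup fun p => mult p m) hm))
  calc ∑ m ∈ idealsLE K x, 1 / realNorm m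
      = ∑ m ∈ idealsLE K x, ∏ p ∈ primesLE K x, (1 / realNorm p.asIdeal) ^ mult p m := by
        refine Finset.sum_congr rfl fun m hm => ?_
        conv_lhs => rw [← prod_pow_mult (mem_idealsLE.1 hm).1 _ (hP m hm), realNorm_prod]
        simp_rw [realNorm_pow, one_div_pow]
        simp
    _ ≤ _ := h
    _ ≤ ∏ p ∈ primesLE K x,
        Real.exp (1 / realNorm p.asIdeal + 2 * (1 / realNorm p.asIdeal ^ 2)) := by
        refine Finset.prod_le_prod (fun p _ => Finset.sum_nonneg fun j _ => by positivity)
          fun p _ => ?_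
        have hn := two_le_realNorm p
        have hu0 : 0 ≤ 1 / realNorm p.asIdeal := by positivity
        have hu1 : 1 / realNorm p.asIdeal ≤ 1 / 2 :=
          one_div_le_one_div_of_le two_pos hn
        rw [← one_div_pow]
        set u := 1 / realNorm p.asIdeal
        have hlt : u < 1 := by linarith
        calc _ ≤ (1 - u)⁻¹ := by
              rw [← tsum_geometric_of_lt_one hu0 hlt]
              exact (summable_geometric_of_lt_one hu0 hlt).sum_le_tsum _ fun _ _ => by positivity
          _ ≤ (u + 2 * u ^ 2) + 1 := by
              rw [inv_le_iff_one_le_mul₀ (by linarith)]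
              nlinarith [mul_nonneg hu0 hu0, mul_nonneg (mul_nonneg hu0 hu0) hu0,
                mul_nonneg (mul_nonneg hu0 hu0) (by linarith : (0 : ℝ) ≤ 1 / 2 - u)]
          _ ≤ _ := Real.add_one_le_exp _
    _ = _ := (Real.exp_sum _ _).symm

/-- A form of Mertens' second theorem for the number field `K`. -/
theorem exists_abs_sum_inv_sub_le : ∃ M : ℝ, 0 < M ∧ ∀ z : ℝ, Real.exp 1 ≤ z →
    |∑ p ∈ primesLE K z, 1 / realNorm p.asIdeal - Real.log (Real.log z)| ≤ M := by
  obtain ⟨M₁, h₁⟩ := exists_sum_inv_le K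
  obtain ⟨M₂, hM₂, h₂⟩ := exists_sum_inv_sq_le K
  obtain ⟨c, hc, x₀, h₃⟩ := exists_le_sum_inv_ideals K
  set X := max x₀ (Real.exp 1) with hX
  refine ⟨|M₁| + (|Real.log c| + 2 * M₂ + |Real.log (Real.log X)|), by positivity,
    fun z hz => ?_⟩
  have hz0 : 0 < z := (Real.exp_pos 1).trans_le hz
  have hL1 : 1 ≤ Real.log z := (Real.le_log_iff_exp_le hz0).2 hz
  rw [abs_le]
  constructor
  · have hM₁ := abs_nonneg M₁
    have hlc := neg_abs_le (Real.log c)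
    have hlX := le_abs_self (Real.log (Real.log X))
    rcases le_total X z with hXz | hXz
    · have h4 := (h₃ z ((le_max_left _ _).trans hXz)).trans (sum_inv_ideals_le K z)
      rw [← Real.log_le_iff_le_exp (by positivity), Real.log_mul hc.ne' (by linarith),
        Finset.sum_add_distrib, ← Finset.mul_sum] at h4
      have h5 := h₂ (primesLE K z)
      have := abs_nonneg (Real.log (Real.log X))
      linarith
    · have h6 : 0 ≤ ∑ p ∈ primesLE K z, 1 / realNorm p.asIdeal :=
        Finset.sum_nonneg fun p _ => by positivity
      have h7 : Real.log (Real.log z) ≤ Real.log (Real.log X) :=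
        Real.log_le_log (by linarith) (Real.log_le_log hz0 hXz)
      have := abs_nonneg (Real.log c)
      linarith
  · have := h₁ z hz
    have := le_abs_self M₁
    have : 0 ≤ |Real.log c| + 2 * M₂ + |Real.log (Real.log X)| := by positivity
    linarith

end Mertens

/-! ### Truncated binomial expansions. -/

section Bonferroni

/-- Pascal's rule for a truncated sum: the only defect from multiplication by 1 + θ is the top term.
-/
theorem sum_range_choose_succ_mul_pow {F : Type*} [CommRing F] (θ : F) (n k : ℕ) :
    ∑ j ∈ Finset.range (k + 1), ((n + 1).choose j : F) * θ ^ j =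
      (1 + θ) * ∑ j ∈ Finset.range (k + 1), (n.choose j : F) * θ ^ j - θ ^ (k + 1) * n.choose k := by
  induction k with
  | zero => simp
  | succ k ih =>
    rw [Finset.sum_range_succ, ih, Finset.sum_range_succ _ (k + 1), Nat.choose_succ_succ]
    push_cast
    ring

/-- A complex Bonferroni inequality: the error is at most the first omitted term. Passing from n to
n + 1 multiplies the error by 1 + θ, of norm at most 1, and adds one term, and Pascal's rule
combines the two bounds. -/
theorem norm_one_add_pow_sub_sum_le {θ : ℂ} (hθ : ‖1 + θ‖ ≤ 1) (n R : ℕ) :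
    ‖(1 + θ) ^ n - ∑ j ∈ Finset.range R, (n.choose j : ℂ) * θ ^ j‖ ≤ ‖θ‖ ^ R * n.choose R := by
  induction n generalizing R with
  | zero =>
    cases R with
    | zero => simp
    | succ R => simp [Finset.sum_range_succ']
  | succ n ih =>
    cases R with
    | zero => simpa using pow_le_one₀ (norm_nonneg _) hθ
    | succ k =>
      have h1 : (1 + θ) ^ (n + 1) - ∑ j ∈ Finset.range (k + 1), ((n + 1).choose j : ℂ) * θ ^ j =
          (1 + θ) * ((1 + θ) ^ n - ∑ j ∈ Finset.range (k + 1), (n.choose j : ℂ) * θ ^ j) +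
            θ ^ (k + 1) * n.choose k := by
        rw [sum_range_choose_succ_mul_pow]; ring
      rw [h1]
      refine (norm_add_le _ _).trans ?_
      rw [norm_mul, norm_mul, norm_pow, Complex.norm_natCast, Nat.choose_succ_succ, Nat.cast_add]
      have h2 := mul_le_mul hθ (ih (k + 1)) (norm_nonneg _) zero_le_one
      rw [one_mul] at h2
      linarith

/-- Factors are exchanged one at a time, the others having norm at most 1. -/
theorem norm_prod_sub_prod_le {ι : Type*} (s : Finset ι) (f g : ι → ℂ) (hf : ∀ i ∈ s, ‖f i‖ ≤ 1)
    (hg : ∀ i ∈ s, ‖g i‖ ≤ 1) : ‖∏ i ∈ s, f i - ∏ i ∈ s, g i‖ ≤ ∑ i ∈ s, ‖f i - g i‖ := by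
  classical
  induction s using Finset.induction_on with
  | empty => simp
  | insert a s ha ih =>
    rw [Finset.prod_insert ha, Finset.prod_insert ha, Finset.sum_insert ha]
    have h1 : f a * ∏ i ∈ s, f i - g a * ∏ i ∈ s, g i =
        (f a - g a) * ∏ i ∈ s, f i + g a * (∏ i ∈ s, f i - ∏ i ∈ s, g i) := by ring
    rw [h1]
    refine (norm_add_le _ _).trans ?_
    rw [norm_mul, norm_mul]
    have h2 : ‖∏ i ∈ s, f i‖ ≤ 1 := by
      rw [norm_prod]
      exact Finset.prod_le_one (fun _ _ => norm_nonneg _)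
        fun i hi => hf i (Finset.mem_insert_of_mem hi)
    have h3 := ih (fun i hi => hf i (Finset.mem_insert_of_mem hi))
      (fun i hi => hg i (Finset.mem_insert_of_mem hi))
    have h4 := hg a (Finset.mem_insert_self _ _)
    have h5 := mul_le_mul h4 h3 (norm_nonneg _) zero_le_one
    have h6 := mul_le_mul_of_nonneg_left h2 (norm_nonneg (f a - g a))
    linarith

end Bonferroni

/-! ### Sums over finite sets of primes. -/

section Truncation

variable {K : Type*} [Field K] [NumberField K]

theorem sum_powerset_div_norm {F : Type*} [Field F] [CharZero F] (a : F)
    (P : Finset (HeightOneSpectrum (𝓞 K))) :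
    ∑ D ∈ P.powerset, a ^ D.card / (Ideal.absNorm (∏ p ∈ D, p.asIdeal) : F) =
      ∏ p ∈ P, (1 + a / (Ideal.absNorm p.asIdeal : F)) := by
  rw [Finset.prod_one_add]
  refine Finset.sum_congr rfl fun D _ => ?_
  rw [Finset.prod_div_distrib, Finset.prod_const, map_prod, Nat.cast_prod]

theorem prod_one_add_div_le_exp {a : ℝ} (ha : 0 ≤ a) (P : Finset (HeightOneSpectrum (𝓞 K))) :
    ∏ p ∈ P, (1 + a / realNorm p.asIdeal) ≤ Real.exp (a * ∑ p ∈ P, 1 / realNorm p.asIdeal) := by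
  rw [Finset.mul_sum, Real.exp_sum]
  refine Finset.prod_le_prod (fun p _ => by positivity) fun p _ => ?_
  rw [mul_one_div, add_comm]
  exact Real.add_one_le_exp _

theorem sum_powerset_div_norm_le {a : ℝ} (ha : 0 ≤ a) (P : Finset (HeightOneSpectrum (𝓞 K))) :
    ∑ D ∈ P.powerset, a ^ D.card / realNorm (∏ p ∈ D, p.asIdeal) ≤
      Real.exp (a * ∑ p ∈ P, 1 / realNorm p.asIdeal) :=
  (sum_powerset_div_norm a P).le.trans (prod_one_add_div_le_exp ha P)

/-- Rankin's trick: the weight (1/2)^R 2^|D| is at least 1 on the sets with |D| ≥ R. -/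
theorem sum_powerset_tail_le {a : ℝ} (ha : 0 ≤ a) (P : Finset (HeightOneSpectrum (𝓞 K))) (R : ℕ) :
    ∑ D ∈ P.powerset with R ≤ D.card, a ^ D.card / realNorm (∏ p ∈ D, p.asIdeal) ≤
      (1 / 2) ^ R * Real.exp (2 * a * ∑ p ∈ P, 1 / realNorm p.asIdeal) := by
  refine le_trans ?_ (mul_le_mul_of_nonneg_left (sum_powerset_div_norm_le (a := 2 * a)
    (by positivity) P) (by positivity))
  rw [Finset.mul_sum]
  refine (Finset.sum_le_sum fun D hD => ?_).trans
    (Finset.sum_le_sum_of_subset_of_nonneg (Finset.filter_subset _ _) fun D _ _ => by positivity)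
  have hR := (Finset.mem_filter.1 hD).2
  rw [← mul_div_assoc]
  gcongr
  rw [mul_pow, ← mul_assoc]
  refine le_mul_of_one_le_left (by positivity) ?_
  calc (1 : ℝ) = (1 / 2) ^ R * 2 ^ R := by rw [← mul_pow]; norm_num
    _ ≤ (1 / 2) ^ R * 2 ^ D.card := by gcongr; norm_num

open scoped Classical in
/-- The number of prime divisors of `m` in the finite set `P`. -/
def omegaIn (P : Finset (HeightOneSpectrum (𝓞 K))) (m : Ideal (𝓞 K)) : ℕ :=
  (P.filter fun p => p.asIdeal ∣ m).card

open scoped Classical in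
-- Exchange of summation: the product of `D` divides m exactly when `D` consists of primes dividing
-- m, so m is met by one binomial coefficient of sets of each size.
theorem sum_powerset_dvd {F : Type*} [Semiring F] (P : Finset (HeightOneSpectrum (𝓞 K)))
    (f : ℕ → F) (y : ℝ) :
    ∑ D ∈ P.powerset, f D.card * ((idealsLE K (y / realNorm (∏ p ∈ D, p.asIdeal))).card : F) =
      ∑ m ∈ idealsLE K y, ∑ j ∈ Finset.range (omegaIn P m + 1), ((omegaIn P m).choose j : F) * f j
      := by
  have h1 (D : Finset (HeightOneSpectrum (𝓞 K))) :
      f D.card * ((idealsLE K (y / realNorm (∏ p ∈ D, p.asIdeal))).card : F) =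
      ∑ m ∈ idealsLE K y, if ∏ p ∈ D, p.asIdeal ∣ m then f D.card else 0 := by
    rw [← card_filter_dvd (prod_ne_bot' _ _ fun i _ => i.ne_bot), ← Finset.sum_filter,
      Finset.sum_const, nsmul_eq_mul, Nat.cast_comm]
  simp_rw [h1]
  rw [Finset.sum_comm]
  refine Finset.sum_congr rfl fun m _ => ?_
  have h2 : P.powerset.filter (fun D => ∏ p ∈ D, p.asIdeal ∣ m) =
      (P.filter fun p => p.asIdeal ∣ m).powerset := by
    ext D
    simp only [Finset.mem_filter, Finset.mem_powerset, prod_asIdeal_dvd_iff]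
    refine ⟨fun h p hp => Finset.mem_filter.2 ⟨h.1 hp, h.2 p hp⟩, fun h =>
      ⟨fun p hp => (Finset.mem_filter.1 (h hp)).1, fun p hp => (Finset.mem_filter.1 (h hp)).2⟩⟩
  rw [← Finset.sum_filter, h2, Finset.sum_powerset_apply_card]
  simp [omegaIn, nsmul_eq_mul]

end Truncation

/-! ### The average of a power of a truncated ω. -/

section FiniteInequality

variable {K : Type*} [Field K] [NumberField K]

theorem sum_range_ite_choose {F : Type*} [Semiring F] (f : ℕ → F) (n R : ℕ) :
    ∑ j ∈ Finset.range (n + 1), (n.choose j : F) * (if j < R then f j else 0) =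
      ∑ j ∈ Finset.range R, (n.choose j : F) * f j := by
  have h1 : ∑ j ∈ Finset.range (n + 1), (n.choose j : F) * (if j < R then f j else 0) =
      ∑ j ∈ (Finset.range (n + 1)).filter (· < R), (n.choose j : F) * f j := by
    rw [Finset.sum_filter]
    exact Finset.sum_congr rfl fun j _ => by split_ifs <;> simp
  rw [h1]
  refine Finset.sum_subset (fun j hj => ?_) fun j hj hj' => ?_
  · exact Finset.mem_range.2 (Finset.mem_filter.1 hj).2
  · have h2 : n < j := by
      by_contra h
      exact hj' (Finset.mem_filter.2 ⟨Finset.mem_range.2 (by omega), Finset.mem_range.1 hj⟩)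
    simp [Nat.choose_eq_zero_of_lt h2]

theorem sum_choose_omegaIn (P : Finset (HeightOneSpectrum (𝓞 K))) (θ : ℂ) (R : ℕ) (y : ℝ) :
    ∑ m ∈ idealsLE K y, ∑ j ∈ Finset.range R, ((omegaIn P m).choose j : ℂ) * θ ^ j =
      ∑ D ∈ P.powerset with D.card < R,
        θ ^ D.card * ((idealsLE K (y / realNorm (∏ p ∈ D, p.asIdeal))).card : ℂ) := by
  have h := sum_powerset_dvd P (fun j => if j < R then θ ^ j else 0) y
  simp_rw [sum_range_ite_choose] at h
  rw [← h, Finset.sum_filter]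
  exact Finset.sum_congr rfl fun D _ => by split_ifs <;> simp

/-- This bounds the average of the first omitted term in the Bonferroni-type inequality. -/
theorem sum_choose_omegaIn_le {c y : ℝ} (hy : 0 < y)
    (hc : ∀ t : ℝ, 0 < t → ((idealsLE K t).card : ℝ) ≤ c * t)
    (P : Finset (HeightOneSpectrum (𝓞 K))) {a : ℝ} (ha : 0 ≤ a) (R : ℕ) :
    ∑ m ∈ idealsLE K y, a ^ R * ((omegaIn P m).choose R : ℝ) ≤
      c * y * ((1 / 2) ^ R * Real.exp (2 * a * ∑ p ∈ P, 1 / realNorm p.asIdeal)) := by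
  have hc0 : 0 ≤ c := by
    have := (Nat.cast_nonneg (α := ℝ) _).trans (hc 1 one_pos)
    linarith
  have h := sum_powerset_dvd P (fun j => if j = R then a ^ R else 0) y
  have h1 (n : ℕ) : ∑ j ∈ Finset.range (n + 1), (n.choose j : ℝ) * (if j = R then a ^ R else 0) =
      a ^ R * (n.choose R : ℝ) := by
    simp only [mul_ite, mul_zero, Finset.sum_ite_eq', Finset.mem_range]
    split_ifs with h
    · ring
    · rw [Nat.choose_eq_zero_of_lt (by omega)]; simp
  simp_rw [h1] at h
  rw [← h]
  refine le_trans ?_ (mul_le_mul_of_nonneg_left (sum_powerset_tail_le ha P R) (by positivity))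
  rw [Finset.mul_sum, Finset.sum_filter]
  refine Finset.sum_le_sum fun D _ => ?_
  have hD : 0 < realNorm (∏ p ∈ D, p.asIdeal) :=
    realNorm_pos (prod_ne_bot' _ _ fun i _ => i.ne_bot)
  split_ifs with h3 h4 h5
  · rw [← h3]
    calc _ ≤ a ^ D.card * (c * (y / realNorm (∏ p ∈ D, p.asIdeal))) := by
          gcongr; exact hc _ (by positivity)
      _ = _ := by ring
  · omega
  · rw [zero_mul]; positivity
  · simp

theorem realNorm_prod_le_pow {z : ℝ} (hz : 1 ≤ z) {D : Finset (HeightOneSpectrum (𝓞 K))}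
    (hD : ∀ p ∈ D, realNorm p.asIdeal ≤ z) {R : ℕ} (hR : D.card ≤ R) :
    realNorm (∏ p ∈ D, p.asIdeal) ≤ z ^ R := by
  rw [realNorm_prod]
  refine (Finset.prod_le_prod (fun p _ => (realNorm_prime_pos p).le) hD).trans ?_
  rw [Finset.prod_const]
  exact pow_le_pow_right₀ hz hR

/-- There are three errors: truncation at order R (`hA`), replacing ideal counts by their main terms
(`hB`), and completing the truncated sum to the full product (`hC`). In `hB` the divisors have norm
at most z^R ≤ √y, so every count is taken at a point at least √y and the saving is y^(-β/2). -/
theorem norm_sum_pow_omegaIn_sub_le {κ β M c : ℝ} (hκ : 0 < κ) (hβ : 0 < β) (hM : 0 < M)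
    (hrate : ∀ t : ℝ, 1 ≤ t → |((idealsLE K t).card : ℝ) - κ * t| ≤ M * t ^ (1 - β))
    (hc : ∀ t : ℝ, 0 < t → ((idealsLE K t).card : ℝ) ≤ c * t)
    (P : Finset (HeightOneSpectrum (𝓞 K))) {y z : ℝ} (hy : 1 ≤ y) (hz : 1 ≤ z)
    (hP : ∀ p ∈ P, realNorm p.asIdeal ≤ z) {R : ℕ} (hR : z ^ R ≤ √y) {θ : ℂ}
    (hθ : ‖1 + θ‖ ≤ 1) :
    ‖∑ m ∈ idealsLE K y, (1 + θ) ^ omegaIn P m -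
        κ * y * ∏ p ∈ P, (1 + θ / (Ideal.absNorm p.asIdeal : ℂ))‖ ≤
      M * y * y ^ (-(β / 2)) * Real.exp (‖θ‖ * ∑ p ∈ P, 1 / realNorm p.asIdeal) +
        (c + κ) * y * ((1 / 2) ^ R * Real.exp (2 * ‖θ‖ * ∑ p ∈ P, 1 / realNorm p.asIdeal)) := by
  have hy0 : 0 < y := by linarith
  have hpos (D : Finset (HeightOneSpectrum (𝓞 K))) : 0 < realNorm (∏ p ∈ D, p.asIdeal) :=
    realNorm_pos (prod_ne_bot' _ _ fun i _ => i.ne_bot)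
  have hA : ‖∑ m ∈ idealsLE K y, (1 + θ) ^ omegaIn P m -
      ∑ m ∈ idealsLE K y, ∑ j ∈ Finset.range R, ((omegaIn P m).choose j : ℂ) * θ ^ j‖ ≤
      c * y * ((1 / 2) ^ R * Real.exp (2 * ‖θ‖ * ∑ p ∈ P, 1 / realNorm p.asIdeal)) := by
    rw [← Finset.sum_sub_distrib]
    refine (norm_sum_le _ _).trans (le_trans ?_ (sum_choose_omegaIn_le hy0 hc P (norm_nonneg θ) R))
    exact Finset.sum_le_sum fun m _ => norm_one_add_pow_sub_sum_le hθ _ _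
  have hB : ‖∑ m ∈ idealsLE K y, ∑ j ∈ Finset.range R, ((omegaIn P m).choose j : ℂ) * θ ^ j -
      ∑ D ∈ P.powerset with D.card < R,
        κ * y * (θ ^ D.card / (Ideal.absNorm (∏ p ∈ D, p.asIdeal) : ℂ))‖ ≤
      M * y * y ^ (-(β / 2)) * Real.exp (‖θ‖ * ∑ p ∈ P, 1 / realNorm p.asIdeal) := by
    rw [sum_choose_omegaIn, ← Finset.sum_sub_distrib]
    refine (norm_sum_le _ _).trans (le_trans ?_ (mul_le_mul_of_nonneg_left
      (sum_powerset_div_norm_le (norm_nonneg θ) P) (by positivity)))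
    rw [Finset.mul_sum]
    refine (Finset.sum_le_sum fun D hD => ?_).trans
      (Finset.sum_le_sum_of_subset_of_nonneg (Finset.filter_subset _ _)
        fun D _ _ => by have := hpos D; positivity)
    obtain ⟨hDP, hDR⟩ := Finset.mem_filter.1 hD
    set N := realNorm (∏ p ∈ D, p.asIdeal) with hN
    have hN0 : 0 < N := hpos D
    have h1 : √y ≤ y / N := by
      rw [le_div_iff₀ hN0]
      have h2 : N ≤ √y :=
        (realNorm_prod_le_pow hz (fun p hp => hP p (Finset.mem_powerset.1 hDP hp)) hDR.le).trans hR
      calc √y * N ≤ √y * √y := by gcongr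
        _ = y := Real.mul_self_sqrt hy0.le
    have h3 : 1 ≤ y / N := (Real.one_le_sqrt.2 hy).trans h1
    have h4 : θ ^ D.card * ((idealsLE K (y / N)).card : ℂ) -
        κ * y * (θ ^ D.card / (Ideal.absNorm (∏ p ∈ D, p.asIdeal) : ℂ)) =
        θ ^ D.card * ((((idealsLE K (y / N)).card : ℝ) - κ * (y / N) : ℝ) : ℂ) := by
      rw [hN]; push_cast; ring
    rw [h4, norm_mul, norm_pow, Complex.norm_real, Real.norm_eq_abs]
    have h5 : (y / N) ^ (1 - β) ≤ y / N * y ^ (-(β / 2)) := by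
      rw [sub_eq_add_neg, Real.rpow_add (by positivity), Real.rpow_one]
      gcongr
      calc (y / N) ^ (-β) ≤ (√y) ^ (-β) :=
            Real.rpow_le_rpow_of_nonpos (by positivity) h1 (by linarith)
        _ = y ^ (-(β / 2)) := by
            rw [Real.sqrt_eq_rpow, ← Real.rpow_mul hy0.le]; ring_nf
    calc ‖θ‖ ^ D.card * |((idealsLE K (y / N)).card : ℝ) - κ * (y / N)|
        ≤ ‖θ‖ ^ D.card * (M * (y / N * y ^ (-(β / 2)))) := by
          gcongr
          exact (hrate _ h3).trans (by gcongr)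
      _ = _ := by ring
  have hC : ‖∑ D ∈ P.powerset with D.card < R,
        κ * y * (θ ^ D.card / (Ideal.absNorm (∏ p ∈ D, p.asIdeal) : ℂ)) -
        κ * y * ∏ p ∈ P, (1 + θ / (Ideal.absNorm p.asIdeal : ℂ))‖ ≤
      κ * y * ((1 / 2) ^ R * Real.exp (2 * ‖θ‖ * ∑ p ∈ P, 1 / realNorm p.asIdeal)) := by
    rw [← sum_powerset_div_norm, Finset.mul_sum,
      ← Finset.sum_filter_add_sum_filter_not P.powerset (fun D => D.card < R), sub_add_cancel_left,
      norm_neg]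
    refine (norm_sum_le _ _).trans (le_trans ?_ (mul_le_mul_of_nonneg_left
      (sum_powerset_tail_le (norm_nonneg θ) P R) (by positivity)))
    simp_rw [not_lt]
    rw [Finset.mul_sum]
    refine Finset.sum_le_sum fun D _ => le_of_eq ?_
    rw [norm_mul, norm_mul, norm_div, norm_pow, Complex.norm_real, Complex.norm_real,
      Complex.norm_natCast, Real.norm_of_nonneg hκ.le, Real.norm_of_nonneg hy0.le]
  calc _ ≤ _ := (norm_sub_le_norm_sub_add_norm_sub _
          (∑ m ∈ idealsLE K y, ∑ j ∈ Finset.range R, ((omegaIn P m).choose j : ℂ) * θ ^ j) _).trans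
          (add_le_add hA ((norm_sub_le_norm_sub_add_norm_sub _ _ _).trans (add_le_add hB hC)))
    _ = _ := by ring

end FiniteInequality

/-! ### Choosing the cutoff for the primes and the order of truncation. -/

section Cutoff

variable {K : Type*} [Field K] [NumberField K]

/-- The normalization `√(log log y)`. -/
def sqrtLogLog (y : ℝ) : ℝ := √(Real.log (Real.log y))

theorem tendsto_sqrtLogLog : Filter.Tendsto sqrtLogLog Filter.atTop Filter.atTop :=
  Real.tendsto_sqrt_atTop.comp (Real.tendsto_log_atTop.comp Real.tendsto_log_atTop)

theorem log_eq_exp_sqrtLogLog_sq {y : ℝ} (hy : Real.exp 1 ≤ y) :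
    Real.log y = Real.exp (sqrtLogLog y ^ 2) := by
  have h1 : 1 ≤ Real.log y := (Real.le_log_iff_exp_le ((Real.exp_pos _).trans_le hy)).2 hy
  rw [sqrtLogLog, Real.sq_sqrt (Real.log_nonneg h1), Real.exp_log (by linarith)]

theorem card_primeDivisors_eq {y : ℝ} {m : Ideal (𝓞 K)} (hm : m ∈ idealsLE K y) :
    (primeDivisors m).card = omegaIn (primesLE K y) m := by
  classical
  obtain ⟨h0, hy⟩ := mem_idealsLE.1 hm
  rw [omegaIn]
  congr 1
  ext p
  rw [mem_primeDivisors h0, Finset.mem_filter, mem_primesLE]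
  exact ⟨fun h => ⟨(realNorm_le_of_dvd h h0).trans hy, h⟩, fun h => h.2⟩

open scoped Classical in
theorem omegaIn_add_omegaIn_sdiff {P Q : Finset (HeightOneSpectrum (𝓞 K))} (h : P ⊆ Q)
    (m : Ideal (𝓞 K)) : omegaIn P m + omegaIn (Q \ P) m = omegaIn Q m := by
  rw [omegaIn, omegaIn, omegaIn, ← Finset.card_union_of_disjoint, ← Finset.filter_union,
    Finset.union_sdiff_of_subset h]
  exact Finset.disjoint_filter_filter Finset.disjoint_sdiff

theorem sum_omegaIn_le {c y : ℝ} (hy : 0 < y)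
    (hc : ∀ t : ℝ, 0 < t → ((idealsLE K t).card : ℝ) ≤ c * t)
    (Q : Finset (HeightOneSpectrum (𝓞 K))) :
    ∑ m ∈ idealsLE K y, (omegaIn Q m : ℝ) ≤ c * y * ∑ p ∈ Q, 1 / realNorm p.asIdeal := by
  classical
  have h1 : ∑ m ∈ idealsLE K y, (omegaIn Q m : ℝ) =
      ∑ p ∈ Q, ((idealsLE K (y / realNorm p.asIdeal)).card : ℝ) := by
    simp_rw [omegaIn, Finset.card_filter]
    push_cast
    rw [Finset.sum_comm]
    refine Finset.sum_congr rfl fun p _ => ?_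
    rw [← card_filter_dvd p.ne_bot, Finset.card_filter]
    push_cast
    rfl
  rw [h1, Finset.mul_sum]
  refine Finset.sum_le_sum fun p _ => ?_
  refine (hc _ (div_pos hy (realNorm_prime_pos p))).trans (le_of_eq ?_)
  ring

variable (K) in
-- Choose R of order s = √(log log y) and z = y^(1/(2R)), so that z^R = √y. Then log log z = s² -
-- log(2R), and by Mertens discarding the primes above z changes the sum of 1/N(p) by O(1 + log s) =
-- o(s). The factor 8(|τ| + 1) in R lets 2^(-R) beat the exponential factor exp(4|τ|s) met later.
theorem exists_cutoff (τ : ℝ) : ∃ G : ℝ → ℝ,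
    Filter.Tendsto (fun s => G s / s) Filter.atTop (nhds 0) ∧
    ∀ᶠ y in Filter.atTop, ∃ z : ℝ, ∃ R : ℕ, 1 ≤ z ∧ z ≤ y ∧ z ^ R ≤ √y ∧
      8 * (|τ| + 1) * sqrtLogLog y ≤ R ∧
      |∑ p ∈ primesLE K z, 1 / realNorm p.asIdeal - sqrtLogLog y ^ 2| ≤ G (sqrtLogLog y) ∧
      |∑ p ∈ primesLE K y, 1 / realNorm p.asIdeal - ∑ p ∈ primesLE K z, 1 / realNorm p.asIdeal| ≤
        G (sqrtLogLog y) := by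
  obtain ⟨M, hM, hmert⟩ := exists_abs_sum_inv_sub_le K
  -- Rounding up and adding 1 gives R ≤ 8(|τ| + 1)s + 2, hence 2R ≤ C s once s ≥ 1.
  set C : ℝ := 2 * (8 * (|τ| + 1) + 2) with hC
  have hC0 : 1 ≤ C := by have := abs_nonneg τ; rw [hC]; linarith
  refine ⟨fun s => (2 * M + Real.log C) + Real.log s, ?_, ?_⟩
  · have h1 := Real.isLittleO_log_id_atTop.tendsto_div_nhds_zero
    have h2 : Filter.Tendsto (fun s : ℝ => (2 * M + Real.log C) / s) Filter.atTop (nhds 0) :=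
      tendsto_const_nhds.div_atTop Filter.tendsto_id
    simpa [add_div] using h2.add h1
  · filter_upwards [Filter.eventually_ge_atTop (Real.exp 1),
      tendsto_sqrtLogLog.eventually_ge_atTop C] with y hy hs
    set s := sqrtLogLog y with hsdef
    have hs1 : 1 ≤ s := hC0.trans hs
    have hy0 : 0 < y := (Real.exp_pos _).trans_le hy
    have hlog := log_eq_exp_sqrtLogLog_sq hy
    rw [← hsdef] at hlog
    have hlogpos : 0 < Real.log y := hlog ▸ Real.exp_pos _
    set R : ℕ := ⌈8 * (|τ| + 1) * s⌉₊ + 1 with hR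
    have ha := abs_nonneg τ
    have hR1 : 8 * (|τ| + 1) * s ≤ R := by
      rw [hR]; push_cast
      linarith [Nat.le_ceil (8 * (|τ| + 1) * s)]
    have hR2 : 2 * (R : ℝ) ≤ C * s := by
      have := Nat.ceil_lt_add_one (a := 8 * (|τ| + 1) * s) (by positivity)
      rw [hR, hC]; push_cast
      nlinarith
    have hRpos : 0 < 2 * (R : ℝ) := by rw [hR]; positivity
    have hR3 : 1 ≤ 2 * (R : ℝ) := by
      have : (1 : ℝ) ≤ R := by exact_mod_cast Nat.le_add_left 1 _
      linarith
    have hR4 : 2 * (R : ℝ) ≤ Real.log y := by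
      rw [hlog]
      have := Real.add_one_le_exp (s ^ 2)
      nlinarith
    set z := Real.exp (Real.log y / (2 * R)) with hz
    have hze : Real.exp 1 ≤ z := by
      rw [hz]; gcongr; rwa [le_div_iff₀ hRpos, one_mul]
    have hlogz : Real.log (Real.log z) = s ^ 2 - Real.log (2 * R) := by
      rw [hz, Real.log_exp, Real.log_div hlogpos.ne' hRpos.ne', hlog, Real.log_exp]
    have hlogy : Real.log (Real.log y) = s ^ 2 := by rw [hlog, Real.log_exp]
    have hR5 : Real.log (2 * R) ≤ Real.log C + Real.log s := by
      rw [← Real.log_mul (by linarith) (by linarith)]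
      exact Real.log_le_log hRpos hR2
    have hR6 : 0 ≤ Real.log (2 * R) := Real.log_nonneg hR3
    have h1 := abs_le.1 (hmert z hze)
    have h2 := abs_le.1 (hmert y hy)
    rw [hlogz] at h1
    rw [hlogy] at h2
    refine ⟨z, R, ?_, ?_, ?_, hR1, ?_, ?_⟩
    · exact Real.one_le_exp (by positivity)
    · rw [hz, ← Real.le_log_iff_exp_le hy0]
      exact div_le_self hlogpos.le hR3
    · rw [hz, ← Real.exp_nat_mul]
      refine Real.le_sqrt_of_sq_le (le_of_eq ?_)
      rw [← Real.exp_nat_mul]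
      conv_rhs => rw [← Real.exp_log hy0]
      congr 1
      have : (R : ℝ) ≠ 0 := by intro h; simp [h] at hRpos
      push_cast
      field_simp
    · rw [abs_le]; constructor <;> linarith [h1.1, h1.2]
    · rw [abs_le]; constructor <;> linarith [h1.1, h1.2, h2.1, h2.2]

end Cutoff

/-! ### Averages of w^ω on the unit circle. -/

section CharFun

variable {K : Type*} [Field K] [NumberField K]

theorem norm_pow_sub_pow_le_of_norm_one {w : ℂ} (hw : ‖w‖ = 1) {a b n : ℕ} (h : a + b = n) :
    ‖w ^ n - w ^ a‖ ≤ ‖w - 1‖ * b := by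
  have h1 : w ^ n - w ^ a = w ^ a * ((w - 1) * ∑ i ∈ Finset.range b, w ^ i) := by
    rw [mul_geom_sum, ← h, pow_add]; ring
  rw [h1, norm_mul, norm_mul, norm_pow, hw, one_pow, one_mul]
  refine mul_le_mul_of_nonneg_left ?_ (norm_nonneg _)
  refine (norm_sum_le _ _).trans (le_of_eq ?_)
  simp [hw]

/-- Each prime divisor above z changes w^ω by at most ‖w - 1‖, and their mean number is bounded by
the sum of 1/N(p) over the discarded primes. The rest is the truncated estimate with θ = w - 1. -/
theorem norm_sum_pow_card_sub_le {κ β M c : ℝ} (hκ : 0 < κ) (hβ : 0 < β) (hM : 0 < M)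
    (hrate : ∀ t : ℝ, 1 ≤ t → |((idealsLE K t).card : ℝ) - κ * t| ≤ M * t ^ (1 - β))
    (hc : ∀ t : ℝ, 0 < t → ((idealsLE K t).card : ℝ) ≤ c * t)
    {y z : ℝ} (hy : 1 ≤ y) (hz : 1 ≤ z) (hzy : z ≤ y) {R : ℕ} (hR : z ^ R ≤ √y) {w : ℂ}
    (hw : ‖w‖ = 1) :
    ‖∑ m ∈ idealsLE K y, w ^ (primeDivisors m).card -
        κ * y * ∏ p ∈ primesLE K z, (1 + (w - 1) / (Ideal.absNorm p.asIdeal : ℂ))‖ ≤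
      y * (c * ‖w - 1‖ * |∑ p ∈ primesLE K y, 1 / realNorm p.asIdeal -
          ∑ p ∈ primesLE K z, 1 / realNorm p.asIdeal| +
        (M * y ^ (-(β / 2)) * Real.exp (‖w - 1‖ * ∑ p ∈ primesLE K z, 1 / realNorm p.asIdeal) +
        (c + κ) * ((1 / 2) ^ R *
          Real.exp (2 * ‖w - 1‖ * ∑ p ∈ primesLE K z, 1 / realNorm p.asIdeal)))) := by
  classical
  have hy0 : 0 < y := by linarith
  have hc0 : 0 ≤ c := by
    have := (Nat.cast_nonneg (α := ℝ) _).trans (hc 1 one_pos)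
    linarith
  have hsub := primesLE_mono (K := K) hzy
  have h1 : ‖∑ m ∈ idealsLE K y, w ^ (primeDivisors m).card -
      ∑ m ∈ idealsLE K y, w ^ omegaIn (primesLE K z) m‖ ≤
      ‖w - 1‖ * (c * y * |∑ p ∈ primesLE K y, 1 / realNorm p.asIdeal -
          ∑ p ∈ primesLE K z, 1 / realNorm p.asIdeal|) := by
    rw [← Finset.sum_sub_distrib]
    refine (norm_sum_le _ _).trans ?_
    rw [← Finset.sum_sdiff hsub, add_sub_cancel_right]
    refine le_trans ?_ (mul_le_mul_of_nonneg_left ((sum_omegaIn_le hy0 hc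
      (primesLE K y \ primesLE K z)).trans (mul_le_mul_of_nonneg_left (le_abs_self _)
        (by positivity))) (norm_nonneg _))
    rw [Finset.mul_sum]
    refine Finset.sum_le_sum fun m hm => ?_
    rw [card_primeDivisors_eq hm]
    exact norm_pow_sub_pow_le_of_norm_one hw (omegaIn_add_omegaIn_sdiff hsub m)
  have h2 := norm_sum_pow_omegaIn_sub_le hκ hβ hM hrate hc (primesLE K z) hy hz
    (fun p hp => mem_primesLE.1 hp) hR (θ := w - 1) (by rw [add_sub_cancel]; exact hw.le)
  rw [add_sub_cancel] at h2
  refine (norm_sub_le_norm_sub_add_norm_sub _ (∑ m ∈ idealsLE K y, w ^ omegaIn (primesLE K z) m)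
    _).trans ((add_le_add h1 h2).trans (le_of_eq ?_))
  ring

/-- The factor 1 + (w - 1)/N(p) is a convex combination of 1 and w, and exp((w - 1)/N(p)) has norm
at most 1 since Re w ≤ 1. Hence the products can be compared factor by factor, at a cost ‖w -
1‖²/N(p)² each. -/
theorem norm_prod_one_add_sub_exp_le {w : ℂ} (hw : ‖w‖ = 1)
    (P : Finset (HeightOneSpectrum (𝓞 K))) :
    ‖∏ p ∈ P, (1 + (w - 1) / (Ideal.absNorm p.asIdeal : ℂ)) -
      Complex.exp ((w - 1) * (∑ p ∈ P, 1 / realNorm p.asIdeal : ℝ))‖ ≤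
      ‖w - 1‖ ^ 2 * ∑ p ∈ P, 1 / realNorm p.asIdeal ^ 2 := by
  push_cast
  rw [Finset.mul_sum, Complex.exp_sum, Finset.mul_sum]
  have hN (p : HeightOneSpectrum (𝓞 K)) := two_le_realNorm p
  refine (norm_prod_sub_prod_le _ _ _ (fun p _ => ?_) fun p _ => ?_).trans
    (Finset.sum_le_sum fun p _ => ?_)
  · have h1 : (1 : ℂ) + (w - 1) / (Ideal.absNorm p.asIdeal : ℂ) =
        ((1 - 1 / realNorm p.asIdeal : ℝ) : ℂ) + ((1 / realNorm p.asIdeal : ℝ) : ℂ) * w := by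
      push_cast; ring
    have h0 : 0 ≤ 1 - 1 / realNorm p.asIdeal := by
      rw [sub_nonneg, div_le_one (by linarith [hN p])]; linarith [hN p]
    have h2 : 0 ≤ 1 / realNorm p.asIdeal := by positivity
    rw [h1]
    refine (norm_add_le _ _).trans ?_
    rw [norm_mul, Complex.norm_real, Complex.norm_real, Real.norm_of_nonneg h0,
      Real.norm_of_nonneg h2, hw]
    linarith
  · rw [Complex.norm_exp, Real.exp_le_one_iff]
    have h1 : (w - 1) * (1 / (Ideal.absNorm p.asIdeal : ℂ)) =
        ((1 / realNorm p.asIdeal : ℝ) : ℂ) * (w - 1) := by push_cast; ring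
    rw [h1, Complex.re_ofReal_mul]
    refine mul_nonpos_of_nonneg_of_nonpos (by positivity) ?_
    have := (Complex.re_le_norm w).trans hw.le
    simp only [Complex.sub_re, Complex.one_re]
    linarith
  · have h3 : ‖(w - 1) / (Ideal.absNorm p.asIdeal : ℂ)‖ = ‖w - 1‖ * (1 / realNorm p.asIdeal) := by
      rw [norm_div, Complex.norm_natCast]; ring
    have h4 : ‖(w - 1) / (Ideal.absNorm p.asIdeal : ℂ)‖ ≤ 1 := by
      rw [norm_div, Complex.norm_natCast, div_le_one (realNorm_prime_pos p)]
      refine (norm_sub_le _ _).trans ?_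
      rw [hw, norm_one]
      linarith [hN p]
    have h5 := Complex.norm_exp_sub_one_sub_id_le h4
    rw [h3] at h5
    rw [mul_one_div, norm_sub_rev, ← sub_sub]
    refine h5.trans (le_of_eq ?_)
    ring

/-- Second-order Taylor expansion of exp(iτ/s); the remainder is O(|τ|³/s). The subtracted term is
the centring by the mean s². -/
theorem tendsto_sq_mul_exp_sub (τ : ℝ) : Filter.Tendsto
    (fun s : ℝ => (s : ℂ) ^ 2 * (Complex.exp (Complex.I * (τ / s : ℝ)) - 1) - Complex.I * (τ * s))
    Filter.atTop (nhds (-(τ : ℂ) ^ 2 / 2)) := by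
  rw [tendsto_iff_norm_sub_tendsto_zero]
  have h0 : Filter.Tendsto (fun s : ℝ => |τ| ^ 3 / s) Filter.atTop (nhds 0) :=
    tendsto_const_nhds.div_atTop Filter.tendsto_id
  refine squeeze_zero' (Filter.Eventually.of_forall fun _ => norm_nonneg _) ?_ h0
  filter_upwards [Filter.eventually_ge_atTop 1, Filter.eventually_ge_atTop |τ|] with s hs hs'
  have hs0 : 0 < s := by linarith
  set x : ℂ := Complex.I * (τ / s : ℝ) with hx
  have hxn : ‖x‖ = |τ| / s := by
    rw [hx, norm_mul, Complex.norm_I, one_mul, Complex.norm_real, Real.norm_eq_abs, abs_div,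
      abs_of_pos hs0]
  have h1 := Complex.exp_bound (x := x) (n := 3) (by rw [hxn, div_le_one hs0]; exact hs') (by norm_num)
  have h2 : (s : ℂ) ^ 2 * (Complex.exp x - 1) - Complex.I * (τ * s) - -(τ : ℂ) ^ 2 / 2 =
      (s : ℂ) ^ 2 * (Complex.exp x - ∑ m ∈ Finset.range 3, x ^ m / (m.factorial : ℂ)) := by
    have hsc : (s : ℂ) ≠ 0 := by exact_mod_cast hs0.ne'
    simp only [Finset.sum_range_succ, Finset.sum_range_zero, Nat.factorial]
    have hx2 : x ^ 2 = -(τ / s) ^ 2 := by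
      rw [hx, mul_pow, Complex.I_sq]; push_cast; ring
    norm_num
    rw [hx2, hx]
    push_cast
    field_simp
    ring
  rw [h2, norm_mul, norm_pow, Complex.norm_real, Real.norm_of_nonneg hs0.le]
  calc s ^ 2 * _ ≤ s ^ 2 * (‖x‖ ^ 3 * 1) := by
        gcongr
        refine h1.trans ?_
        gcongr
        norm_num [Nat.factorial]
    _ = |τ| ^ 3 / s := by rw [hxn]; field_simp

end CharFun

/-! ### The limiting characteristic function for all ideals. -/

section CharFunLimit

/-- For s = √(log log y) the first factor is y^(-b), so a power of y beats every exponential in s.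
-/
theorem tendsto_exp_decay {b : ℝ} (hb : 0 < b) (a : ℝ) :
    Filter.Tendsto (fun s : ℝ => Real.exp (-(b * Real.exp (s ^ 2)) + a * s)) Filter.atTop
      (nhds 0) := by
  refine Real.tendsto_exp_atBot.comp ?_
  have h2 : Filter.Tendsto (fun s : ℝ => (a - b * s) * s) Filter.atTop Filter.atBot := by
    refine Filter.Tendsto.atBot_mul_atTop₀ ?_ Filter.tendsto_id
    exact Filter.tendsto_atBot_add_const_left _ a
      (Filter.tendsto_neg_atTop_atBot.comp (Filter.tendsto_id.const_mul_atTop hb))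
  refine Filter.tendsto_atBot_mono (fun s => ?_) h2
  have := Real.add_one_le_exp (s ^ 2)
  nlinarith

variable (K : Type*) [Field K] [NumberField K]

theorem tendsto_charFun_idealsLE : ∃ κ : ℝ, 0 < κ ∧
    Filter.Tendsto (fun y : ℝ => ((idealsLE K y).card : ℝ) / y) Filter.atTop (nhds κ) ∧
    ∀ τ : ℝ, Filter.Tendsto (fun y : ℝ => (y : ℂ)⁻¹ * ∑ m ∈ idealsLE K y,
      Complex.exp (Complex.I * (τ * ((((primeDivisors m).card : ℝ) - sqrtLogLog y ^ 2) /
        sqrtLogLog y) : ℝ))) Filter.atTop (nhds (κ * Complex.exp (-(τ : ℂ) ^ 2 / 2))) := by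
  obtain ⟨κ, hκ, β, hβ, hβ1, M, hM, hrate⟩ := exists_abs_card_idealsLE_sub_le K
  obtain ⟨c₁, -, c, hc0, hbounds⟩ := exists_card_idealsLE_bounds K
  obtain ⟨M₂, hM₂, hsq⟩ := exists_sum_inv_sq_le K
  have hc (t : ℝ) (ht : 0 < t) : ((idealsLE K t).card : ℝ) ≤ c * t := by
    rcases le_or_gt 1 t with h | h
    · exact (hbounds t h).2
    · rw [idealsLE_eq_empty (K := K) h]; simpa using by positivity
  refine ⟨κ, hκ, ?_, fun τ => ?_⟩
  · rw [tendsto_iff_norm_sub_tendsto_zero]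
    have h0 : Filter.Tendsto (fun t : ℝ => M * t ^ (-β)) Filter.atTop (nhds 0) := by
      simpa using (tendsto_rpow_neg_atTop hβ).const_mul M
    refine squeeze_zero' (Filter.Eventually.of_forall fun _ => norm_nonneg _) ?_ h0
    filter_upwards [Filter.eventually_ge_atTop 1] with t ht
    have ht0 : 0 < t := by linarith
    have h1 : ((idealsLE K t).card : ℝ) / t - κ = (((idealsLE K t).card : ℝ) - κ * t) / t := by
      field_simp
    rw [h1, Real.norm_eq_abs, abs_div, abs_of_pos ht0, div_le_iff₀ ht0]
    refine (hrate t ht).trans (le_of_eq ?_)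
    rw [mul_assoc, ← Real.rpow_add_one ht0.ne']
    ring_nf
  obtain ⟨G, hG, hcut⟩ := exists_cutoff K τ
  set w : ℝ → ℂ := fun s => Complex.exp (Complex.I * (τ / s : ℝ)) with hwdef
  have hw (s : ℝ) : ‖w s‖ = 1 := Complex.norm_exp_I_mul_ofReal _
  have hw1 (s : ℝ) (hs : 0 < s) : ‖w s - 1‖ ≤ |τ| / s := by
    refine Real.norm_exp_I_mul_ofReal_sub_one_le.trans (le_of_eq ?_)
    rw [Real.norm_eq_abs, abs_div, abs_of_pos hs]
  choose! z R hz1 hzy hzR hR hΛ hdiff using fun y h => (h : ∃ z : ℝ, ∃ R : ℕ, 1 ≤ z ∧ z ≤ y ∧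
      z ^ R ≤ √y ∧ 8 * (|τ| + 1) * sqrtLogLog y ≤ R ∧
      |∑ p ∈ primesLE K z, 1 / realNorm p.asIdeal - sqrtLogLog y ^ 2| ≤ G (sqrtLogLog y) ∧
      |∑ p ∈ primesLE K y, 1 / realNorm p.asIdeal - ∑ p ∈ primesLE K z, 1 / realNorm p.asIdeal| ≤
        G (sqrtLogLog y))
  set Λ : ℝ → ℝ := fun y => ∑ p ∈ primesLE K (z y), 1 / realNorm p.asIdeal with hΛdef
  -- The main term. Its exponent is s²(w - 1) - iτs, which tends to -τ²/2, plus (w - 1)(Λ - s²),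
  -- which is O(G(s)/s) and tends to 0.
  set E : ℝ → ℂ := fun y => κ * (Complex.exp (-(Complex.I * (τ * sqrtLogLog y))) *
    Complex.exp ((w (sqrtLogLog y) - 1) * Λ y)) with hE
  have hElim : Filter.Tendsto E Filter.atTop (nhds (κ * Complex.exp (-(τ : ℂ) ^ 2 / 2))) := by
    refine Filter.Tendsto.const_mul _ ?_
    simp_rw [← Complex.exp_add]
    refine (Complex.continuous_exp.tendsto _).comp ?_
    have h1 := (tendsto_sq_mul_exp_sub τ).comp tendsto_sqrtLogLog
    have h2 : Filter.Tendsto (fun y => (w (sqrtLogLog y) - 1) *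
        ((Λ y - sqrtLogLog y ^ 2 : ℝ) : ℂ)) Filter.atTop (nhds 0) := by
      rw [tendsto_zero_iff_norm_tendsto_zero]
      have h3 := ((hG.comp tendsto_sqrtLogLog).const_mul |τ|)
      rw [mul_zero] at h3
      refine squeeze_zero' (Filter.Eventually.of_forall fun _ => norm_nonneg _) ?_ h3
      filter_upwards [hcut, tendsto_sqrtLogLog.eventually_gt_atTop 0] with y hy hs
      rw [norm_mul, Complex.norm_real, Real.norm_eq_abs]
      refine (mul_le_mul (hw1 _ hs) (hΛ y hy) (abs_nonneg _) (by positivity)).trans (le_of_eq ?_)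
      simp only [Function.comp_apply]
      ring
    have h4 := h1.add h2
    rw [add_zero] at h4
    refine h4.congr fun y => ?_
    simp only [Function.comp_apply, hwdef]
    push_cast
    ring
  have hbound : Filter.Tendsto (fun s : ℝ => c * |τ| * (G s / s) +
      (M * Real.exp (-(β / 2 * Real.exp (s ^ 2)) + 2 * |τ| * s) + (c + κ) * Real.exp (-(4 * s))) +
      κ * M₂ * (τ ^ 2 / s ^ 2)) Filter.atTop (nhds 0) := by
    have h1 := hG.const_mul (c * |τ|)
    have h2 := (tendsto_exp_decay (half_pos hβ) (2 * |τ|)).const_mul M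
    have h3 : Filter.Tendsto (fun s : ℝ => Real.exp (-(4 * s))) Filter.atTop (nhds 0) :=
      Real.tendsto_exp_neg_atTop_nhds_zero.comp
        (Filter.tendsto_id.const_mul_atTop (by norm_num : (0 : ℝ) < 4))
    have h4 : Filter.Tendsto (fun s : ℝ => τ ^ 2 / s ^ 2) Filter.atTop (nhds 0) :=
      tendsto_const_nhds.div_atTop (Filter.tendsto_pow_atTop two_ne_zero)
    simpa using (h1.add (h2.add (h3.const_mul (c + κ)))).add (h4.const_mul (κ * M₂))
  have hbound' := hbound.comp tendsto_sqrtLogLog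
  have hG0 := hG.eventually (Iio_mem_nhds (show (0 : ℝ) < 1 from one_pos))
  refine (tendsto_iff_of_dist ?_).1 hElim
  refine squeeze_zero' (Filter.Eventually.of_forall fun _ => dist_nonneg) ?_ hbound'
  filter_upwards [hcut, tendsto_sqrtLogLog.eventually_ge_atTop 1,
    Filter.eventually_ge_atTop (Real.exp 1), tendsto_sqrtLogLog.eventually hG0] with y hy hs hye hGy
  simp only [Function.comp_apply]
  have hlog := log_eq_exp_sqrtLogLog_sq hye
  set s := sqrtLogLog y with hsdef
  have hs0 : 0 < s := by linarith
  have hy0 : 0 < y := (Real.exp_pos _).trans_le hye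
  have hy1 : 1 ≤ y := (Real.one_le_exp zero_le_one).trans hye
  have hGs : G s ≤ s := by exact ((div_lt_one hs0).1 hGy).le
  have hΛs : Λ y ≤ 2 * s ^ 2 := by
    have := (abs_le.1 (hΛ y hy)).2
    rw [← hsdef] at this
    simp only [hΛdef]
    nlinarith
  have hΛ0 : 0 ≤ Λ y := Finset.sum_nonneg fun p _ => by positivity
  have hθΛ : ‖w s - 1‖ * Λ y ≤ 2 * |τ| * s := by
    calc _ ≤ |τ| / s * (2 * s ^ 2) := mul_le_mul (hw1 s hs0) hΛs hΛ0 (by positivity)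
      _ = _ := by field_simp
  have h1 := norm_sum_pow_card_sub_le hκ hβ hM hrate hc hy1 (hz1 y hy) (hzy y hy) (hzR y hy) (hw s)
  have h2 := norm_prod_one_add_sub_exp_le (hw s) (primesLE K (z y))
  have hsum : (y : ℂ)⁻¹ * ∑ m ∈ idealsLE K y,
      Complex.exp (Complex.I * (τ * ((((primeDivisors m).card : ℝ) - s ^ 2) / s) : ℝ)) =
      Complex.exp (-(Complex.I * (τ * s))) * ((y : ℂ)⁻¹ * ∑ m ∈ idealsLE K y,
        w s ^ (primeDivisors m).card) := by
    rw [Finset.mul_sum, Finset.mul_sum, Finset.mul_sum]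
    refine Finset.sum_congr rfl fun m _ => ?_
    rw [mul_left_comm]
    congr 1
    simp only [hwdef]
    rw [← Complex.exp_nat_mul, ← Complex.exp_add]
    congr 1
    have : (s : ℂ) ≠ 0 := by exact_mod_cast hs0.ne'
    push_cast
    field_simp
    ring
  have hnorm : ‖Complex.exp (-(Complex.I * (τ * s)))‖ = 1 := by
    have : -(Complex.I * (τ * s)) = Complex.I * ((-(τ * s) : ℝ) : ℂ) := by push_cast; ring
    rw [this, Complex.norm_exp_I_mul_ofReal]
  have hyc : (y : ℂ) ≠ 0 := by exact_mod_cast hy0.ne'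
  set Pr : ℂ := ∏ p ∈ primesLE K (z y), (1 + (w s - 1) / (Ideal.absNorm p.asIdeal : ℂ)) with hPr
  set Sm : ℂ := ∑ m ∈ idealsLE K y, w s ^ (primeDivisors m).card with hSm
  have hmain : (y : ℂ)⁻¹ * Sm - κ * Complex.exp ((w s - 1) * Λ y) =
      (y : ℂ)⁻¹ * (Sm - κ * y * Pr) + κ * (Pr - Complex.exp ((w s - 1) * Λ y)) := by
    field_simp
    ring
  rw [dist_comm, dist_eq_norm, hsum]
  simp only [hE]
  rw [← hsdef, mul_left_comm (κ : ℂ), ← mul_sub, norm_mul, hnorm, one_mul, hmain]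
  refine (norm_add_le _ _).trans (add_le_add ?_ ?_)
  · rw [norm_mul, norm_inv, Complex.norm_real, Real.norm_of_nonneg hy0.le, inv_mul_le_iff₀ hy0]
    refine h1.trans (mul_le_mul_of_nonneg_left (add_le_add ?_ (add_le_add ?_ ?_)) hy0.le)
    · calc _ ≤ c * (|τ| / s) * G s := by
            gcongr
            · exact hw1 s hs0
            · exact hdiff y hy
        _ = _ := by ring
    · rw [mul_assoc, Real.exp_add, Real.rpow_def_of_pos hy0, hlog]
      gcongr
      linarith
    -- Here log 2 > 1/2 and R ≥ 8(|τ| + 1)s. After absorbing exp(4|τ|s) the error exp(-4s) remains.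
    · have h5 : (1 / 2 : ℝ) ^ R y ≤ Real.exp (-(4 * (|τ| + 1) * s)) := by
        have h6 : (1 / 2 : ℝ) = Real.exp (-Real.log 2) := by
          rw [Real.exp_neg, Real.exp_log two_pos]; norm_num
        rw [h6, ← Real.exp_nat_mul, Real.exp_le_exp]
        have h7 := hR y hy
        rw [← hsdef] at h7
        have h8 := Real.log_two_gt_d9
        have h9 : 0 ≤ (|τ| + 1) * s := by positivity
        nlinarith
      refine mul_le_mul_of_nonneg_left ?_ (by positivity)
      calc _ ≤ Real.exp (-(4 * (|τ| + 1) * s)) * Real.exp (2 * (2 * |τ| * s)) := by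
            refine mul_le_mul h5 (Real.exp_le_exp.2 ?_) (Real.exp_pos _).le (Real.exp_pos _).le
            rw [mul_assoc]
            exact mul_le_mul_of_nonneg_left hθΛ two_pos.le
        _ = Real.exp (-(4 * s)) := by rw [← Real.exp_add]; ring_nf
  · rw [norm_mul, Complex.norm_real, Real.norm_of_nonneg hκ.le, mul_assoc]
    refine mul_le_mul_of_nonneg_left (h2.trans ?_) hκ.le
    calc _ ≤ (|τ| / s) ^ 2 * M₂ := by
          gcongr
          · exact hw1 s hs0
          · exact hsq _
      _ = _ := by rw [div_pow, sq_abs]; ring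

end CharFunLimit

/-! ### Empirical measures and Lévy's continuity theorem. -/

section Levy

open MeasureTheory ProbabilityTheory

theorem Phi_eq_gaussianReal (a : ℝ) : Phi a = (gaussianReal 0 1).real (Set.Iic a) := by
  rw [Measure.real, gaussianReal_apply_eq_integral _ one_ne_zero, ENNReal.toReal_ofReal
    (integral_nonneg fun x => gaussianPDFReal_nonneg _ _ _), Phi, ← integral_const_mul]
  congr 1
  ext u
  simp [gaussianPDFReal]

theorem Phi_nonneg (a : ℝ) : 0 ≤ Phi a := by
  rw [Phi_eq_gaussianReal]; exact measureReal_nonneg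

theorem Phi_le_one (a : ℝ) : Phi a ≤ 1 := by
  rw [Phi_eq_gaussianReal]; exact measureReal_le_one

theorem continuous_Phi : Continuous Phi := by
  have h1 : Integrable (fun u : ℝ => Real.exp (-u ^ 2 / 2)) := by
    convert integrable_exp_neg_mul_sq (b := 1 / 2) (by norm_num) using 3
    ring
  refine continuous_iff_continuousAt.2 fun a => ?_
  have h2 (b : ℝ) : Phi b = 1 / √(2 * Real.pi) * (∫ u in Set.Iic a, Real.exp (-u ^ 2 / 2)) +
      1 / √(2 * Real.pi) * ∫ u in a..b, Real.exp (-u ^ 2 / 2) := by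
    rw [intervalIntegral.integral_Iic_sub_Iic h1.integrableOn h1.integrableOn |>.symm, Phi]
    ring
  rw [funext h2]
  refine ContinuousAt.add continuousAt_const (ContinuousAt.mul continuousAt_const ?_)
  exact (intervalIntegral.continuous_primitive (fun _ _ => h1.intervalIntegrable) a).continuousAt

/-- The empirical distribution of `f` on a finite set. -/
def empirical {α : Type*} (s : Finset α) (f : α → ℝ) : Measure ℝ :=
  (s.card : ENNReal)⁻¹ • ∑ m ∈ s, Measure.dirac (f m)

theorem isProbabilityMeasure_empirical {α : Type*} {s : Finset α} (hs : s.Nonempty) (f : α → ℝ) :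
    IsProbabilityMeasure (empirical s f) := by
  constructor
  simp only [empirical, Measure.smul_apply, Measure.coe_finsetSum, Finset.sum_apply, measure_univ,
    Finset.sum_const, nsmul_eq_mul, mul_one, smul_eq_mul]
  exact ENNReal.inv_mul_cancel (by simpa using hs.ne_empty) (ENNReal.natCast_ne_top _)

theorem charFun_empirical {α : Type*} (s : Finset α) (f : α → ℝ) (τ : ℝ) :
    charFun (empirical s f) τ =
      (s.card : ℂ)⁻¹ * ∑ m ∈ s, Complex.exp (Complex.I * (τ * f m : ℝ)) := by
  rw [charFun_apply_real, empirical, integral_smul_measure, integral_finsetSum_measure]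
  · simp only [integral_dirac, ENNReal.toReal_inv, ENNReal.toReal_natCast, Complex.real_smul]
    push_cast
    congr 1
    exact Finset.sum_congr rfl fun m _ => by ring_nf
  · intro m _
    exact integrable_dirac (by simp)

theorem empirical_real_Iic {α : Type*} (s : Finset α) (f : α → ℝ) (a : ℝ)
    [DecidablePred fun m => f m ≤ a] :
    (empirical s f).real (Set.Iic a) = ((s.filter fun m => f m ≤ a).card : ℝ) / s.card := by
  simp only [Measure.real, empirical, Measure.smul_apply, Measure.coe_finsetSum, Finset.sum_apply,
    measurableSet_Iic, Measure.dirac_apply', smul_eq_mul, ENNReal.toReal_mul, ENNReal.toReal_inv,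
    ENNReal.toReal_natCast]
  rw [Finset.card_filter, ENNReal.toReal_sum]
  · rw [div_eq_inv_mul]
    push_cast
    congr 1
    refine Finset.sum_congr rfl fun m _ => ?_
    by_cases h : f m ≤ a <;> simp [h]
  · intro m _
    by_cases h : f m ≤ a <;> simp [h]

open scoped Classical in
-- Convergence of characteristic functions gives weak convergence to the Gaussian law, and the
-- boundary point of the half-line is a null set for that law.
theorem tendsto_card_filter_div_card {α : Type*} (s : ℕ → Finset α) (hs : ∀ n, (s n).Nonempty)
    (f : ℕ → α → ℝ) (h : ∀ τ : ℝ, Filter.Tendsto (fun n => ((s n).card : ℂ)⁻¹ *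
      ∑ m ∈ s n, Complex.exp (Complex.I * (τ * f n m : ℝ))) Filter.atTop
      (nhds (Complex.exp (-(τ : ℂ) ^ 2 / 2)))) (a : ℝ) :
    Filter.Tendsto (fun n => (((s n).filter fun m => f n m ≤ a).card : ℝ) / (s n).card)
      Filter.atTop (nhds (Phi a)) := by
  let μ : ℕ → ProbabilityMeasure ℝ := fun n =>
    ⟨empirical (s n) (f n), isProbabilityMeasure_empirical (hs n) _⟩
  let ν : ProbabilityMeasure ℝ := ⟨gaussianReal 0 1, inferInstance⟩
  have h1 : Filter.Tendsto μ Filter.atTop (nhds ν) := by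
    rw [ProbabilityMeasure.tendsto_iff_tendsto_charFun]
    intro τ
    have h2 : charFun (ν : Measure ℝ) τ = Complex.exp (-(τ : ℂ) ^ 2 / 2) := by
      change charFun (gaussianReal 0 1) τ = _
      rw [charFun_gaussianReal]
      simp [neg_div]
    rw [h2]
    exact (h τ).congr fun n => (charFun_empirical _ _ _).symm
  have h3 : (ν : Measure ℝ) (frontier (Set.Iic a)) = 0 := by
    rw [frontier_Iic]
    exact gaussianReal_absolutelyContinuous 0 one_ne_zero (by simp)
  have h4 := ProbabilityMeasure.tendsto_measure_of_null_frontier_of_tendsto' h1 h3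
  have h5 := (ENNReal.tendsto_toReal (measure_ne_top (ν : Measure ℝ) _)).comp h4
  rw [Phi_eq_gaussianReal]
  exact h5.congr fun n => empirical_real_Iic _ _ _

end Levy

/-! ### The Erdős–Kac theorem for all ideals. -/

section AllIdeals

variable (K : Type*) [Field K] [NumberField K]

open scoped Classical in
theorem tendsto_card_filter_idealsLE : ∃ κ : ℝ, 0 < κ ∧
    Filter.Tendsto (fun y : ℝ => ((idealsLE K y).card : ℝ) / y) Filter.atTop (nhds κ) ∧
    ∀ a : ℝ, Filter.Tendsto (fun y : ℝ => (((idealsLE K y).filter fun m =>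
      (((primeDivisors m).card : ℝ) - sqrtLogLog y ^ 2) / sqrtLogLog y ≤ a).card : ℝ) / y)
      Filter.atTop (nhds (κ * Phi a)) := by
  obtain ⟨κ, hκ, h1, h2⟩ := tendsto_charFun_idealsLE K
  refine ⟨κ, hκ, h1, fun a => Filter.tendsto_of_seq_tendsto fun u hu => ?_⟩
  -- Raising the bound to 1 keeps the unit ideal in every set, so that all empirical measures are
  -- probability measures; eventually nothing changes.
  set v : ℕ → ℝ := fun n => max 1 (u n) with hv
  have huv : ∀ᶠ n in Filter.atTop, v n = u n := by
    filter_upwards [hu.eventually_ge_atTop 1] with n hn using max_eq_right hn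
  have hvlim : Filter.Tendsto v Filter.atTop Filter.atTop :=
    hu.congr' (huv.mono fun n hn => hn.symm)
  have hne (n : ℕ) : (idealsLE K (v n)).Nonempty :=
    ⟨1, mem_idealsLE.2 ⟨one_ne_zero, by simp [hv]⟩⟩
  have h3 := tendsto_card_filter_div_card (fun n => idealsLE K (v n)) hne
    (fun n m => (((primeDivisors m).card : ℝ) - sqrtLogLog (v n) ^ 2) / sqrtLogLog (v n))
    (fun τ => by
      have h4 := (h2 τ).comp hvlim
      have h5 := (Complex.continuous_ofReal.tendsto _).comp (h1.comp hvlim)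
      have h6 := h4.div h5 (by exact_mod_cast hκ.ne')
      rw [mul_div_cancel_left₀ _ (by exact_mod_cast hκ.ne')] at h6
      refine h6.congr fun n => ?_
      have h7 : (v n : ℂ) ≠ 0 := by
        have : 1 ≤ v n := le_max_left _ _
        exact_mod_cast (by linarith : (0 : ℝ) < v n).ne'
      have h8 : ((idealsLE K (v n)).card : ℂ) ≠ 0 := by
        exact_mod_cast (Finset.card_pos.2 (hne n)).ne'
      simp only [Function.comp_apply, Pi.div_apply]
      push_cast
      field_simp) a
  refine ((h1.comp hvlim).mul h3).congr' ?_
  filter_upwards [huv] with n hn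
  have h8 : ((idealsLE K (v n)).card : ℝ) ≠ 0 := by
    exact_mod_cast (Finset.card_pos.2 (hne n)).ne'
  simp only [Function.comp_apply, ← hn]
  field_simp

end AllIdeals

/-! ### Stability of the normalization under dilation and shift. -/

section Asymptotics

theorem tendsto_log_mul_div_log {q : ℝ} (hq : 0 < q) :
    Filter.Tendsto (fun y => Real.log (q * y) / Real.log y) Filter.atTop (nhds 1) := by
  have h1 : Filter.Tendsto (fun y => Real.log q / Real.log y + 1) Filter.atTop (nhds (0 + 1)) :=
    (tendsto_const_nhds.div_atTop Real.tendsto_log_atTop).add_const 1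
  rw [zero_add] at h1
  refine h1.congr' ?_
  filter_upwards [Filter.eventually_gt_atTop 1] with y hy
  have h2 : Real.log y ≠ 0 := (Real.log_pos hy).ne'
  rw [Real.log_mul hq.ne' (by linarith)]
  field_simp

theorem sqrtLogLog_sq {y : ℝ} (hy : Real.exp 1 ≤ y) :
    sqrtLogLog y ^ 2 = Real.log (Real.log y) :=
  Real.sq_sqrt (Real.log_nonneg
    ((Real.le_log_iff_exp_le ((Real.exp_pos _).trans_le hy)).2 hy))

/-- The ratio log(qy)/log y tends to 1, so its logarithm tends to 0. -/
theorem tendsto_sqrtLogLog_sq_mul_sub {q : ℝ} (hq : 0 < q) :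
    Filter.Tendsto (fun y => sqrtLogLog (q * y) ^ 2 - sqrtLogLog y ^ 2) Filter.atTop (nhds 0) := by
  have h1 := (Real.continuousAt_log one_ne_zero).tendsto.comp (tendsto_log_mul_div_log hq)
  rw [Real.log_one] at h1
  refine h1.congr' ?_
  have h2 : Filter.Tendsto (fun y => q * y) Filter.atTop Filter.atTop :=
    Filter.tendsto_id.const_mul_atTop hq
  filter_upwards [Filter.eventually_ge_atTop (Real.exp 1),
    h2.eventually_ge_atTop (Real.exp 1)] with y hy hqy
  have h3 {t : ℝ} (ht : Real.exp 1 ≤ t) : Real.log t ≠ 0 :=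
    (zero_lt_one.trans_le
      ((Real.le_log_iff_exp_le ((Real.exp_pos _).trans_le ht)).2 ht)).ne'
  rw [sqrtLogLog_sq hy, sqrtLogLog_sq hqy, Function.comp_apply, Real.log_div (h3 hqy) (h3 hy)]

theorem tendsto_sqrtLogLog_mul_div {q : ℝ} (hq : 0 < q) :
    Filter.Tendsto (fun y => sqrtLogLog (q * y) / sqrtLogLog y) Filter.atTop (nhds 1) := by
  have h1 : Filter.Tendsto (fun y => (sqrtLogLog (q * y) ^ 2 - sqrtLogLog y ^ 2) *
      (1 / sqrtLogLog y ^ 2) + 1) Filter.atTop (nhds (0 * 0 + 1)) :=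
    ((tendsto_sqrtLogLog_sq_mul_sub hq).mul (tendsto_const_nhds.div_atTop
      ((Filter.tendsto_pow_atTop two_ne_zero).comp tendsto_sqrtLogLog))).add_const 1
  rw [zero_mul, zero_add] at h1
  have h2 := (Real.continuous_sqrt.tendsto 1).comp h1
  rw [Real.sqrt_one] at h2
  refine h2.congr' ?_
  filter_upwards [tendsto_sqrtLogLog.eventually_gt_atTop 0] with y hy
  have h3 : (sqrtLogLog (q * y) ^ 2 - sqrtLogLog y ^ 2) * (1 / sqrtLogLog y ^ 2) + 1 =
      (sqrtLogLog (q * y) / sqrtLogLog y) ^ 2 := by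
    field_simp
    ring
  have h4 : 0 ≤ sqrtLogLog (q * y) := Real.sqrt_nonneg _
  rw [Function.comp_apply, h3, Real.sqrt_sq (by positivity)]

/-- The function `A` is a threshold whose position relative to the normalization tends to `a`. -/
def IsThreshold (A : ℝ → ℝ) (a : ℝ) : Prop :=
  Filter.Tendsto (fun y => (A y - sqrtLogLog y ^ 2) / sqrtLogLog y) Filter.atTop (nhds a)

/-- Bounded shifts disappear after division by √(log log y). They will absorb the bounded changes of
ω and of log log N(m) in the later reductions. -/
theorem isThreshold_add {A : ℝ → ℝ} {a : ℝ} (hA : IsThreshold A a) (B : ℝ) :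
    IsThreshold (fun y => A y + B) a := by
  have h := Filter.Tendsto.add hA ((tendsto_const_nhds (x := B)).div_atTop tendsto_sqrtLogLog)
  rw [add_zero] at h
  exact h.congr fun y => by ring

theorem isThreshold_dilate {A : ℝ → ℝ} {a : ℝ} (hA : IsThreshold A a) {q : ℝ} (hq : 0 < q) :
    IsThreshold (fun y => A (q * y)) a := by
  have h0 : Filter.Tendsto (fun y => q * y) Filter.atTop Filter.atTop :=
    Filter.tendsto_id.const_mul_atTop hq
  have h1 := ((hA.comp h0).mul (tendsto_sqrtLogLog_mul_div hq)).add
    ((tendsto_sqrtLogLog_sq_mul_sub hq).div_atTop tendsto_sqrtLogLog)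
  rw [mul_one, add_zero] at h1
  refine h1.congr' ?_
  filter_upwards [tendsto_sqrtLogLog.eventually_gt_atTop 0,
    (tendsto_sqrtLogLog.comp h0).eventually_gt_atTop 0] with y hy hqy
  simp only [Function.comp_apply] at hqy ⊢
  field_simp
  ring

theorem isThreshold_base (a C : ℝ) :
    IsThreshold (fun y => sqrtLogLog y ^ 2 + a * sqrtLogLog y + C) a := by
  refine isThreshold_add ?_ C
  refine Filter.Tendsto.congr' ?_ tendsto_const_nhds
  filter_upwards [tendsto_sqrtLogLog.eventually_gt_atTop 0] with y hy
  field_simp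
  ring

end Asymptotics

/-! ### Sets of ideals that obey the Erdős–Kac law. -/

section Gaussian

variable {K : Type*} [Field K] [NumberField K]

open scoped Classical in
/-- The members of `T` of norm at most `y` with at most `B` prime divisors. -/
def omegaLE (T : Set (Ideal (𝓞 K))) (y B : ℝ) : Finset (Ideal (𝓞 K)) :=
  (idealsLE K y).filter fun m => m ∈ T ∧ ((primeDivisors m).card : ℝ) ≤ B

open scoped Classical in
/-- The members of `T` of norm at most `y`. -/
def membersLE (T : Set (Ideal (𝓞 K))) (y : ℝ) : Finset (Ideal (𝓞 K)) :=
  (idealsLE K y).filter fun m => m ∈ T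

theorem mem_omegaLE {T : Set (Ideal (𝓞 K))} {y B : ℝ} {m : Ideal (𝓞 K)} :
    m ∈ omegaLE T y B ↔ m ∈ idealsLE K y ∧ m ∈ T ∧ ((primeDivisors m).card : ℝ) ≤ B := by
  classical
  simp [omegaLE]

theorem mem_membersLE {T : Set (Ideal (𝓞 K))} {y : ℝ} {m : Ideal (𝓞 K)} :
    m ∈ membersLE T y ↔ m ∈ idealsLE K y ∧ m ∈ T := by
  classical
  simp [membersLE]

/-- The set `T` has density `c` and its members satisfy the Erdős–Kac theorem. -/
structure IsGaussian (T : Set (Ideal (𝓞 K))) (c : ℝ) : Prop where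
  tendsto_card : Filter.Tendsto (fun y : ℝ => ((membersLE T y).card : ℝ) / y) Filter.atTop (nhds c)
  tendsto_omegaLE : ∀ A a, IsThreshold A a → Filter.Tendsto
    (fun y : ℝ => ((omegaLE T y (A y)).card : ℝ) / y) Filter.atTop (nhds (c * Phi a))

theorem tendsto_div_of_dilate {f : ℝ → ℝ} {l q : ℝ} (hq : 0 < q)
    (h : Filter.Tendsto (fun y => f y / y) Filter.atTop (nhds l)) :
    Filter.Tendsto (fun y => f (y / q) / y) Filter.atTop (nhds (l / q)) := by
  have h1 := (h.comp (Filter.tendsto_id.atTop_div_const hq)).div_const q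
  refine h1.congr fun y => ?_
  simp only [Function.comp_apply, id]
  field_simp

theorem IsGaussian.tendsto_card_dilate {T : Set (Ideal (𝓞 K))} {c : ℝ} (hT : IsGaussian T c)
    {q : ℝ} (hq : 0 < q) :
    Filter.Tendsto (fun y : ℝ => ((membersLE T (y / q)).card : ℝ) / y) Filter.atTop
      (nhds (c / q)) :=
  tendsto_div_of_dilate (f := fun y => ((membersLE T y).card : ℝ)) hq hT.tendsto_card

theorem IsGaussian.tendsto_omegaLE_dilate {T : Set (Ideal (𝓞 K))} {c : ℝ} (hT : IsGaussian T c)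
    {q : ℝ} (hq : 0 < q) {A : ℝ → ℝ} {a : ℝ} (hA : IsThreshold A a) (B : ℝ) :
    Filter.Tendsto (fun y : ℝ => ((omegaLE T (y / q) (A y + B)).card : ℝ) / y) Filter.atTop
      (nhds (c * Phi a / q)) := by
  have h := tendsto_div_of_dilate (f := fun y => ((omegaLE T y (A (q * y) + B)).card : ℝ)) hq
    (hT.tendsto_omegaLE _ _ (isThreshold_add (isThreshold_dilate hA hq) B))
  refine h.congr fun y => ?_
  rw [mul_div_cancel₀ _ hq.ne']

variable (K) in
-- A threshold with limit a eventually lies between the exact ones for b slightly below and slightly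
-- above a, and `Phi` is continuous.
theorem exists_isGaussian_univ : ∃ κ : ℝ, 0 < κ ∧ IsGaussian (Set.univ : Set (Ideal (𝓞 K))) κ := by
  classical
  obtain ⟨κ, hκ, h1, h2⟩ := tendsto_card_filter_idealsLE K
  refine ⟨κ, hκ, ⟨?_, fun A a hA => ?_⟩⟩
  · simpa [membersLE] using h1
  · refine tendsto_order.2 ⟨fun l hl => ?_, fun l hl => ?_⟩
    · have h3 : ∃ b < a, l < κ * Phi b := by
        have h4 : ∀ᶠ b in nhdsWithin a (Set.Iio a), l < κ * Phi b :=
          ((continuous_const.mul continuous_Phi).continuousAt.eventually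
            (lt_mem_nhds hl)).filter_mono nhdsWithin_le_nhds
        obtain ⟨b, hb, hba⟩ := (h4.and self_mem_nhdsWithin).exists
        exact ⟨b, hba, hb⟩
      obtain ⟨b, hb, hlb⟩ := h3
      filter_upwards [(h2 b).eventually (lt_mem_nhds hlb), hA.eventually (lt_mem_nhds hb),
        Filter.eventually_gt_atTop 0, tendsto_sqrtLogLog.eventually_gt_atTop 0] with y hy hAy hy0 hs
      refine hy.trans_le ?_
      gcongr
      intro m hm
      obtain ⟨h5, h6⟩ := Finset.mem_filter.1 hm
      refine mem_omegaLE.2 ⟨h5, trivial, ?_⟩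
      have h7 := h6.trans hAy.le
      rw [div_le_div_iff_of_pos_right hs] at h7
      linarith
    · have h3 : ∃ b > a, κ * Phi b < l := by
        have h4 : ∀ᶠ b in nhdsWithin a (Set.Ioi a), κ * Phi b < l :=
          ((continuous_const.mul continuous_Phi).continuousAt.eventually
            (gt_mem_nhds hl)).filter_mono nhdsWithin_le_nhds
        obtain ⟨b, hb, hba⟩ := (h4.and self_mem_nhdsWithin).exists
        exact ⟨b, hba, hb⟩
      obtain ⟨b, hb, hlb⟩ := h3
      filter_upwards [(h2 b).eventually (gt_mem_nhds hlb), hA.eventually (gt_mem_nhds hb),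
        Filter.eventually_gt_atTop 0, tendsto_sqrtLogLog.eventually_gt_atTop 0] with y hy hAy hy0 hs
      refine lt_of_le_of_lt ?_ hy
      gcongr
      intro m hm
      obtain ⟨h5, -, h6⟩ := mem_omegaLE.1 hm
      refine Finset.mem_filter.2 ⟨h5, le_trans ?_ hAy.le⟩
      gcongr

end Gaussian

/-! ### Bounding multiplicities at finitely many, then at all primes. -/

section Sieve

variable {K : Type*} [Field K] [NumberField K]

open scoped Classical in
theorem primeDivisors_mul {a b : Ideal (𝓞 K)} (ha : a ≠ ⊥) (hb : b ≠ ⊥) :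
    primeDivisors (a * b) = primeDivisors a ∪ primeDivisors b := by
  ext p
  rw [Finset.mem_union, mem_primeDivisors (mul_ne_bot' ha hb), mem_primeDivisors ha,
    mem_primeDivisors hb, p.prime.dvd_mul]

theorem card_primeDivisors_le_mul {a b : Ideal (𝓞 K)} (ha : a ≠ ⊥) (hb : b ≠ ⊥) :
    (primeDivisors b).card ≤ (primeDivisors (a * b)).card := by
  classical
  rw [primeDivisors_mul ha hb]
  exact Finset.card_le_card Finset.subset_union_right

theorem card_primeDivisors_prime_pow_mul_le (p : HeightOneSpectrum (𝓞 K)) (n : ℕ)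
    {b : Ideal (𝓞 K)} (hb : b ≠ ⊥) :
    (primeDivisors (p.asIdeal ^ n * b)).card ≤ (primeDivisors b).card + 1 := by
  classical
  have hp : p.asIdeal ^ n ≠ ⊥ := pow_ne_zero n p.ne_bot
  have h1 : primeDivisors (p.asIdeal ^ n) ⊆ {p} := fun q hq => by
    rw [mem_primeDivisors hp] at hq
    rw [Finset.mem_singleton, ← dvd_prime_iff]
    exact q.prime.dvd_of_dvd_pow hq
  rw [primeDivisors_mul hp hb, add_comm]
  refine (Finset.card_union_le _ _).trans (Nat.add_le_add_right ?_ _)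
  simpa using Finset.card_le_card h1

/-- The ideals whose multiplicities at the primes of `F` are bounded by `e`. -/
def sieved (F : Finset (HeightOneSpectrum (𝓞 K))) (e : HeightOneSpectrum (𝓞 K) → ℕ) :
    Set (Ideal (𝓞 K)) := {m | ∀ p ∈ F, mult p m ≤ e p}

theorem mem_sieved_prime_pow_mul_iff {F : Finset (HeightOneSpectrum (𝓞 K))}
    {e : HeightOneSpectrum (𝓞 K) → ℕ} {p : HeightOneSpectrum (𝓞 K)} (hp : p ∉ F) (n : ℕ)
    {m : Ideal (𝓞 K)} (hm : m ≠ ⊥) : p.asIdeal ^ n * m ∈ sieved F e ↔ m ∈ sieved F e := by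
  classical
  refine forall₂_congr fun q hq => ?_
  have hqp : q ≠ p := fun h => hp (h ▸ hq)
  rw [mult_mul q (pow_ne_zero n p.ne_bot) hm, mult_pow q p.ne_bot, mult_prime, if_neg hqp, mul_zero,
    zero_add]

theorem mul_mem_idealsLE_iff {d m : Ideal (𝓞 K)} (hd : d ≠ ⊥) {y : ℝ} :
    d * m ∈ idealsLE K y ↔ m ∈ idealsLE K (y / realNorm d) := by
  rw [mem_idealsLE, mem_idealsLE, le_div_iff₀ (realNorm_pos hd), mul_comm (Ideal.absNorm m : ℝ)]
  refine and_congr ⟨fun h h' => h (by rw [h']; exact mul_zero d), fun h => mul_ne_bot' hd h⟩ ?_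
  rw [← realNorm_mul]

section Step

variable (F : Finset (HeightOneSpectrum (𝓞 K))) (e : HeightOneSpectrum (𝓞 K) → ℕ)
  (p : HeightOneSpectrum (𝓞 K)) (y B : ℝ)

open scoped Classical in
-- An ideal that violates the new condition at p is p^(e+1) times an ideal of the old set, because p
-- is not in `F`, and the cofactor has no more prime divisors.
theorem card_omegaLE_sieved_le (hp : p ∉ F) : (omegaLE (sieved F e) y B).card ≤
    (omegaLE (sieved (insert p F) e) y B).card +
      (omegaLE (sieved F e) (y / realNorm (p.asIdeal ^ (e p + 1))) B).card := by
  have hq : p.asIdeal ^ (e p + 1) ≠ ⊥ := pow_ne_zero _ p.ne_bot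
  refine le_trans (Finset.card_le_card (t := omegaLE (sieved (insert p F) e) y B ∪
    (omegaLE (sieved F e) (y / realNorm (p.asIdeal ^ (e p + 1))) B).image
      (p.asIdeal ^ (e p + 1) * ·)) fun m hm => ?_)
    ((Finset.card_union_le _ _).trans (Nat.add_le_add_left Finset.card_image_le _))
  obtain ⟨h1, h2, h3⟩ := mem_omegaLE.1 hm
  have hm0 := (mem_idealsLE.1 h1).1
  rw [Finset.mem_union]
  by_cases h : mult p m ≤ e p
  · refine Or.inl (mem_omegaLE.2 ⟨h1, fun r hr => ?_, h3⟩)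
    rcases Finset.mem_insert.1 hr with rfl | hr
    · exact h
    · exact h2 r hr
  · obtain ⟨m', rfl⟩ := (pow_dvd_iff_le_mult p hm0 (n := e p + 1)).2 (by omega)
    have hm' : m' ≠ ⊥ := fun h => hm0 (by rw [h]; exact mul_zero _)
    refine Or.inr (Finset.mem_image.2 ⟨m', mem_omegaLE.2 ⟨(mul_mem_idealsLE_iff hq).1 h1,
      (mem_sieved_prime_pow_mul_iff hp _ hm').1 h2, le_trans ?_ h3⟩, rfl⟩)
    exact_mod_cast card_primeDivisors_le_mul hq hm'

open scoped Classical in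
-- In the opposite direction, multiplying by the prime power adds at most one prime divisor, which
-- accounts for the lowered threshold.
theorem le_card_omegaLE_sieved (hp : p ∉ F) : (omegaLE (sieved (insert p F) e) y B).card +
      (omegaLE (sieved F e) (y / realNorm (p.asIdeal ^ (e p + 1))) (B + (-1))).card ≤
    (omegaLE (sieved F e) y B).card := by
  have hq : p.asIdeal ^ (e p + 1) ≠ ⊥ := pow_ne_zero _ p.ne_bot
  rw [← Finset.card_image_of_injective (f := (p.asIdeal ^ (e p + 1) * ·))
    (omegaLE (sieved F e) (y / realNorm (p.asIdeal ^ (e p + 1))) (B + (-1))) (mul_right_injective₀ hq), ← Finset.card_union_of_disjoint]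
  · refine Finset.card_le_card (Finset.union_subset (fun m hm => ?_) fun m hm => ?_)
    · obtain ⟨h1, h2, h3⟩ := mem_omegaLE.1 hm
      exact mem_omegaLE.2 ⟨h1, fun r hr => h2 r (Finset.mem_insert_of_mem hr), h3⟩
    · obtain ⟨m', hm', rfl⟩ := Finset.mem_image.1 hm
      obtain ⟨h1, h2, h3⟩ := mem_omegaLE.1 hm'
      have hm0 := (mem_idealsLE.1 h1).1
      refine mem_omegaLE.2 ⟨(mul_mem_idealsLE_iff hq).2 h1,
        (mem_sieved_prime_pow_mul_iff hp _ hm0).2 h2, ?_⟩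
      have h4 : ((primeDivisors (p.asIdeal ^ (e p + 1) * m')).card : ℝ) ≤
          (primeDivisors m').card + 1 := by
        exact_mod_cast card_primeDivisors_prime_pow_mul_le p _ hm0
      linarith
  · rw [Finset.disjoint_left]
    intro m hm hm2
    obtain ⟨m', hm', rfl⟩ := Finset.mem_image.1 hm2
    obtain ⟨h1, h2, -⟩ := mem_omegaLE.1 hm
    have h4 := h2 p (Finset.mem_insert_self _ _)
    have h5 := (pow_dvd_iff_le_mult p (mem_idealsLE.1 h1).1 (n := e p + 1)).1 (dvd_mul_right _ _)
    omega

end Step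

/-- A large threshold makes the condition on ω void, so that the two sieve inequalities combine into
an exact identity for cardinalities. -/
theorem exists_omegaLE_eq_membersLE (y : ℝ) : ∃ B₀ : ℝ, ∀ B, B₀ ≤ B → ∀ t, t ≤ y →
    ∀ T : Set (Ideal (𝓞 K)), omegaLE T t B = membersLE T t := by
  refine ⟨((idealsLE K y).sup fun m => (primeDivisors m).card : ℕ), fun B hB t ht T => ?_⟩
  ext m
  rw [mem_omegaLE, mem_membersLE]
  refine ⟨fun h => ⟨h.1, h.2.1⟩, fun h => ⟨h.1, h.2, le_trans ?_ hB⟩⟩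
  rw [mem_idealsLE] at h
  exact_mod_cast Finset.le_sup (f := fun m => (primeDivisors m).card)
    (mem_idealsLE.2 ⟨h.1.1, h.1.2.trans ht⟩)

/-- With q the norm of p^(e+1), the removed ideals form a dilated copy of relative density 1/q. The
upper and lower sieve bounds differ only by 1 in the threshold, hence have the same limit. -/
theorem exists_isGaussian_sieved (F : Finset (HeightOneSpectrum (𝓞 K)))
    (e : HeightOneSpectrum (𝓞 K) → ℕ) : ∃ c : ℝ, IsGaussian (sieved F e) c := by
  classical
  induction F using Finset.induction_on with
  | empty =>
    obtain ⟨κ, -, h⟩ := exists_isGaussian_univ K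
    refine ⟨κ, ?_⟩
    convert h using 1
    simp [sieved]
  | insert p F hp ih =>
    obtain ⟨c, hc⟩ := ih
    set q := realNorm (p.asIdeal ^ (e p + 1)) with hq
    have hq1 : 1 ≤ q := one_le_realNorm (pow_ne_zero _ p.ne_bot)
    have hq0 : 0 < q := by linarith
    refine ⟨c - c / q, ⟨?_, fun A a hA => ?_⟩⟩
    · refine (hc.tendsto_card.sub (hc.tendsto_card_dilate hq0)).congr' ?_
      filter_upwards [Filter.eventually_gt_atTop 0] with y hy
      obtain ⟨B₀, hB⟩ := exists_omegaLE_eq_membersLE (K := K) y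
      have hyq : y / q ≤ y := div_le_self hy.le hq1
      -- With `B₀ + 1` even the lowered threshold of the second inequality is at least `B₀`.
      have h1 := card_omegaLE_sieved_le F e p y (B₀ + 1) hp
      have h2 := le_card_omegaLE_sieved F e p y (B₀ + 1) hp
      rw [hB _ (by linarith) _ le_rfl, hB _ (by linarith) _ le_rfl, hB _ (by linarith) _ hyq] at h1 h2
      rw [← sub_div]
      congr 1
      have h3 := h1.antisymm h2
      rw [sub_eq_iff_eq_add]
      exact_mod_cast h3
    · have h1 := (hc.tendsto_omegaLE A a hA).sub (hc.tendsto_omegaLE_dilate hq0 hA 0)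
      have h2 := (hc.tendsto_omegaLE A a hA).sub (hc.tendsto_omegaLE_dilate hq0 hA (-1))
      have h3 : (c - c / q) * Phi a = c * Phi a - c * Phi a / q := by ring
      rw [h3]
      refine tendsto_of_tendsto_of_tendsto_of_le_of_le' h1 h2 ?_ ?_
      · filter_upwards [Filter.eventually_gt_atTop 0] with y hy
        rw [← sub_div, add_zero]
        gcongr
        rw [sub_le_iff_le_add]
        exact_mod_cast card_omegaLE_sieved_le F e p y (A y) hp
      · filter_upwards [Filter.eventually_gt_atTop 0] with y hy
        rw [← sub_div]
        gcongr
        rw [le_sub_iff_add_le]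
        exact_mod_cast le_card_omegaLE_sieved F e p y (A y) hp

theorem exists_tendsto_of_approx {f : ℝ → ℝ}
    (h : ∀ ε > 0, ∃ c', ∀ᶠ y in Filter.atTop, |f y - c'| ≤ ε) :
    ∃ c, Filter.Tendsto f Filter.atTop (nhds c) := by
  refine cauchy_map_iff_exists_tendsto.1 (Metric.cauchy_iff.2 ⟨inferInstance, fun ε hε => ?_⟩)
  obtain ⟨c', hc'⟩ := h (ε / 4) (by positivity)
  refine ⟨_, Filter.image_mem_map hc', ?_⟩
  rintro _ ⟨x, hx, rfl⟩ _ ⟨y, hy, rfl⟩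
  have h1 := abs_le.1 (show |f x - c'| ≤ ε / 4 from hx)
  have h2 := abs_le.1 (show |f y - c'| ≤ ε / 4 from hy)
  rw [Real.dist_eq, abs_lt]
  constructor <;> linarith [h1.1, h1.2, h2.1, h2.2]

/-- The proportions of T differ from the densities of its approximating supersets by an arbitrarily
small amount, so they form a Cauchy family. The condition on ω cannot enlarge the gap between T and
T'. -/
theorem exists_isGaussian_of_approx (T : Set (Ideal (𝓞 K)))
    (h : ∀ ε > 0, ∃ T' c', IsGaussian T' c' ∧ T ⊆ T' ∧
      ∀ᶠ y in Filter.atTop, ((membersLE T' y).card : ℝ) ≤ (membersLE T y).card + ε * y) :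
    ∃ c, IsGaussian T c := by
  classical
  have hsub {T' : Set (Ideal (𝓞 K))} (hT : T ⊆ T') (y : ℝ) : membersLE T y ⊆ membersLE T' y :=
    fun m hm => by
      rw [mem_membersLE] at hm ⊢
      exact ⟨hm.1, hT hm.2⟩
  have happ (ε : ℝ) (hε : 0 < ε) (T' : Set (Ideal (𝓞 K))) (c' : ℝ) (hc' : IsGaussian T' c')
      (hT : T ⊆ T') (hcard : ∀ᶠ y in Filter.atTop,
        ((membersLE T' y).card : ℝ) ≤ (membersLE T y).card + ε * y) :
      ∀ᶠ y in Filter.atTop, |((membersLE T y).card : ℝ) / y - c'| ≤ 2 * ε := by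
    filter_upwards [hcard, hc'.tendsto_card.eventually (Metric.ball_mem_nhds c' hε),
      Filter.eventually_gt_atTop 0] with y h1 h2 hy
    rw [Real.dist_eq, abs_lt] at h2
    have h3 : ((membersLE T y).card : ℝ) / y ≤ ((membersLE T' y).card : ℝ) / y := by
      gcongr; exact hsub hT y
    have h4 : ((membersLE T' y).card : ℝ) / y ≤ ((membersLE T y).card : ℝ) / y + ε := by
      rw [div_add' _ _ _ hy.ne']; gcongr
    rw [abs_le]
    constructor <;> linarith [h2.1, h2.2]
  obtain ⟨c, hc⟩ := exists_tendsto_of_approx (f := fun y => ((membersLE T y).card : ℝ) / y)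
    fun ε hε => by
      obtain ⟨T', c', h1, h2, h3⟩ := h (ε / 2) (by positivity)
      exact ⟨c', (happ _ (by positivity) T' c' h1 h2 h3).mono fun y hy => hy.trans (by linarith)⟩
  refine ⟨c, hc, fun A a hA => Metric.tendsto_nhds.2 fun ε hε => ?_⟩
  have hε5 : 0 < ε / 5 := by positivity
  obtain ⟨T', c', h1, h2, h3⟩ := h (ε / 5) hε5
  have hcc : |c - c'| ≤ 2 * (ε / 5) :=
    le_of_tendsto ((hc.sub_const c').abs) (happ _ hε5 T' c' h1 h2 h3)
  filter_upwards [h3, (h1.tendsto_omegaLE A a hA).eventually (Metric.ball_mem_nhds _ hε5),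
    Filter.eventually_gt_atTop 0] with y h4 h5 hy
  have h6 : (omegaLE T y (A y)).card ≤ (omegaLE T' y (A y)).card :=
    Finset.card_le_card fun m hm => by
      rw [mem_omegaLE] at hm ⊢
      exact ⟨hm.1, h2 hm.2.1, hm.2.2⟩
  -- The members of T' below the threshold that are outside T are among all the members of T'
  -- outside T.
  have h7 : (omegaLE T' y (A y)).card + (membersLE T y).card ≤
      (omegaLE T y (A y)).card + (membersLE T' y).card := by
    rw [← Finset.card_union_add_card_inter]
    rw [add_comm (omegaLE T y (A y)).card]
    refine Nat.add_le_add (Finset.card_le_card (Finset.union_subset (fun m hm => ?_) (hsub h2 y)))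
      (Finset.card_le_card fun m hm => ?_)
    · rw [mem_omegaLE] at hm
      exact mem_membersLE.2 ⟨hm.1, hm.2.1⟩
    · rw [Finset.mem_inter, mem_omegaLE, mem_membersLE] at hm
      exact mem_omegaLE.2 ⟨hm.1.1, hm.2.2, hm.1.2.2⟩
  have h8 : ((omegaLE T y (A y)).card : ℝ) / y ≤ ((omegaLE T' y (A y)).card : ℝ) / y := by
    gcongr
  have h9 : ((omegaLE T' y (A y)).card : ℝ) / y ≤ ((omegaLE T y (A y)).card : ℝ) / y + ε / 5 := by
    rw [div_add' _ _ _ hy.ne']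
    gcongr
    have : ((omegaLE T' y (A y)).card : ℝ) + (membersLE T y).card ≤
      (omegaLE T y (A y)).card + (membersLE T' y).card := by exact_mod_cast h7
    linarith
  rw [Real.dist_eq, abs_lt] at h5
  have h10 : |(c - c') * Phi a| ≤ 2 * (ε / 5) := by
    rw [abs_mul, abs_of_nonneg (Phi_nonneg a)]
    exact (mul_le_of_le_one_right (abs_nonneg _) (Phi_le_one a)).trans hcc
  rw [abs_le] at h10
  rw [Real.dist_eq, abs_lt]
  constructor <;> nlinarith [h5.1, h5.2, h10.1, h10.2]

/-- Impose the bounds only on a finite set `F` that contains all primes with e = 0. A violation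
outside `F` then forces p² to divide m, and such ideals have small density because the sum of
N(p)^(-2) over the primes outside `F` is small. -/
theorem exists_isGaussian_forall_mult_le (e : HeightOneSpectrum (𝓞 K) → ℕ)
    (he : {p | e p = 0}.Finite) : ∃ c : ℝ, IsGaussian {m | ∀ p, mult p m ≤ e p} c := by
  classical
  refine exists_isGaussian_of_approx _ fun ε hε => ?_
  obtain ⟨c₁, -, c, hc0, hbounds⟩ := exists_card_idealsLE_bounds K
  have hc (t : ℝ) (ht : 0 < t) : ((idealsLE K t).card : ℝ) ≤ c * t := by
    rcases le_or_gt 1 t with h | h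
    · exact (hbounds t h).2
    · rw [idealsLE_eq_empty (K := K) h]; simpa using by positivity
  obtain ⟨F₀, hF₀⟩ := summable_iff_vanishing_norm.1 (summable_prime_rpow K one_lt_two le_rfl)
    (ε / c) (by positivity)
  set F := F₀ ∪ he.toFinset with hF
  obtain ⟨c', hc'⟩ := exists_isGaussian_sieved F e
  refine ⟨sieved F e, c', hc', fun m hm p _ => hm p, ?_⟩
  filter_upwards [Filter.eventually_gt_atTop 0] with y hy
  have h1 : membersLE (sieved F e) y ⊆ membersLE {m | ∀ p, mult p m ≤ e p} y ∪
      (primesLE K y \ F).biUnion fun p => (idealsLE K y).filter (p.asIdeal ^ 2 ∣ ·) := by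
    intro m hm
    obtain ⟨h1, h2⟩ := mem_membersLE.1 hm
    obtain ⟨hm0, hmy⟩ := mem_idealsLE.1 h1
    rw [Finset.mem_union]
    by_cases h : ∀ p, mult p m ≤ e p
    · exact Or.inl (mem_membersLE.2 ⟨h1, h⟩)
    · push Not at h
      obtain ⟨p, hp⟩ := h
      have hpF : p ∉ F := fun h => (h2 p h).not_gt hp
      have hpe : e p ≠ 0 := fun h => hpF (Finset.mem_union_right _ (by simpa using h))
      have hdvd : p.asIdeal ^ 2 ∣ m := (pow_dvd_iff_le_mult p hm0).2 (by omega)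
      refine Or.inr (Finset.mem_biUnion.2 ⟨p, Finset.mem_sdiff.2 ⟨mem_primesLE.2 ?_, hpF⟩,
        Finset.mem_filter.2 ⟨h1, hdvd⟩⟩)
      exact (realNorm_le_of_dvd ((dvd_pow_self _ two_ne_zero).trans hdvd) hm0).trans hmy
  have h2 := (Finset.card_le_card h1).trans ((Finset.card_union_le _ _).trans
    (Nat.add_le_add_left Finset.card_biUnion_le _))
  have h3 : ((membersLE (sieved F e) y).card : ℝ) ≤ (membersLE {m | ∀ p, mult p m ≤ e p} y).card +
      ∑ p ∈ primesLE K y \ F, (((idealsLE K y).filter (p.asIdeal ^ 2 ∣ ·)).card : ℝ) := by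
    exact_mod_cast h2
  refine h3.trans (add_le_add_right ?_ _)
  have h4 := hF₀ (primesLE K y \ F) (by
    rw [Finset.disjoint_left]
    exact fun p hp hp' => (Finset.mem_sdiff.1 hp).2 (Finset.mem_union_left _ hp'))
  have h5 := (le_abs_self _).trans h4.le
  calc _ ≤ ∑ p ∈ primesLE K y \ F, c * y * realNorm p.asIdeal ^ (-(2 : ℝ)) := by
        refine Finset.sum_le_sum fun p _ => ?_
        have hp := realNorm_prime_pos p
        rw [card_filter_dvd (pow_ne_zero 2 p.ne_bot), realNorm_pow]
        refine (hc _ (by positivity)).trans (le_of_eq ?_)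
        rw [Real.rpow_neg hp.le, Real.rpow_two]
        ring
    _ ≤ c * y * (ε / c) := by rw [← Finset.mul_sum]; gcongr
    _ = ε * y := by field_simp

end Sieve

/-! ### The factorization m = a^k b. -/

section Decomposition

variable {K : Type*} [Field K] [NumberField K]

/-- The nonzero ideals all of whose nonzero multiplicities lie in `E`. -/
def exponentSet (K : Type*) [Field K] [NumberField K] (E : Set ℕ) : Set (Ideal (𝓞 K)) :=
  {m | m ≠ ⊥ ∧ ∀ p : HeightOneSpectrum (𝓞 K), mult p m ≠ 0 → mult p m ∈ E}

/-- The squarefree ideals coprime to `b`. -/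
def squarefreeCoprime (b : Ideal (𝓞 K)) : Set (Ideal (𝓞 K)) :=
  {a | ∀ p : HeightOneSpectrum (𝓞 K), mult p a ≤ if mult p b = 0 then 1 else 0}

/-- The product of the primes of multiplicity exactly `k` in `m`. -/
def exactPart (k : ℕ) (m : Ideal (𝓞 K)) : Ideal (𝓞 K) :=
  ∏ p ∈ primeDivisors m, p.asIdeal ^ (if mult p m = k then 1 else 0)

/-- The part of `m` supported on the primes of multiplicity different from `k`. -/
def corePart (k : ℕ) (m : Ideal (𝓞 K)) : Ideal (𝓞 K) :=
  ∏ p ∈ primeDivisors m, p.asIdeal ^ (if mult p m = k then 0 else mult p m)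

theorem exactPart_ne_bot (k : ℕ) (m : Ideal (𝓞 K)) : exactPart k m ≠ ⊥ :=
  prod_ne_bot' _ _ fun p _ => pow_ne_zero _ p.ne_bot

theorem corePart_ne_bot (k : ℕ) (m : Ideal (𝓞 K)) : corePart k m ≠ ⊥ :=
  prod_ne_bot' _ _ fun p _ => pow_ne_zero _ p.ne_bot

theorem notMem_primeDivisors_iff {m : Ideal (𝓞 K)} (hm : m ≠ ⊥) {p : HeightOneSpectrum (𝓞 K)} :
    p ∉ primeDivisors m ↔ mult p m = 0 := by
  rw [mem_primeDivisors hm, dvd_iff_mult_ne_zero p hm, not_not]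

theorem mult_exactPart {k : ℕ} (hk : k ≠ 0) {m : Ideal (𝓞 K)} (hm : m ≠ ⊥)
    (p : HeightOneSpectrum (𝓞 K)) : mult p (exactPart k m) = if mult p m = k then 1 else 0 := by
  classical
  rw [exactPart, mult_prod_pow _ (fun p => if mult p m = k then 1 else 0)]
  split_ifs with h1 h2 h2
  · rfl
  · rfl
  · rw [notMem_primeDivisors_iff hm] at h1; omega
  · rfl

theorem mult_corePart {k : ℕ} {m : Ideal (𝓞 K)} (hm : m ≠ ⊥) (p : HeightOneSpectrum (𝓞 K)) :
    mult p (corePart k m) = if mult p m = k then 0 else mult p m := by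
  classical
  rw [corePart, mult_prod_pow _ (fun p => if mult p m = k then 0 else mult p m)]
  split_ifs with h1 h2 h2
  · rfl
  · rfl
  · rfl
  · rw [notMem_primeDivisors_iff hm] at h1; omega

theorem exactPart_pow_mul_corePart {k : ℕ} (hk : k ≠ 0) {m : Ideal (𝓞 K)} (hm : m ≠ ⊥) :
    exactPart k m ^ k * corePart k m = m := by
  have h1 := exactPart_ne_bot k m
  have h2 := corePart_ne_bot k m
  refine ext_mult (mul_ne_bot' (pow_ne_zero k h1) h2) hm fun p => ?_
  rw [mult_mul p (pow_ne_zero k h1) h2, mult_pow p h1, mult_exactPart hk hm, mult_corePart hm]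
  split_ifs with h <;> simp [h]

theorem exactPart_mem {k : ℕ} (hk : k ≠ 0) {m : Ideal (𝓞 K)} (hm : m ≠ ⊥) :
    exactPart k m ∈ squarefreeCoprime (corePart k m) := fun p => by
  rw [mult_exactPart hk hm, mult_corePart hm]
  split_ifs <;> simp_all

theorem corePart_mem {k : ℕ} {E : Set ℕ} {m : Ideal (𝓞 K)} (hm : m ∈ exponentSet K E) :
    corePart k m ∈ exponentSet K (E \ {k}) := by
  refine ⟨corePart_ne_bot k m, fun p hp => ?_⟩
  rw [mult_corePart hm.1] at hp ⊢
  split_ifs at hp ⊢ with h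
  · exact absurd rfl hp
  · exact ⟨hm.2 p hp, h⟩

theorem mult_pow_mul {a b : Ideal (𝓞 K)} (ha : a ≠ ⊥) (hb : b ≠ ⊥) (k : ℕ)
    (p : HeightOneSpectrum (𝓞 K)) : mult p (a ^ k * b) = k * mult p a + mult p b := by
  rw [mult_mul p (pow_ne_zero k ha) hb, mult_pow p ha]

theorem pow_mul_mem_exponentSet {k : ℕ} {E : Set ℕ} (hkE : k ∈ E) {a b : Ideal (𝓞 K)} (ha : a ≠ ⊥)
    (hb : b ∈ exponentSet K (E \ {k})) (hab : a ∈ squarefreeCoprime b) :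
    a ^ k * b ∈ exponentSet K E := by
  refine ⟨mul_ne_bot' (pow_ne_zero k ha) hb.1, fun p hp => ?_⟩
  rw [mult_pow_mul ha hb.1] at hp ⊢
  have h1 := hab p
  split_ifs at h1 with h
  · rw [h, add_zero] at hp ⊢
    have h2 : mult p a = 1 := by
      have : mult p a ≠ 0 := fun h => hp (by rw [h, mul_zero])
      omega
    rwa [h2, mul_one]
  · rw [Nat.le_zero.1 h1, mul_zero, zero_add]
    exact (hb.2 p h).1

theorem corePart_pow_mul {k : ℕ} {E : Set ℕ} {a b : Ideal (𝓞 K)} (ha : a ≠ ⊥)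
    (hb : b ∈ exponentSet K (E \ {k})) (hab : a ∈ squarefreeCoprime b) :
    corePart k (a ^ k * b) = b := by
  have hm := mul_ne_bot' (pow_ne_zero k ha) hb.1
  refine ext_mult (corePart_ne_bot _ _) hb.1 fun p => ?_
  rw [mult_corePart hm, mult_pow_mul ha hb.1]
  have h1 := hab p
  by_cases h : mult p b = 0
  · rw [if_pos h] at h1
    rw [h, add_zero]
    interval_cases mult p a
    · simp
    · simp
  · rw [if_neg h] at h1
    rw [Nat.le_zero.1 h1, mul_zero, zero_add, if_neg]
    exact (hb.2 p h).2

theorem pow_mul_injective {k : ℕ} (hk : k ≠ 0) {a a' b : Ideal (𝓞 K)} (ha : a ≠ ⊥) (ha' : a' ≠ ⊥)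
    (hb : b ≠ ⊥) (h : a ^ k * b = a' ^ k * b) : a = a' := by
  refine ext_mult ha ha' fun p => ?_
  have h1 := congrArg (mult p) h
  rw [mult_pow_mul ha hb, mult_pow_mul ha' hb] at h1
  exact Nat.eq_of_mul_eq_mul_left (Nat.pos_of_ne_zero hk) (by omega)

/-- The real `k`-th root of the norm. -/
def rootNorm (k : ℕ) (b : Ideal (𝓞 K)) : ℝ := realNorm b ^ ((k : ℝ)⁻¹)

theorem rootNorm_pow {k : ℕ} (hk : k ≠ 0) (b : Ideal (𝓞 K)) : rootNorm k b ^ k = realNorm b :=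
  Real.rpow_inv_natCast_pow (by positivity) hk

theorem one_le_rootNorm (k : ℕ) {b : Ideal (𝓞 K)} (hb : b ≠ ⊥) : 1 ≤ rootNorm k b :=
  Real.one_le_rpow (one_le_realNorm hb) (by positivity)

theorem realNorm_pow_mul {k : ℕ} (hk : k ≠ 0) (a b : Ideal (𝓞 K)) :
    realNorm (a ^ k * b) = (realNorm a * rootNorm k b) ^ k := by
  rw [mul_pow, rootNorm_pow hk, realNorm_mul, realNorm_pow]

theorem pow_mul_mem_idealsLE_iff {k : ℕ} (hk : k ≠ 0) {a b : Ideal (𝓞 K)} (hb : b ≠ ⊥) {y : ℝ}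
    (hy : 0 ≤ y) : a ^ k * b ∈ idealsLE K (y ^ k) ↔ a ∈ idealsLE K (y / rootNorm k b) := by
  have hq : 0 < rootNorm k b := zero_lt_one.trans_le (one_le_rootNorm k hb)
  rw [mem_idealsLE, mem_idealsLE, le_div_iff₀ hq]
  refine and_congr ⟨fun h h' => h ?_, fun h => mul_ne_bot' (pow_ne_zero k h) hb⟩ ?_
  · rw [h', ← Ideal.zero_eq_bot, zero_pow hk, zero_mul]
  · rw [← pow_le_pow_iff_left₀ (by positivity) hy hk, ← realNorm_pow_mul hk]

open scoped Classical in
-- The fibre of `corePart` over b is parametrized by a ↦ a^k b with a squarefree and coprime to b.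
-- Writing the norm bound as y^k makes it linear in N(a).
theorem card_filter_exponentSet {k : ℕ} (hk : k ≠ 0) {E : Set ℕ} (hkE : k ∈ E) {y : ℝ} (hy : 0 ≤ y)
    (P : Ideal (𝓞 K) → Prop) [DecidablePred P] :
    ((membersLE (exponentSet K E) (y ^ k)).filter P).card =
      ∑ b ∈ idealsLE K (y ^ k), if b ∈ exponentSet K (E \ {k}) then
        ((membersLE (squarefreeCoprime b) (y / rootNorm k b)).filter fun a => P (a ^ k * b)).card
      else 0 := by
  rw [← Finset.sum_filter]
  rw [Finset.card_eq_sum_card_fiberwise (f := corePart k)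
    (t := (idealsLE K (y ^ k)).filter (· ∈ exponentSet K (E \ {k})))]
  · refine Finset.sum_congr rfl fun b hb => ?_
    obtain ⟨hb1, hb⟩ := Finset.mem_filter.1 hb
    rw [← Finset.card_image_of_injOn (s := (membersLE (squarefreeCoprime b)
      (y / rootNorm k b)).filter fun a => P (a ^ k * b)) (f := fun a => a ^ k * b)]
    · congr 1
      ext m
      rw [Finset.mem_filter, Finset.mem_filter, mem_membersLE, Finset.mem_image]
      constructor
      · rintro ⟨⟨⟨h1, h2⟩, h3⟩, rfl⟩
        have h4 := exactPart_pow_mul_corePart hk h2.1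
        refine ⟨exactPart k m, Finset.mem_filter.2 ⟨mem_membersLE.2
          ⟨(pow_mul_mem_idealsLE_iff hk hb.1 hy).1 (by rwa [h4]), exactPart_mem hk h2.1⟩,
          by rwa [h4]⟩, h4⟩
      · rintro ⟨a, ha, rfl⟩
        rw [Finset.mem_filter, mem_membersLE] at ha
        obtain ⟨⟨h1, h2⟩, h3⟩ := ha
        have ha0 := (mem_idealsLE.1 h1).1
        exact ⟨⟨⟨(pow_mul_mem_idealsLE_iff hk hb.1 hy).2 h1,
          pow_mul_mem_exponentSet hkE ha0 hb h2⟩, h3⟩, corePart_pow_mul ha0 hb h2⟩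
    · intro a ha a' ha' h
      rw [Finset.mem_coe, Finset.mem_filter, mem_membersLE, mem_idealsLE] at ha ha'
      exact pow_mul_injective hk ha.1.1.1 ha'.1.1.1 hb.1 h
  · intro m hm
    rw [Finset.mem_coe, Finset.mem_filter, mem_membersLE, mem_idealsLE] at hm
    refine Finset.mem_coe.2 (Finset.mem_filter.2 ⟨mem_idealsLE.2 ⟨corePart_ne_bot k m, ?_⟩,
      corePart_mem hm.1.2⟩)
    refine le_trans (realNorm_le_of_dvd ?_ hm.1.1.1) hm.1.1.2
    exact ⟨exactPart k m ^ k, by rw [mul_comm, exactPart_pow_mul_corePart hk hm.1.1.1]⟩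

end Decomposition

/-! ### Convergence of the sum of N(b)^(-1/k). -/

section Summability

variable {K : Type*} [Field K] [NumberField K]

/-- A geometric sum over the exponents above k; the maximum makes the right side vanish when no such
exponent is in range. -/
theorem sum_range_ite_pow_mul (r : ℝ) (k J : ℕ) :
    (∑ j ∈ Finset.range J, if k < j + 1 then r ^ (j + 1) else 0) * (1 - r) =
      r ^ (k + 1) - r ^ (max J k + 1) := by
  induction J with
  | zero => simp
  | succ J ih =>
    rw [Finset.sum_range_succ, add_mul, ih]
    split_ifs with h
    · rw [max_eq_left (by omega), max_eq_left (by omega)]; ring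
    · rw [max_eq_right (by omega), max_eq_right (by omega)]; ring

/-- A geometric series with ratio N^(-1/k) that starts at exponent k + 1. The ratio is at most
2^(-1/k), so the constant does not depend on N. -/
theorem sum_range_rpow_le {k : ℕ} (hk : k ≠ 0) {N : ℝ} (hN : 2 ≤ N) (J : ℕ) :
    ∑ j ∈ Finset.range (J + 1), (if j = 0 then 1 else if k < j then N ^ (-((j : ℝ) / k)) else 0) ≤
      1 + 1 / (1 - 2 ^ (-(1 / (k : ℝ)))) * N ^ (-(1 + 1 / (k : ℝ))) := by
  have hk0 : (0 : ℝ) < k := by exact_mod_cast Nat.pos_of_ne_zero hk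
  have hN0 : 0 < N := by linarith
  set r : ℝ := N ^ (-(1 / (k : ℝ))) with hr
  have hr0 : 0 < r := Real.rpow_pos_of_pos hN0 _
  have hr2 : r ≤ 2 ^ (-(1 / (k : ℝ))) :=
    Real.rpow_le_rpow_of_nonpos two_pos hN (by simp)
  have h21 : (2 : ℝ) ^ (-(1 / (k : ℝ))) < 1 :=
    Real.rpow_lt_one_of_one_lt_of_neg one_lt_two (by simpa using Nat.pos_of_ne_zero hk)
  have hpow (j : ℕ) : N ^ (-((j : ℝ) / k)) = r ^ j := by
    rw [hr, ← Real.rpow_natCast, ← Real.rpow_mul hN0.le]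
    congr 1; ring
  have hlast : N ^ (-(1 + 1 / (k : ℝ))) = r ^ (k + 1) := by
    rw [← hpow]; congr 1; push_cast; field_simp
  rw [hlast, Finset.sum_range_succ']
  simp only [Nat.succ_ne_zero, if_false, if_true, hpow]
  rw [add_comm]
  gcongr
  have hr1 : r < 1 := hr2.trans_lt h21
  rw [div_mul_eq_mul_div, one_mul, le_div_iff₀ (by linarith)]
  have h0 : 0 ≤ ∑ j ∈ Finset.range J, (if k < j + 1 then r ^ (j + 1) else 0) :=
    Finset.sum_nonneg fun j _ => by positivity
  have h1 := sum_range_ite_pow_mul r k J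
  have h2 : 0 ≤ r ^ (max J k + 1) := by positivity
  nlinarith

/-- The exponents of b are at least k + 1, so each Euler factor is 1 + O(N(p)^(-(1 + 1/k))), and the
product of these converges. -/
theorem exists_sum_rootNorm_inv_le (K : Type*) [Field K] [NumberField K] {k : ℕ} (hk : k ≠ 0)
    {E : Set ℕ} (hE : ∀ j ∈ E, k ≤ j) :
    ∃ M : ℝ, ∀ G : Finset (Ideal (𝓞 K)), (∀ b ∈ G, b ∈ exponentSet K (E \ {k})) →
      ∑ b ∈ G, (rootNorm k b)⁻¹ ≤ M := by
  classical
  set C : ℝ := 1 / (1 - 2 ^ (-(1 / (k : ℝ)))) with hC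
  have hk1 : (1 : ℝ) ≤ k := by exact_mod_cast Nat.pos_of_ne_zero hk
  have hC0 : 0 ≤ C := by
    have : (2 : ℝ) ^ (-(1 / (k : ℝ))) < 1 :=
      Real.rpow_lt_one_of_one_lt_of_neg one_lt_two (by simpa using Nat.pos_of_ne_zero hk)
    exact div_nonneg zero_le_one (by linarith)
  have hs1 : 1 < 1 + 1 / (k : ℝ) := by simpa using Nat.pos_of_ne_zero hk
  have hs2 : 1 + 1 / (k : ℝ) ≤ 2 := by
    have : 1 / (k : ℝ) ≤ 1 := (div_le_one (by linarith)).2 hk1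
    linarith
  have hsum := summable_prime_rpow K hs1 hs2
  refine ⟨Real.exp (C * ∑' p : HeightOneSpectrum (𝓞 K),
    realNorm p.asIdeal ^ (-(1 + 1 / (k : ℝ)))), fun G hG => ?_⟩
  set P := G.biUnion primeDivisors with hP
  have hPG (b : Ideal (𝓞 K)) (hb : b ∈ G) (p : HeightOneSpectrum (𝓞 K)) (hp : p.asIdeal ∣ b) :
      p ∈ P := Finset.mem_biUnion.2 ⟨b, hb, (mem_primeDivisors (hG b hb).1).2 hp⟩
  set J := G.sup fun b => P.sup fun p => mult p b with hJ
  set w : HeightOneSpectrum (𝓞 K) → ℕ → ℝ := fun p j =>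
    if j = 0 then 1 else if k < j then realNorm p.asIdeal ^ (-((j : ℝ) / k)) else 0 with hw
  have h1 := sum_prod_mult_le w (fun p j => by simp only [hw]; positivity) G
    (fun b hb => (hG b hb).1) P hPG J fun b hb p hp =>
      (Finset.le_sup (f := fun p => mult p b) hp).trans
        (Finset.le_sup (f := fun b => P.sup fun p => mult p b) hb)
  have h2 (b : Ideal (𝓞 K)) (hb : b ∈ G) : (rootNorm k b)⁻¹ = ∏ p ∈ P, w p (mult p b) := by
    conv_lhs => rw [rootNorm, ← prod_pow_mult (hG b hb).1 P (hPG b hb), realNorm_prod,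
      ← Real.finsetProd_rpow _ _ (fun p _ => by positivity), ← Finset.prod_inv_distrib]
    refine Finset.prod_congr rfl fun p _ => ?_
    have hp0 := realNorm_prime_pos p
    simp only [hw]
    split_ifs with h3 h4
    · simp [h3, realNorm]
    · rw [realNorm_pow, ← Real.rpow_natCast, ← Real.rpow_mul hp0.le, ← Real.rpow_neg hp0.le]
      rfl
    · have h5 := (hG b hb).2 p h3
      have h6 := hE _ h5.1
      exact absurd (lt_of_le_of_ne h6 (Ne.symm h5.2)) h4
  rw [Finset.sum_congr rfl h2]
  refine h1.trans ?_
  have h3 : C * ∑ p ∈ P, realNorm p.asIdeal ^ (-(1 + 1 / (k : ℝ))) ≤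
      C * ∑' p : HeightOneSpectrum (𝓞 K), realNorm p.asIdeal ^ (-(1 + 1 / (k : ℝ))) := by
    gcongr
    exact hsum.sum_le_tsum _ fun p _ => by positivity
  refine le_trans ?_ (Real.exp_le_exp.2 h3)
  rw [Finset.mul_sum, Real.exp_sum]
  refine Finset.prod_le_prod (fun p _ => Finset.sum_nonneg fun j _ => by
    simp only [hw]; positivity) fun p _ => ?_
  refine (sum_range_rpow_le hk (two_le_realNorm p) J).trans ?_
  rw [add_comm]
  exact Real.add_one_le_exp _

end Summability

/-! ### The distribution on the fibre over a fixed b. -/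

section Fibre

variable {K : Type*} [Field K] [NumberField K]

/-- Since √L + s ≥ 1, the difference √L - s is no larger than L - s². -/
theorem abs_add_mul_sqrt_sub_le {s L D : ℝ} (hs : 1 ≤ s) (hL : |L - s ^ 2| ≤ D) (hL0 : 0 ≤ L)
    (t : ℝ) : |L + t * √L - (s ^ 2 + t * s)| ≤ D * (1 + |t|) := by
  have h1 : |√L - s| ≤ D := by
    have h2 : L - s ^ 2 = (√L - s) * (√L + s) := by
      linear_combination (Real.sq_sqrt hL0).symm
    rw [h2, abs_mul] at hL
    have h3 : 1 ≤ |√L + s| := by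
      rw [abs_of_nonneg (by positivity)]
      linarith [Real.sqrt_nonneg L]
    exact (le_mul_of_one_le_right (abs_nonneg _) h3).trans hL
  calc |L + t * √L - (s ^ 2 + t * s)| = |(L - s ^ 2) + t * (√L - s)| := by ring_nf
    _ ≤ |L - s ^ 2| + |t| * |√L - s| := (abs_add_le _ _).trans (by rw [abs_mul])
    _ ≤ D + |t| * D := by gcongr
    _ = _ := by ring

/-- If √y < n ≤ y then log n lies between half of log y and log y, so taking another logarithm loses
at most log 2; the k-th power adds log k. -/
theorem abs_log_log_sub_le {k : ℕ} (hk : k ≠ 0) {y n : ℝ} (hy : Real.exp 2 ≤ y) (hny : n ≤ y)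
    (hn : √y < n) :
    |Real.log (Real.log (n ^ k)) - sqrtLogLog y ^ 2| ≤ Real.log k + Real.log 2 := by
  have hy0 : 0 < y := (Real.exp_pos _).trans_le hy
  have hn0 : 0 < n := (Real.sqrt_nonneg y).trans_lt hn
  have hk1 : (1 : ℝ) ≤ k := by exact_mod_cast Nat.pos_of_ne_zero hk
  have hlogy : 2 ≤ Real.log y := (Real.le_log_iff_exp_le hy0).2 hy
  have h1 : Real.log y / 2 < Real.log n := by
    rw [← Real.log_sqrt hy0.le]
    exact Real.log_lt_log (Real.sqrt_pos.2 hy0) hn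
  have h2 : Real.log n ≤ Real.log y := Real.log_le_log hn0 hny
  have h3 : 0 < Real.log n := by linarith
  have hlk : 0 ≤ Real.log k := Real.log_nonneg hk1
  rw [Real.log_pow, Real.log_mul (by linarith) h3.ne',
    sqrtLogLog_sq ((Real.exp_le_exp.2 one_le_two).trans hy)]
  have h4 : Real.log (Real.log n) ≤ Real.log (Real.log y) := Real.log_le_log h3 h2
  have h5 : Real.log (Real.log y) - Real.log 2 ≤ Real.log (Real.log n) := by
    rw [← Real.log_div (by linarith) two_ne_zero]
    exact Real.log_le_log (by linarith) h1.le
  have h6 : 0 < Real.log (Real.log y) := Real.log_pos (by linarith)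
  have h7 : 0 < Real.log 2 := Real.log_pos one_lt_two
  exact abs_le.2 ⟨by linarith, by linarith⟩

open scoped Classical in
/-- The members `a` of `T` with `N(a^k b) ≤ y^k` for which `a^k b` satisfies the condition of
the distribution function at `t`. -/
def ratioLE (g : Ideal (𝓞 K) → ℝ) (k : ℕ) (b : Ideal (𝓞 K)) (t y : ℝ) : Finset (Ideal (𝓞 K)) :=
  (membersLE (squarefreeCoprime b) (y / rootNorm k b)).filter fun a =>
    3 ≤ Ideal.absNorm (a ^ k * b) ∧ ratio g (a ^ k * b) ≤ t

theorem tendsto_card_idealsLE_sqrt_div (K : Type*) [Field K] [NumberField K] :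
    Filter.Tendsto (fun y : ℝ => ((idealsLE K (√y)).card : ℝ) / y) Filter.atTop (nhds 0) := by
  obtain ⟨c₁, -, c, hc0, hbounds⟩ := exists_card_idealsLE_bounds K
  have h0 : Filter.Tendsto (fun y : ℝ => c / √y) Filter.atTop (nhds 0) :=
    tendsto_const_nhds.div_atTop Real.tendsto_sqrt_atTop
  refine squeeze_zero' (Filter.Eventually.of_forall fun y => ?_) ?_ h0
  · rcases le_or_gt 0 y with h | h
    · positivity
    · rw [Real.sqrt_eq_zero_of_nonpos h.le, idealsLE_eq_empty (K := K) zero_lt_one]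
      simp
  · filter_upwards [Filter.eventually_ge_atTop 1] with y hy
    have hy0 : 0 < y := by linarith
    rw [div_le_div_iff₀ hy0 (Real.sqrt_pos.2 hy0)]
    calc _ ≤ c * √y * √y := by gcongr; exact (hbounds _ (Real.one_le_sqrt.2 hy)).2
      _ = c * y := by rw [mul_assoc, Real.mul_self_sqrt hy0.le]

/-- When N(a) > √y, log log N(a^k b) differs from log log y by a bounded amount, so the condition on
the ratio is pinched between two thresholds for ω(a) with the same limit t. The ideals with N(a) ≤
√y number O(√y) and are negligible. -/
theorem tendsto_card_ratioLE {k : ℕ} (hk : k ≠ 0) {b : Ideal (𝓞 K)} (hb : b ≠ ⊥) {c : ℝ}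
    (hc : IsGaussian (squarefreeCoprime b) c) {g : Ideal (𝓞 K) → ℝ}
    (hg : ∀ a, a ≠ ⊥ → a ∈ squarefreeCoprime b →
      g (a ^ k * b) = (primeDivisors a).card + g b) (t : ℝ) :
    Filter.Tendsto (fun y => ((ratioLE g k b t y).card : ℝ) / y) Filter.atTop
      (nhds (c * Phi t / rootNorm k b)) := by
  classical
  set q := rootNorm k b with hq
  have hq1 : 1 ≤ q := one_le_rootNorm k hb
  have hq0 : 0 < q := by linarith
  set D := Real.log k + Real.log 2 with hD
  set C := D * (1 + |t|) with hC
  have hthr (B : ℝ) : IsThreshold (fun y => sqrtLogLog y ^ 2 + t * sqrtLogLog y + B) t :=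
    isThreshold_base t B
  have hlow := (hc.tendsto_omegaLE_dilate hq0 (hthr (-C)) (-g b)).sub
    (tendsto_card_idealsLE_sqrt_div K)
  have hupp := (hc.tendsto_omegaLE_dilate hq0 (hthr C) (-g b)).add
    (tendsto_card_idealsLE_sqrt_div K)
  rw [sub_zero] at hlow
  rw [add_zero] at hupp
  have hkey : ∀ᶠ y in Filter.atTop, ∀ a ∈ membersLE (squarefreeCoprime b) (y / q),
      a ∉ idealsLE K (√y) →
      3 ≤ Ideal.absNorm (a ^ k * b) ∧
      (ratio g (a ^ k * b) ≤ t → ((primeDivisors a).card : ℝ) ≤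
        sqrtLogLog y ^ 2 + t * sqrtLogLog y + C + -g b) ∧
      (((primeDivisors a).card : ℝ) ≤ sqrtLogLog y ^ 2 + t * sqrtLogLog y + -C + -g b →
        ratio g (a ^ k * b) ≤ t) := by
    filter_upwards [Filter.eventually_ge_atTop (Real.exp 2),
      Real.tendsto_sqrt_atTop.eventually_ge_atTop 3,
      (tendsto_sqrtLogLog.eventually_ge_atTop (1 + D))] with y hy hy9 hs a ha ha'
    obtain ⟨h1, h2⟩ := mem_membersLE.1 ha
    obtain ⟨ha0, h3⟩ := mem_idealsLE.1 h1
    have h4 : √y < realNorm a := by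
      by_contra h
      exact ha' (mem_idealsLE.2 ⟨ha0, not_lt.1 h⟩)
    have ha1 : 0 < realNorm a := realNorm_pos ha0
    have h5 : √y < realNorm a * q := h4.trans_le (le_mul_of_one_le_right ha1.le hq1)
    have h6 : realNorm a * q ≤ y := (le_div_iff₀ hq0).1 h3
    have hD0 : 0 ≤ D := add_nonneg (Real.log_natCast_nonneg k) (Real.log_nonneg one_le_two)
    have h7 := abs_log_log_sub_le hk hy h6 h5
    have hN : ((Ideal.absNorm (a ^ k * b) : ℕ) : ℝ) = (realNorm a * q) ^ k :=
      realNorm_pow_mul hk a b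
    rw [← hN] at h7
    set L := Real.log (Real.log (Ideal.absNorm (a ^ k * b))) with hL
    have hs1 : 1 ≤ sqrtLogLog y := by linarith
    have hLpos : 0 < L := by
      have h8 := (abs_le.1 h7).1
      have : 1 + D ≤ sqrtLogLog y ^ 2 := by nlinarith
      linarith
    have h9 := abs_le.1 (abs_add_mul_sqrt_sub_le hs1 h7 hLpos.le t)
    have h10 : ratio g (a ^ k * b) ≤ t ↔ (primeDivisors a).card + g b ≤ L + t * √L := by
      rw [ratio, ← hL, div_le_iff₀ (Real.sqrt_pos.2 hLpos), hg a ha0 h2, sub_le_iff_le_add']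
    refine ⟨?_, fun h => ?_, fun h => ?_⟩
    · have h11 : (3 : ℝ) ≤ (Ideal.absNorm (a ^ k * b) : ℕ) := by
        rw [hN]
        have : 3 ≤ realNorm a * q := hy9.trans h5.le
        exact this.trans (le_self_pow₀ (by linarith) hk)
      exact_mod_cast h11
    · have := h10.1 h
      linarith [h9.2]
    · exact h10.2 (by linarith [h9.1])
  refine tendsto_of_tendsto_of_tendsto_of_le_of_le' hlow hupp ?_ ?_
  · filter_upwards [hkey, Filter.eventually_gt_atTop 0] with y h1 hy
    rw [← sub_div]
    gcongr
    rw [sub_le_iff_le_add, ← Nat.cast_add, Nat.cast_le]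
    refine (Finset.card_le_card (t := ratioLE g k b t y ∪ idealsLE K (√y)) fun a ha => ?_).trans
      (Finset.card_union_le _ _)
    obtain ⟨h2, h3, h4⟩ := mem_omegaLE.1 ha
    rw [Finset.mem_union]
    by_cases h : a ∈ idealsLE K (√y)
    · exact Or.inr h
    · have h5 := mem_membersLE.2 ⟨h2, h3⟩
      obtain ⟨h6, -, h7⟩ := h1 a h5 h
      exact Or.inl (Finset.mem_filter.2 ⟨h5, h6, h7 h4⟩)
  · filter_upwards [hkey, Filter.eventually_gt_atTop 0] with y h1 hy
    rw [← add_div]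
    gcongr
    rw [← Nat.cast_add, Nat.cast_le]
    refine (Finset.card_le_card (t := omegaLE (squarefreeCoprime b) (y / q)
      (sqrtLogLog y ^ 2 + t * sqrtLogLog y + C + -g b) ∪ idealsLE K (√y)) fun a ha => ?_).trans
      (Finset.card_union_le _ _)
    obtain ⟨h2, h3⟩ := Finset.mem_filter.1 ha
    rw [Finset.mem_union]
    by_cases h : a ∈ idealsLE K (√y)
    · exact Or.inr h
    · obtain ⟨-, h7, -⟩ := h1 a h2 h
      obtain ⟨h8, h9⟩ := mem_membersLE.1 h2
      exact Or.inl (mem_omegaLE.2 ⟨h8, h9, h7 h3.2⟩)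

end Fibre

/-! ### Summing over the fibres. -/

section Assembly

variable {K : Type*} [Field K] [NumberField K]

theorem finite_squarefreeCoprime_exceptions {b : Ideal (𝓞 K)} (hb : b ≠ ⊥) :
    {p : HeightOneSpectrum (𝓞 K) | (if mult p b = 0 then 1 else 0) = 0}.Finite := by
  refine (primeDivisors b).finite_toSet.subset fun p hp => ?_
  rw [Finset.mem_coe, mem_primeDivisors hb, dvd_iff_mult_ne_zero p hb]
  intro h
  simp [h] at hp

theorem exists_isGaussian_squarefreeCoprime {b : Ideal (𝓞 K)} (hb : b ≠ ⊥) :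
    ∃ c : ℝ, IsGaussian (squarefreeCoprime b) c :=
  exists_isGaussian_forall_mult_le _ (finite_squarefreeCoprime_exceptions hb)

open scoped Classical in
theorem exists_summable_bound {k : ℕ} (hk : k ≠ 0) {E : Set ℕ} (hE : ∀ j ∈ E, k ≤ j) {c : ℝ}
    (hc : 0 ≤ c) : Summable fun b : Ideal (𝓞 K) =>
      if b ∈ exponentSet K (E \ {k}) then c / rootNorm k b else 0 := by
  obtain ⟨M, hM⟩ := exists_sum_rootNorm_inv_le K hk hE
  have hnn (b : Ideal (𝓞 K)) : 0 ≤ rootNorm k b := by unfold rootNorm; positivity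
  refine summable_of_sum_le (c := c * M) (fun b => ?_) fun G => ?_
  · have := hnn b
    positivity
  · rw [← Finset.sum_filter]
    simp_rw [div_eq_mul_inv, ← Finset.mul_sum]
    exact mul_le_mul_of_nonneg_left (hM _ fun b hb => (Finset.mem_filter.1 hb).2) hc

open scoped Classical in
-- Dominated convergence for series, with majorant c / N(b)^(1/k). If N(b)^(1/k) > y the term is
-- zero, so for each y > 0 the finite sum equals the full series.
theorem tendsto_sum_exponentSet {k : ℕ} (hk : k ≠ 0) {E : Set ℕ} (hE : ∀ j ∈ E, k ≤ j)
    (f : Ideal (𝓞 K) → ℝ → ℕ) (l : Ideal (𝓞 K) → ℝ)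
    (hf : ∀ b y, f b y ≤ (idealsLE K (y / rootNorm k b)).card)
    (hl : ∀ b ∈ exponentSet K (E \ {k}),
      Filter.Tendsto (fun y => (f b y : ℝ) / y) Filter.atTop (nhds (l b))) :
    Filter.Tendsto (fun y : ℝ => ((∑ b ∈ idealsLE K (y ^ k),
      if b ∈ exponentSet K (E \ {k}) then f b y else 0 : ℕ) : ℝ) / y) Filter.atTop
      (nhds (∑' b : Ideal (𝓞 K), if b ∈ exponentSet K (E \ {k}) then l b else 0)) := by
  obtain ⟨c₁, -, c, hc0, hbounds⟩ := exists_card_idealsLE_bounds K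
  have hc (t : ℝ) (ht : 0 < t) : ((idealsLE K t).card : ℝ) ≤ c * t := by
    rcases le_or_gt 1 t with h | h
    · exact (hbounds t h).2
    · rw [idealsLE_eq_empty (K := K) h]; simpa using by positivity
  have h1 := tendsto_tsum_of_dominated_convergence
    (f := fun (y : ℝ) (b : Ideal (𝓞 K)) =>
      if b ∈ exponentSet K (E \ {k}) then (f b y : ℝ) / y else 0)
    (g := fun b : Ideal (𝓞 K) => if b ∈ exponentSet K (E \ {k}) then l b else 0)
    (𝓕 := Filter.atTop) (exists_summable_bound (K := K) hk hE hc0.le)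
    (fun b => by
      by_cases h : b ∈ exponentSet K (E \ {k})
      · simpa [h] using hl b h
      · simp [h]) (by
      filter_upwards [Filter.eventually_gt_atTop 0] with y hy b
      split_ifs with h
      · have hq : 0 < rootNorm k b := zero_lt_one.trans_le (one_le_rootNorm k h.1)
        rw [Real.norm_of_nonneg (by positivity), div_le_iff₀ hy]
        refine (Nat.cast_le.2 (hf b y)).trans ((hc _ (by positivity)).trans (le_of_eq ?_))
        ring
      · simp)
  refine h1.congr' ?_
  filter_upwards [Filter.eventually_gt_atTop 0] with y hy
  rw [tsum_eq_sum (s := idealsLE K (y ^ k)) fun b hb => ?_]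
  · rw [Nat.cast_sum, Finset.sum_div]
    exact Finset.sum_congr rfl fun b _ => by split_ifs <;> simp
  · split_ifs with h
    · have hq : 0 < rootNorm k b := zero_lt_one.trans_le (one_le_rootNorm k h.1)
      have h2 : y < rootNorm k b := by
        by_contra h3
        refine hb (mem_idealsLE.2 ⟨h.1, ?_⟩)
        have := pow_le_pow_left₀ hq.le (not_lt.1 h3) k
        rwa [rootNorm_pow hk] at this
      have h4 := hf b y
      rw [idealsLE_eq_empty (K := K) ((div_lt_one hq).2 h2), Finset.card_empty] at h4
      rw [Nat.le_zero.1 h4]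
      simp
    · rfl

theorem card_membersLE_le (T : Set (Ideal (𝓞 K))) (y : ℝ) :
    (membersLE T y).card ≤ (idealsLE K y).card :=
  Finset.card_le_card fun _ hm => (mem_membersLE.1 hm).1

theorem one_mem_exponentSet (E : Set ℕ) : (1 : Ideal (𝓞 K)) ∈ exponentSet K E :=
  ⟨one_ne_zero, fun p hp => absurd (mult_one p) hp⟩

open scoped Classical in
theorem tendsto_card_exponentSet {k : ℕ} (hk : k ≠ 0) {E : Set ℕ} (hkE : k ∈ E)
    (hE : ∀ j ∈ E, k ≤ j) {c : Ideal (𝓞 K) → ℝ}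
    (hc : ∀ b, b ≠ ⊥ → IsGaussian (squarefreeCoprime b) (c b)) :
    Filter.Tendsto (fun y : ℝ => ((membersLE (exponentSet K E) (y ^ k)).card : ℝ) / y) Filter.atTop
      (nhds (∑' b : Ideal (𝓞 K),
        if b ∈ exponentSet K (E \ {k}) then c b / rootNorm k b else 0)) := by
  refine (tendsto_sum_exponentSet hk hE
    (fun b y => (membersLE (squarefreeCoprime b) (y / rootNorm k b)).card) _
    (fun b y => card_membersLE_le _ _) fun b hb => (hc b hb.1).tendsto_card_dilate
      (zero_lt_one.trans_le (one_le_rootNorm k hb.1))).congr' ?_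
  filter_upwards [Filter.eventually_ge_atTop 0] with y hy
  have h := card_filter_exponentSet hk hkE hy (fun _ : Ideal (𝓞 K) => True)
  simp only [Finset.filter_true] at h
  rw [h]

open scoped Classical in
theorem tendsto_card_ratio_exponentSet {k : ℕ} (hk : k ≠ 0) {E : Set ℕ} (hkE : k ∈ E)
    (hE : ∀ j ∈ E, k ≤ j) {c : Ideal (𝓞 K) → ℝ}
    (hc : ∀ b, b ≠ ⊥ → IsGaussian (squarefreeCoprime b) (c b)) {g : Ideal (𝓞 K) → ℝ}
    (hg : ∀ a b, a ≠ ⊥ → b ∈ exponentSet K (E \ {k}) → a ∈ squarefreeCoprime b →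
      g (a ^ k * b) = (primeDivisors a).card + g b) (t : ℝ) :
    Filter.Tendsto (fun y : ℝ => (((membersLE (exponentSet K E) (y ^ k)).filter fun m =>
      3 ≤ Ideal.absNorm m ∧ ratio g m ≤ t).card : ℝ) / y) Filter.atTop
      (nhds ((∑' b : Ideal (𝓞 K),
        if b ∈ exponentSet K (E \ {k}) then c b / rootNorm k b else 0) * Phi t)) := by
  have h1 : (∑' b : Ideal (𝓞 K),
        if b ∈ exponentSet K (E \ {k}) then c b / rootNorm k b else 0) * Phi t =
      ∑' b : Ideal (𝓞 K),
        if b ∈ exponentSet K (E \ {k}) then c b * Phi t / rootNorm k b else 0 := by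
    rw [← tsum_mul_right]
    refine tsum_congr fun b => ?_
    split_ifs
    · ring
    · ring
  rw [h1]
  refine (tendsto_sum_exponentSet hk hE (fun b y => (ratioLE g k b t y).card) _
    (fun b y => (Finset.card_le_card (Finset.filter_subset _ _)).trans (card_membersLE_le _ _))
    fun b hb => tendsto_card_ratioLE hk hb.1 (hc b hb.1) (fun a ha => hg a b ha hb) t).congr' ?_
  filter_upwards [Filter.eventually_ge_atTop 0] with y hy
  rw [card_filter_exponentSet hk hkE hy]
  rfl

theorem IsGaussian.nonneg {T : Set (Ideal (𝓞 K))} {c : ℝ} (h : IsGaussian T c) : 0 ≤ c :=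
  ge_of_tendsto h.tendsto_card ((Filter.eventually_ge_atTop 0).mono fun y hy => by positivity)

theorem IsGaussian.le_of_subset {T T' : Set (Ideal (𝓞 K))} {c c' : ℝ} (h : IsGaussian T c)
    (h' : IsGaussian T' c') (hT : T ⊆ T') : c ≤ c' := by
  refine le_of_tendsto_of_tendsto h.tendsto_card h'.tendsto_card
    ((Filter.eventually_ge_atTop 0).mono fun y hy => ?_)
  dsimp only
  gcongr
  intro m hm
  rw [mem_membersLE] at hm ⊢
  exact ⟨hm.1, hT hm.2⟩

theorem squarefreeCoprime_subset_one (b : Ideal (𝓞 K)) :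
    squarefreeCoprime b ⊆ squarefreeCoprime (1 : Ideal (𝓞 K)) := fun a ha p => by
  rw [mult_one, if_pos rfl]
  refine (ha p).trans ?_
  split_ifs <;> simp

/-- If squarefree ideals had density zero, so would those coprime to any b. The decomposition with k
= 1 and all exponents allowed would then give the set of all ideals density at most zero, whereas κ
> 0. -/
theorem IsGaussian.squarefree_pos {c : ℝ} (hc1 : IsGaussian (squarefreeCoprime (1 : Ideal (𝓞 K))) c) :
    0 < c := by
  classical
  by_contra hneg
  have hsel (b : Ideal (𝓞 K)) : ∃ c : ℝ, b ≠ ⊥ → IsGaussian (squarefreeCoprime b) c := by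
    by_cases hb : b = ⊥
    · exact ⟨0, fun h => absurd hb h⟩
    · obtain ⟨c, hc⟩ := exists_isGaussian_squarefreeCoprime hb
      exact ⟨c, fun _ => hc⟩
  choose d hd using hsel
  obtain ⟨κ, hκ, hlim, -⟩ := tendsto_card_filter_idealsLE K
  have h1 := tendsto_card_exponentSet one_ne_zero (E := {j | 1 ≤ j}) (by simp)
    (fun j hj => hj) hd
  have h2 (y : ℝ) : membersLE (exponentSet K {j | 1 ≤ j}) (y ^ 1) = idealsLE K y := by
    ext m
    rw [mem_membersLE, pow_one]
    exact ⟨fun h => h.1, fun h => ⟨h, (mem_idealsLE.1 h).1, fun p hp =>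
      Nat.one_le_iff_ne_zero.2 hp⟩⟩
  simp_rw [h2] at h1
  have h3 := tendsto_nhds_unique hlim h1
  refine hκ.not_ge (h3.le.trans (tsum_nonpos fun b => ?_))
  split_ifs with hb
  · have h4 := (hd b hb.1).le_of_subset hc1 (squarefreeCoprime_subset_one b)
    exact div_nonpos_of_nonpos_of_nonneg (h4.trans (not_lt.1 hneg))
      (zero_le_one.trans (one_le_rootNorm 1 hb.1))
  · exact le_rfl

theorem ncard_upTo (S : Set (Ideal (𝓞 K))) (hS : ∀ m ∈ S, m ≠ ⊥) (x : ℚ) :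
    (upTo S x).ncard = (membersLE S (x : ℝ)).card := by
  rw [← Set.ncard_coe_finset]
  congr 1
  ext m
  rw [Finset.mem_coe, mem_membersLE, mem_idealsLE]
  refine ⟨fun h => ⟨⟨hS m h.1, by exact_mod_cast h.2⟩, h.1⟩, fun h => ⟨h.2, by exact_mod_cast h.1.2⟩⟩

open scoped Classical in
theorem ncard_upTo_ratio (S : Set (Ideal (𝓞 K))) (hS : ∀ m ∈ S, m ≠ ⊥) (g : Ideal (𝓞 K) → ℝ)
    (t : ℝ) (x : ℚ) : {m ∈ upTo S x | 3 ≤ Ideal.absNorm m ∧ ratio g m ≤ t}.ncard =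
      ((membersLE S (x : ℝ)).filter fun m => 3 ≤ Ideal.absNorm m ∧ ratio g m ≤ t).card := by
  rw [← Set.ncard_coe_finset]
  congr 1
  ext m
  rw [Finset.mem_coe, Finset.mem_filter, mem_membersLE, mem_idealsLE]
  refine ⟨fun h => ⟨⟨⟨hS m h.1.1, by exact_mod_cast h.1.2⟩, h.1.1⟩, h.2⟩,
    fun h => ⟨⟨h.1.2, by exact_mod_cast h.1.1.2⟩, h.2⟩⟩

/-- With y = x^(1/k), the whole set and the part below t are asymptotic to C y and C Φ(t) y with the
same C, which is positive because of the term b = 1. -/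
theorem tendsto_density_exponentSet {k : ℕ} (hk : k ≠ 0) {E : Set ℕ} (hkE : k ∈ E)
    (hE : ∀ j ∈ E, k ≤ j) {g : Ideal (𝓞 K) → ℝ}
    (hg : ∀ a b, a ≠ ⊥ → b ∈ exponentSet K (E \ {k}) → a ∈ squarefreeCoprime b →
      g (a ^ k * b) = (primeDivisors a).card + g b) (t : ℝ) :
    Filter.Tendsto (density (exponentSet K E) g t) Filter.atTop (nhds (Phi t)) := by
  classical
  have hsel (b : Ideal (𝓞 K)) : ∃ c : ℝ, b ≠ ⊥ → IsGaussian (squarefreeCoprime b) c := by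
    by_cases hb : b = ⊥
    · exact ⟨0, fun h => absurd hb h⟩
    · obtain ⟨c, hc⟩ := exists_isGaussian_squarefreeCoprime hb
      exact ⟨c, fun _ => hc⟩
  choose c hc using hsel
  have h1 := tendsto_card_exponentSet hk hkE hE hc
  have h2 := tendsto_card_ratio_exponentSet hk hkE hE hc hg t
  set C := ∑' b : Ideal (𝓞 K), if b ∈ exponentSet K (E \ {k}) then c b / rootNorm k b else 0 with hC
  have hnn (b : Ideal (𝓞 K)) :
      0 ≤ if b ∈ exponentSet K (E \ {k}) then c b / rootNorm k b else 0 := by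
    split_ifs with hb
    · exact div_nonneg (hc b hb.1).nonneg (zero_le_one.trans (one_le_rootNorm k hb.1))
    · exact le_rfl
  have hone : (1 : Ideal (𝓞 K)) ≠ ⊥ := one_ne_zero
  have hCpos : 0 < C := by
    have hsum : Summable fun b : Ideal (𝓞 K) =>
        if b ∈ exponentSet K (E \ {k}) then c b / rootNorm k b else 0 := by
      refine Summable.of_nonneg_of_le hnn (fun b => ?_)
        (exists_summable_bound (K := K) hk hE (hc 1 hone).nonneg)
      split_ifs with hb
      · have := zero_le_one.trans (one_le_rootNorm k hb.1)
        gcongr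
        exact (hc b hb.1).le_of_subset (hc 1 hone) (squarefreeCoprime_subset_one b)
      · exact le_rfl
    refine lt_of_lt_of_le ?_ (hsum.le_tsum 1 fun b _ => hnn b)
    rw [if_pos (one_mem_exponentSet _)]
    exact div_pos (hc 1 hone).squarefree_pos (zero_lt_one.trans_le (one_le_rootNorm k hone))
  have h3 := h2.div h1 hCpos.ne'
  rw [mul_div_cancel_left₀ _ hCpos.ne'] at h3
  have hroot : Filter.Tendsto (fun x : ℚ => (x : ℝ) ^ ((k : ℝ)⁻¹)) Filter.atTop Filter.atTop :=
    (tendsto_rpow_atTop (by positivity)).comp (tendsto_ratCast_atTop_iff.2 Filter.tendsto_id)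
  refine (h3.comp hroot).congr' ?_
  filter_upwards [Filter.eventually_gt_atTop 0] with x hx
  have hx' : (0 : ℝ) < x := by exact_mod_cast hx
  have hy : 0 < (x : ℝ) ^ ((k : ℝ)⁻¹) := by positivity
  simp only [Function.comp_apply, Pi.div_apply, density]
  rw [Real.rpow_inv_natCast_pow hx'.le hk, ncard_upTo _ fun m hm => hm.1,
    ncard_upTo_ratio _ fun m hm => hm.1]
  rw [div_div_div_cancel_right₀ hy.ne', one_div_mul_eq_div]

end Assembly

/-! ### The functions ω_𝒜 and the two families of ideals. -/

section Additive

variable {K : Type*} [Field K] [NumberField K]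

theorem omegaMult_eq_card {m : Ideal (𝓞 K)} (hm : m ≠ ⊥) {i : ℕ} (hi : 1 ≤ i) :
    omegaMult i m = ((primeDivisors m).filter fun p => mult p m = i).card := by
  rw [omegaMult, ← Set.ncard_coe_finset]
  congr 1
  ext p
  rw [Finset.mem_coe, Finset.mem_filter, mem_primeDivisors hm, dvd_iff_mult_ne_zero p hm]
  exact ⟨fun h => ⟨by rw [show mult p m = i from h]; omega, h⟩, fun h => h.2⟩

theorem omegaSeq_eq_sum (A : ℕ → ℝ) {m : Ideal (𝓞 K)} (hm : m ≠ ⊥) :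
    omegaSeq A m = ∑ p ∈ primeDivisors m, A (mult p m) := by
  classical
  rw [Finset.sum_comp A fun p => mult p m, omegaSeq]
  have hI (i : ℕ) (hi : i ∈ (primeDivisors m).image fun p => mult p m) : 1 ≤ i := by
    obtain ⟨p, hp, rfl⟩ := Finset.mem_image.1 hi
    rw [mem_primeDivisors hm, dvd_iff_mult_ne_zero p hm] at hp
    omega
  rw [← finsum_mem_coe_finset]
  have h1 : (∑ᶠ (i : ℕ) (_ : 1 ≤ i), A i * (omegaMult i m : ℝ)) =
      ∑ᶠ (i : ℕ) (_ : i ∈ {i : ℕ | 1 ≤ i}), A i * (omegaMult i m : ℝ) := rfl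
  rw [h1]
  have h2 : ∑ᶠ (i : ℕ) (_ : i ∈ (((primeDivisors m).image fun p => mult p m : Finset ℕ) : Set ℕ)),
      A i * (omegaMult i m : ℝ) = ∑ᶠ (i : ℕ) (_ : i ∈ {i : ℕ | 1 ≤ i}),
        A i * (omegaMult i m : ℝ) := by
    refine finsum_mem_inter_support_eq _ _ _ ?_
    ext i
    simp only [Set.mem_inter_iff, Finset.mem_coe]
    refine and_congr_left fun hi => ⟨fun h => hI i h, fun h => ?_⟩
    by_contra h3
    refine hi ?_
    have h4 : ((primeDivisors m).filter fun p => mult p m = i) = ∅ :=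
      Finset.filter_eq_empty_iff.2 fun p hp h5 => h3 (Finset.mem_image.2 ⟨p, hp, h5⟩)
    change A i * (omegaMult i m : ℝ) = 0
    rw [omegaMult_eq_card hm h, h4]
    simp
  rw [← h2]
  refine finsum_mem_congr rfl fun i hi => ?_
  rw [omegaMult_eq_card hm (hI i hi), nsmul_eq_mul, mul_comm]

/-- The primes of a occur in a^k b with exponent exactly k and do not divide b, so the sum over
prime divisors splits into the two parts. -/
theorem omegaSeq_pow_mul (A : ℕ → ℝ) {k : ℕ} (hk : k ≠ 0) {a b : Ideal (𝓞 K)} (ha : a ≠ ⊥)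
    (hb : b ≠ ⊥) (hab : a ∈ squarefreeCoprime b) :
    omegaSeq A (a ^ k * b) = A k * (primeDivisors a).card + omegaSeq A b := by
  classical
  have hak : a ^ k ≠ ⊥ := pow_ne_zero k ha
  have h1 : primeDivisors (a ^ k) = primeDivisors a := by
    ext p
    rw [mem_primeDivisors hak, mem_primeDivisors ha, p.prime.dvd_pow_iff_dvd hk]
  have h2 (p : HeightOneSpectrum (𝓞 K)) (hp : p ∈ primeDivisors a) :
      mult p a = 1 ∧ mult p b = 0 := by
    rw [mem_primeDivisors ha, dvd_iff_mult_ne_zero p ha] at hp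
    have h3 := hab p
    split_ifs at h3 with h
    · exact ⟨by omega, h⟩
    · omega
  have h4 : Disjoint (primeDivisors a) (primeDivisors b) := Finset.disjoint_left.2 fun p hp hp' => by
    rw [mem_primeDivisors hb, dvd_iff_mult_ne_zero p hb] at hp'
    exact hp' (h2 p hp).2
  rw [omegaSeq_eq_sum A (mul_ne_bot' hak hb), omegaSeq_eq_sum A hb, primeDivisors_mul hak hb, h1,
    Finset.sum_union h4]
  congr 1
  · rw [Finset.sum_congr rfl fun p hp => by
      rw [mult_pow_mul ha hb, (h2 p hp).1, (h2 p hp).2, mul_one, add_zero], Finset.sum_const,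
      nsmul_eq_mul, mul_comm]
  · refine Finset.sum_congr rfl fun p hp => ?_
    have h5 : mult p a = 0 := by
      rw [← notMem_primeDivisors_iff ha]
      exact fun h => Finset.disjoint_left.1 h4 h hp
    rw [mult_pow_mul ha hb, h5, mul_zero, zero_add]

/-- All that the argument takes from the five types: it permits division by a_k. -/
theorem Admissible.ne_zero {k : ℕ} (hk : 1 ≤ k) {A : ℕ → ℝ} (hA : Admissible k A) : A k ≠ 0 := by
  rcases hA with h | h | h | h | h
  · rw [h k hk]; exact one_ne_zero
  · rw [h k hk]; exact_mod_cast Nat.one_le_iff_ne_zero.1 hk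
  · rw [h k hk]
    have : (1 : ℝ) ≤ k := by exact_mod_cast hk
    exact (Real.log_pos (by linarith)).ne'
  · rcases Nat.even_or_odd k with h1 | h1
    · rw [(h k hk).2 h1]; norm_num
    · rw [(h k hk).1 h1]; norm_num
  · rw [h.1]; exact one_ne_zero

theorem tendsto_density_omegaSeq {k : ℕ} (hk : 1 ≤ k) {E : Set ℕ} (hkE : k ∈ E)
    (hE : ∀ j ∈ E, k ≤ j) {A : ℕ → ℝ} (hA : A k ≠ 0) (t : ℝ) :
    Filter.Tendsto (density (exponentSet K E) (fun m => 1 / A k * omegaSeq A m) t) Filter.atTop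
      (nhds (Phi t)) := by
  have hk0 : k ≠ 0 := Nat.one_le_iff_ne_zero.1 hk
  refine tendsto_density_exponentSet hk0 hkE hE (fun a b ha hb hab => ?_) t
  rw [omegaSeq_pow_mul A hk0 ha hb.1 hab]
  field_simp

theorem fullIdeals_eq_exponentSet (K : Type*) [Field K] [NumberField K] (k : ℕ) :
    fullIdeals K k = exponentSet K {j | k ≤ j} := by
  ext m
  refine and_congr_right fun hm => forall_congr' fun p => ?_
  rw [dvd_iff_mult_ne_zero p hm]
  rfl

theorem freeIdeals_eq_exponentSet (K : Type*) [Field K] [NumberField K] (h : ℕ) :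
    freeIdeals K h = exponentSet K {j | 1 ≤ j ∧ j ≤ h - 1} := by
  ext m
  refine and_congr_right fun hm => forall_congr' fun p => ?_
  rw [dvd_iff_mult_ne_zero p hm]
  exact ⟨fun h1 h2 => ⟨Nat.one_le_iff_ne_zero.2 h2, h1 h2⟩, fun h1 h2 => (h1 h2).2⟩

end Additive

end ErdosKac
end

theorem mainTheorem10 (K : Type*) [Field K] [NumberField K] :
    (∀ k : ℕ, 1 ≤ k → ∀ A : ℕ → ℝ, ErdosKac.Admissible k A → ∀ a : ℝ,
      Filter.Tendsto
        (ErdosKac.density (ErdosKac.fullIdeals K k)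
          (fun m => 1 / A k * ErdosKac.omegaSeq A m) a)
        Filter.atTop (nhds (ErdosKac.Phi a))) ∧
    (∀ h : ℕ, 2 ≤ h → ∀ A : ℕ → ℝ, ErdosKac.Admissible 1 A → ∀ a : ℝ,
      Filter.Tendsto
        (ErdosKac.density (ErdosKac.freeIdeals K h)
          (fun m => 1 / A 1 * ErdosKac.omegaSeq A m) a)
        Filter.atTop (nhds (ErdosKac.Phi a))) := by
  refine ⟨fun k hk A hA a => ?_, fun h hh A hA a => ?_⟩
  · rw [ErdosKac.fullIdeals_eq_exponentSet]
    exact ErdosKac.tendsto_density_omegaSeq (E := {j | k ≤ j}) hk (by simp) (fun j hj => hj)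
      (hA.ne_zero hk) a
  · rw [ErdosKac.freeIdeals_eq_exponentSet]
    -- The condition h ≥ 2 is what puts the exponent 1 in the allowed set, so the least exponent is
    -- 1.
    exact ErdosKac.tendsto_density_omegaSeq le_rfl (by simp; omega) (fun j hj => hj.1)
      (hA.ne_zero le_rfl) a
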